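/- **Setting.** Let $1<\beta\le 2$ and $\tau(x)=\beta x-[\beta x]$ on $[0,1]$. Put $g_n(x)=[\beta\tau^{n-1}(x)]$ for $n\ge1$, and call $x$ simple if $\beta\tau^{n-1}(x)$ is a positive integer for some $n\ge 1$ (for $\beta<2$ this means $\tau^{n-1}(x)=1/\beta$). Let $\underline 1=(q_n)_{n\ge1}$ be the quasi-greedy expansion of $1$: $q_n=g_n(1)$ if $1$ is not simple, and the periodic sequence with period $g_1(1)\cdots g_{S-1}(1)(g_S(1)-1)$ if $1$ is simple, $S$ being the least $n$ such that $\beta\tau^{n-1}(1)$ is a positive integer. Let $X_\beta\subset\{0,1\}^{\mathbb N}$ be the closure, in the product topology, of $\{(g_n(x))_{n\ge1}: x\in[0,1]\text{ not simple}\}$. Let $\sigma$ be the left shift, $\preceq$ the lexicographic order, $\underline 0=000\cdots$ and $[\underline 0,\underline a]=\{\underline x\in X_\beta:\underline x\preceq\underline a\}$. Let $BV$ be the space of functions $f:X_\beta\to\mathbb C$ of bounded variation with respect to $\preceq$, with norm $|f|_\infty+\operatorname{var}(f)$. Let $\mathcal N\subset BV$ be the subspace of functions vanishing off a countable set, and let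 $\mathcal B=BV/\mathcal N$ with the quotient norm $\|\cdot\|_{\mathcal B}$. Let $\mathcal F\subset\mathcal B$ be the closed linear span of the indicator functions of intervals of $X_\beta$. For $t\in\mathbb R$ let $\phi=t\chi_{C_1}$ with $C_1=\{\underline x\in X_\beta:x_1=1\}$, let $\mathcal L_tf(\underline x)=\sum_{\sigma(\underline y)=\underline x}e^{\phi(\underline y)}f(\underline y)$, a bounded operator on $\mathcal F$, and let $$r_t=\limsup_{n\to\infty}\Bigl(\sup_{X_\beta}\exp\sum_{i=0}^{n-1}\phi\circ\sigma^i\Bigr)^{1/n},\quad H_n(t,\underline a)=e^{t(a_1+\cdots+a_n)},\quad \phi_t(z)=\sum_{n\ge1}q_nH_{n-1}(t,\underline 1)z^n .$$ An isolated eigenvalue is an eigenvalue of $\mathcal L_t$ on $\mathcal F$ that is an isolated point of the spectrum. An eigenfunctional for $\lambda$ is a bounded linear functional $\nu$ on $\mathcal F$ with $\nu\circ\mathcal L_t=\lambda\nu$. **Theorem.** Let $1<\beta\le2$ and $t\in\mathbb R$. (1) Let $\lambda\in\mathbb C$ be an isolated eigenvalue of $\mathcal L_t$ with $|\lambda|>r_t$.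 Then its geometric multiplicity is $1$, there is exactly one eigenfunctional $\nu$ for $\lambda$ with $\nu(1)=1$, and $$\nu(\chi_{[\underline 0,\underline a]})=\sum_{n=1}^\infty\frac{a_nH_{n-1}(t,\underline a)}{\lambda^n}\qquad(\underline a=(a_i)_{i\ge1}\in X_\beta).\tag{$*$}$$ The series $\sum_{n\ge0}\frac{H_n(t,\underline 1)}{\lambda^n}\chi_{[\underline 0,\sigma^n(\underline 1)]}$ converges in $\mathcal F$, and every eigenfunction for $\lambda$ is a constant $C\in\mathbb C$ times its sum. (2) There are a positive eigenvalue $\lambda_t$ of $\mathcal L_t$ and an eigenfunctional $\nu_t$ for $\lambda_t$ with $\nu_t(1)=1$ and $\nu_t(f)\ge0$ for all $f\ge0$. For every such pair, $\lambda_t>r_t$, and $\lambda_t$ is an isolated eigenvalue of algebraic multiplicity $1$. The functional $\nu_t$ is integration against a non-atomic Borel probability measure on $X_\beta$ (again denoted $\nu_t$) that satisfies $(*)$ with $\lambda=\lambda_t$. The normalizing constant $$F(t)=\sum_{n=1}^\infty\frac{n\,q_nH_{n-1}(t,\underline 1)}{\lambda_t^n}$$ is finite and positive, the series $$h_t=\frac1{F(t)}\sum_{n=0}^\infty\frac{H_n(t,\underline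 1)}{\lambda_t^n}\chi_{[\underline 0,\sigma^n(\underline 1)]}$$ converges pointwise, and $\mu_t=h_t\nu_t$ is a $\sigma$-invariant probability measure. (3) $|\lambda|<\lambda_t$ for every isolated eigenvalue $\lambda\ne\lambda_t$ with $|\lambda|>r_t$. The maximum $$\alpha=\max\bigl(\{r_t\}\cup\{|\lambda|:\ 1-\phi_t(\lambda^{-1})=0,\ \lambda\neq\lambda_t\}\bigr)$$ exists (where $\lambda$ ranges over the nonzero complex numbers at which the series $\phi_t(\lambda^{-1})$ converges absolutely), and $\alpha\in[r_t,\lambda_t)$. There is $K>0$ such that $$\Bigl|\int f\cdot g\circ\sigma^n\,d\mu_t-\int f\,d\mu_t\int g\,d\mu_t\Bigr|\le K\|f\|_{\mathcal B}\|g\|_{L^1(\mu_t)}\,\alpha^n\qquad(n\ge1,\ f\in\mathcal F,\ g\in L^1(\mu_t)).$$ Moreover, for every $\theta>\alpha$ there is $K_\theta>0$ such that this bound holds with $K_\theta(\theta/\lambda_t)^n$ in place of $K\alpha^n$. In particular $(\sigma,\mu_t)$ is exponentially mixing: the bound holds with $K'\rho^n$ for some $K'>0$ and some $\rho\in(0,1)$.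 -/

import Mathlib

open Set Filter Topology MeasureTheory

namespace BetaRPF

noncomputable section

/-- The beta-map `x ↦ βx - [βx]`. -/
def betaMap (β x : ℝ) : ℝ := β * x - ⌊β * x⌋₊

/-- The greedy digits of `x`; `greedyDigit β x n` is the `(n+1)`-st one, `[β τⁿ(x)]`. -/
def greedyDigit (β x : ℝ) (n : ℕ) : ℕ := ⌊β * (betaMap β)^[n] x⌋₊

/-- `β τⁿ(x)` is a positive integer. For `x ∈ [0,1]` and `1 < β < 2` this says `τⁿ(x) = 1/β`
(because `β τⁿ(x) < 2`); for `β = 2` it also covers `τⁿ(x) = 1`, that is `n = 0` and `x = 1`. -/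
def HitsAt (β x : ℝ) (n : ℕ) : Prop := ∃ k : ℕ, 0 < k ∧ β * (betaMap β)^[n] x = k

/-- `x` is simple: its greedy expansion is finite and nonzero. -/
def IsSimple (β x : ℝ) : Prop := ∃ n, HitsAt β x n

/-- The shift on one-sided sequences of zeros and ones. -/
def shift (x : ℕ → Fin 2) : ℕ → Fin 2 := fun n => x (n + 1)

open Classical in
/-- The digits of the quasi-greedy expansion of `1`: if `1` is simple with finite greedy
expansion `g₁ … g_S`, the periodic sequence with period `g₁ … g_{S-1} (g_S - 1)`; otherwise the
greedy digits of `1`. (Indices start at `0`.) -/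
def quasiDigit (β : ℝ) (n : ℕ) : ℕ :=
  if h : IsSimple β 1 then
    if n % (Nat.find h + 1) = Nat.find h then greedyDigit β 1 (Nat.find h) - 1
    else greedyDigit β 1 (n % (Nat.find h + 1))
  else greedyDigit β 1 n

/-- The quasi-greedy expansion of `1` as a sequence of zeros and ones (for `1 < β ≤ 2` all
`quasiDigit β n` are at most `1`, see `quasiOne_val`). -/
def quasiOne (β : ℝ) : ℕ → Fin 2 := fun n => Fin.ofNat 2 (quasiDigit β n)

/-- The greedy codes of the non-simple points of `[0,1]`. -/
def codes (β : ℝ) : Set (ℕ → Fin 2) :=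
  {x | ∃ y ∈ Icc (0 : ℝ) 1, ¬ IsSimple β y ∧ ∀ n, (x n : ℕ) = greedyDigit β y n}

/-- The beta-shift, as a set of sequences: the closure of the codes in the product topology. -/
def betaSet (β : ℝ) : Set (ℕ → Fin 2) := closure (codes β)

/-! ### The quasi-greedy orbit of one -/

lemma step_aux {β z : ℝ} (hβ : 1 < β ∧ β ≤ 2) (hz0 : 0 < z) (hz1 : z ≤ 1)
    (h : ¬ ∃ k : ℕ, 0 < k ∧ β * z = k) :
    0 < betaMap β z ∧ betaMap β z < 1 ∧ ⌊β * z⌋₊ ≤ 1 := by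
  have hpos : 0 < β * z := mul_pos (by linarith [hβ.1]) hz0
  have h1 := Nat.floor_le hpos.le
  have h2 := Nat.lt_floor_add_one (β * z)
  have hne : (⌊β * z⌋₊ : ℝ) ≠ β * z := by
    intro he
    refine h ⟨⌊β * z⌋₊, ?_, he.symm⟩
    rcases Nat.eq_zero_or_pos ⌊β * z⌋₊ with h0 | h0
    · rw [h0] at he; exact absurd he (by simpa using hpos.ne)
    · exact h0
  have hlt : (⌊β * z⌋₊ : ℝ) < β * z := lt_of_le_of_ne h1 hne
  refine ⟨by unfold betaMap; linarith, by unfold betaMap; linarith, ?_⟩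
  have : (⌊β * z⌋₊ : ℝ) < 2 := by nlinarith [hβ.1, hβ.2]
  have : ⌊β * z⌋₊ < 2 := by exact_mod_cast this
  omega

lemma orbit_pos {β z : ℝ} (hβ : 1 < β ∧ β ≤ 2) (hz0 : 0 < z) (hz1 : z ≤ 1) (m : ℕ)
    (h : ∀ j < m, ¬ HitsAt β z j) :
    0 < (betaMap β)^[m] z ∧ (betaMap β)^[m] z ≤ 1 := by
  induction m with
  | zero => exact ⟨hz0, hz1⟩
  | succ m ih =>
    have h' := ih fun j hj => h j (by omega)
    have := step_aux hβ h'.1 h'.2 (h m (by omega))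
    rw [Function.iterate_succ_apply']
    exact ⟨this.1, this.2.1.le⟩

/-- The orbit of `1` behind the quasi-greedy expansion. -/
lemma quasi_orbit {β : ℝ} (hβ : 1 < β ∧ β ≤ 2) : ∃ w : ℕ → ℝ, w 0 = 1 ∧
    (∀ n, 0 < w n ∧ w n ≤ 1) ∧ (∀ n, w (n + 1) = β * w n - quasiDigit β n) ∧
    ∀ n, quasiDigit β n ≤ 1 := by
  classical
  by_cases hs : IsSimple β 1
  · set N := Nat.find hs with hN
    have hmin : ∀ j < N, ¬ HitsAt β 1 j := fun j hj => Nat.find_min hs hj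
    have hp : ∀ m ≤ N, 0 < (betaMap β)^[m] 1 ∧ (betaMap β)^[m] 1 ≤ 1 := fun m hm =>
      orbit_pos hβ one_pos le_rfl m fun j hj => hmin j (by omega)
    obtain ⟨k, hk0, hk⟩ : HitsAt β 1 N := Nat.find_spec hs
    have hg : greedyDigit β 1 N = k := by simp [greedyDigit, hk]
    have hk2 : k ≤ 2 := by
      have h1 := hp N le_rfl
      have : (k : ℝ) ≤ 2 := by rw [← hk]; nlinarith [hβ.1, hβ.2]
      exact_mod_cast this
    have hlt : ∀ n, n % (N + 1) ≤ N := fun n => Nat.lt_succ_iff.1 (Nat.mod_lt _ (by omega))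
    have hq : ∀ n, quasiDigit β n = if n % (N + 1) = N then k - 1
        else greedyDigit β 1 (n % (N + 1)) := by
      intro n; simp only [quasiDigit, dif_pos hs, ← hN, hg]
    refine ⟨fun n => (betaMap β)^[n % (N + 1)] 1, by simp, fun n => hp _ (hlt n), ?_, ?_⟩
    · intro n
      rw [hq]
      by_cases hn : n % (N + 1) = N
      · have h0 : (n + 1) % (N + 1) = 0 := by
          rw [Nat.add_mod, hn]
          rcases N with _ | N
          · simp
          · rw [Nat.mod_eq_of_lt (show 1 < N + 1 + 1 by omega)]; simp
        simp only [h0, hn, if_true, hk, Function.iterate_zero, id]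
        rw [Nat.cast_sub hk0]; simp
      · have h0 : (n + 1) % (N + 1) = n % (N + 1) + 1 := by
          have := hlt n
          rw [Nat.add_mod, Nat.mod_eq_of_lt (show 1 < N + 1 by omega), Nat.mod_eq_of_lt (by omega)]
        simp only [h0, if_neg hn, Function.iterate_succ_apply', greedyDigit, betaMap]
    · intro n
      rw [hq]
      split_ifs with hn
      · omega
      · have h1 : n % (N + 1) < N := lt_of_le_of_ne (hlt n) hn
        have h2 := hp _ h1.le
        exact (step_aux hβ h2.1 h2.2 (hmin _ h1)).2.2
  · have hns : ∀ j, ¬ HitsAt β 1 j := fun j hj => hs ⟨j, hj⟩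
    have hp := fun m => orbit_pos hβ one_pos le_rfl m fun j _ => hns j
    have hq : ∀ n, quasiDigit β n = greedyDigit β 1 n := by
      intro n; simp only [quasiDigit, dif_neg hs]
    refine ⟨fun n => (betaMap β)^[n] 1, rfl, hp, ?_, ?_⟩
    · intro n; rw [hq]; simp only [Function.iterate_succ_apply', greedyDigit, betaMap]
    · intro n; rw [hq]
      exact (step_aux hβ (hp n).1 (hp n).2 (hns n)).2.2

lemma quasiOne_val {β : ℝ} (hβ : 1 < β ∧ β ≤ 2) (n : ℕ) :
    ((quasiOne β n : Fin 2) : ℕ) = quasiDigit β n := by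
  obtain ⟨w, -, -, -, h⟩ := quasi_orbit hβ
  have := h n
  simp [quasiOne, Fin.ofNat]; omega

/-! ### Parry's description of the beta-shift -/

lemma lex_lt_iff {x y : ℕ → Fin 2} :
    toLex x < toLex y ↔ ∃ i, (∀ j < i, x j = y j) ∧ x i < y i := Iff.rfl

lemma isClosed_le (q : ℕ → Fin 2) : IsClosed {x : ℕ → Fin 2 | toLex x ≤ toLex q} := by
  rw [← isOpen_compl_iff]
  have : {x : ℕ → Fin 2 | toLex x ≤ toLex q}ᶜ =
      ⋃ i : ℕ, ({x | q i < x i} ∩ ⋂ j : Fin i, {x | q j = x j}) := by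
    ext x
    simp only [mem_compl_iff, mem_ofPred_eq, not_le, mem_iUnion, mem_inter_iff, mem_iInter]
    refine Iff.trans lex_lt_iff ⟨?_, ?_⟩
    · rintro ⟨i, h1, h2⟩; exact ⟨i, h2, fun j => h1 j j.2⟩
    · rintro ⟨i, h2, h1⟩; exact ⟨i, fun j hj => h1 ⟨j, hj⟩, h2⟩
  rw [this]
  refine isOpen_iUnion fun i => IsOpen.inter ?_ (isOpen_iInter_of_finite fun j => ?_)
  · exact (isOpen_discrete (Ioi (q i))).preimage (continuous_apply (A := fun _ => Fin 2) i)
  · exact (isOpen_discrete {a : Fin 2 | q j = a}).preimage (continuous_apply (A := fun _ => Fin 2) (j : ℕ))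

lemma continuous_shift : Continuous shift :=
  continuous_pi fun n => continuous_apply (n + 1)

lemma shift_iter (x : ℕ → Fin 2) (n m : ℕ) : shift^[n] x m = x (m + n) := by
  induction n generalizing m with
  | zero => rfl
  | succ n ih => rw [Function.iterate_succ_apply']; simp only [shift, ih]; congr 1; ring

lemma betaMap_mem {β z : ℝ} (hβ : 1 < β) (hz : z ∈ Icc (0 : ℝ) 1) :
    betaMap β z ∈ Icc (0 : ℝ) 1 := by
  have hpos : 0 ≤ β * z := mul_nonneg (by linarith) hz.1
  have h1 := Nat.floor_le hpos
  have h2 := Nat.lt_floor_add_one (β * z)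
  constructor <;> unfold betaMap <;> linarith

lemma not_isSimple_betaMap {β z : ℝ} (hz : ¬ IsSimple β z) : ¬ IsSimple β (betaMap β z) := by
  rintro ⟨n, k, hk, h⟩
  exact hz ⟨n + 1, k, hk, by rwa [Function.iterate_succ_apply]⟩

lemma shift_mem_codes {β : ℝ} (hβ : 1 < β) {x : ℕ → Fin 2} (hx : x ∈ codes β) :
    shift x ∈ codes β := by
  obtain ⟨y, hy, hs, h⟩ := hx
  refine ⟨betaMap β y, betaMap_mem hβ hy, not_isSimple_betaMap hs, fun n => ?_⟩
  simp only [shift, h, greedyDigit, Function.iterate_succ_apply]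

lemma code_le {β : ℝ} (hβ : 1 < β ∧ β ≤ 2) {x : ℕ → Fin 2} (hx : x ∈ codes β) :
    toLex x ≤ toLex (quasiOne β) := by
  obtain ⟨z, hz, hs, h⟩ := hx
  obtain ⟨w, w0, w1, ws, wd⟩ := quasi_orbit hβ
  by_contra hlt
  obtain ⟨i, hi, hlt⟩ := lex_lt_iff.1 (not_le.1 hlt)
  have hb : 0 < β := by linarith [hβ.1]
  have key : ∀ j ≤ i, (betaMap β)^[j] z ≤ w j := by
    intro j
    induction j with
    | zero => intro _; simpa [w0] using hz.2
    | succ j ih =>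
      intro hj
      have h1 := ih (by omega)
      have h2 : quasiDigit β j = greedyDigit β z j := by
        rw [← h, ← quasiOne_val hβ, hi j (by omega)]
      have h3 := mul_le_mul_of_nonneg_left h1 hb.le
      have h4 : betaMap β ((betaMap β)^[j] z) = β * (betaMap β)^[j] z - greedyDigit β z j := rfl
      rw [Function.iterate_succ_apply', ws, h2, h4]
      linarith
  have h1 := mul_le_mul_of_nonneg_left (key i le_rfl) hb.le
  have h2 : quasiDigit β i + 1 ≤ greedyDigit β z i := by
    rw [← h, ← quasiOne_val hβ]; exact hlt
  have h2' : (quasiDigit β i : ℝ) + 1 ≤ greedyDigit β z i := by exact_mod_cast h2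
  have h3 : β * w i ≤ quasiDigit β i + 1 := by linarith [ws i, (w1 (i + 1)).2]
  have h4 : (0 : ℝ) ≤ β * (betaMap β)^[i] z := by
    have : ∀ j, (betaMap β)^[j] z ∈ Icc (0 : ℝ) 1 := by
      intro j
      induction j with
      | zero => exact hz
      | succ j ih => rw [Function.iterate_succ_apply']; exact betaMap_mem hβ.1 ih
    exact mul_nonneg hb.le (this i).1
  have h5 : (greedyDigit β z i : ℝ) ≤ β * (betaMap β)^[i] z := Nat.floor_le h4
  exact hs ⟨i, greedyDigit β z i, by omega, by linarith⟩

lemma betaSet_shift_le {β : ℝ} (hβ : 1 < β ∧ β ≤ 2) {x : ℕ → Fin 2} (hx : x ∈ betaSet β)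
    (n : ℕ) : toLex (shift^[n] x) ≤ toLex (quasiOne β) := by
  have hcl : IsClosed {x : ℕ → Fin 2 | toLex (shift^[n] x) ≤ toLex (quasiOne β)} :=
    (isClosed_le (quasiOne β)).preimage (continuous_shift.iterate n)
  refine closure_minimal ?_ hcl hx
  intro y hy
  refine code_le hβ ?_
  induction n with
  | zero => exact hy
  | succ n ih =>
    rw [Function.iterate_succ_apply']
    exact shift_mem_codes hβ.1 (ih ((isClosed_le (quasiOne β)).preimage
      (continuous_shift.iterate n)))

/-- The value `∑ xₙ β⁻ⁿ` of a sequence of digits. -/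
def val (β : ℝ) (x : ℕ → Fin 2) : ℝ := ∑' n, ((x n : ℕ) : ℝ) * β⁻¹ ^ (n + 1)

/-- Sequences all of whose shifts are at most the quasi-greedy expansion of `1`. -/
def parrySet (β : ℝ) : Set (ℕ → Fin 2) :=
  {x | ∀ n, toLex (shift^[n] x) ≤ toLex (quasiOne β)}

lemma digit_le (x : ℕ → Fin 2) (n : ℕ) : ((x n : ℕ) : ℝ) ≤ 1 := by
  have : (x n : ℕ) ≤ 1 := by omega
  exact_mod_cast this

lemma val_summable {β : ℝ} (hβ : 1 < β) (x : ℕ → Fin 2) :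
    Summable fun n => ((x n : ℕ) : ℝ) * β⁻¹ ^ (n + 1) := by
  have hb : 0 < β := by linarith
  have hs : Summable fun n => β⁻¹ ^ (n + 1) :=
    (summable_nat_add_iff 1).2 (summable_geometric_of_lt_one (by positivity) (inv_lt_one_of_one_lt₀ hβ))
  refine Summable.of_nonneg_of_le (fun n => by positivity) (fun n => ?_) hs
  exact mul_le_of_le_one_left (by positivity) (digit_le x n)

lemma val_nonneg {β : ℝ} (hβ : 1 < β) (x : ℕ → Fin 2) : 0 ≤ val β x :=
  tsum_nonneg fun n => by have : 0 < β := by linarith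
                          positivity

lemma val_le {β : ℝ} (hβ : 1 < β) : ∃ C, 1 ≤ C ∧ ∀ x, val β x ≤ C := by
  have hb : 0 < β := by linarith
  have hs : Summable fun n => β⁻¹ ^ (n + 1) :=
    (summable_nat_add_iff 1).2 (summable_geometric_of_lt_one (by positivity) (inv_lt_one_of_one_lt₀ hβ))
  refine ⟨max 1 (∑' n, β⁻¹ ^ (n + 1)), le_max_left _ _, fun x => le_trans ?_ (le_max_right _ _)⟩
  exact (val_summable hβ x).tsum_le_tsum
    (fun n => mul_le_of_le_one_left (by positivity) (digit_le x n)) hs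

lemma val_rec {β : ℝ} (hβ : 1 < β) (x : ℕ → Fin 2) :
    β * val β x = (x 0 : ℕ) + val β (shift x) := by
  have hb : β ≠ 0 := by linarith
  unfold val
  rw [(val_summable hβ x).tsum_eq_zero_add, mul_add, ← tsum_mul_left]
  congr 1
  · rw [zero_add, pow_one]
    field_simp
  · congr 1
    ext n
    simp only [shift, pow_succ]
    field_simp

lemma val_rec_iter {β : ℝ} (hβ : 1 < β) (x : ℕ → Fin 2) (n : ℕ) :
    β * val β (shift^[n] x) = (x n : ℕ) + val β (shift^[n + 1] x) := by
  rw [val_rec hβ, Function.iterate_succ_apply', shift_iter]; simp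

lemma val_agree {β : ℝ} (hβ : 1 < β ∧ β ≤ 2) {w : ℕ → ℝ} (w0 : w 0 = 1)
    (ws : ∀ n, w (n + 1) = β * w n - quasiDigit β n) (x : ℕ → Fin 2) (k : ℕ)
    (h : ∀ j < k, x j = quasiOne β j) :
    β ^ k * (val β x - 1) = val β (shift^[k] x) - w k := by
  induction k with
  | zero => simp [w0]
  | succ k ih =>
    have h1 := ih fun j hj => h j (by omega)
    have h2 := val_rec_iter hβ.1 x k
    rw [h k (by omega), quasiOne_val hβ] at h2
    rw [ws, pow_succ, mul_comm _ β, mul_assoc, h1]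
    linarith

lemma shift_mem_parrySet {β : ℝ} {x : ℕ → Fin 2} (hx : x ∈ parrySet β) :
    shift x ∈ parrySet β := fun n => by
  have := hx (n + 1); rwa [Function.iterate_succ_apply] at this

lemma shift_iter_mem_parrySet {β : ℝ} {x : ℕ → Fin 2} (hx : x ∈ parrySet β) (n : ℕ) :
    shift^[n] x ∈ parrySet β := by
  induction n with
  | zero => exact hx
  | succ n ih => rw [Function.iterate_succ_apply']; exact shift_mem_parrySet ih

lemma val_lt_aux {β : ℝ} (hβ : 1 < β ∧ β ≤ 2) {w : ℕ → ℝ} (w0 : w 0 = 1)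
    (ws : ∀ n, w (n + 1) = β * w n - quasiDigit β n) {x : ℕ → Fin 2} (hx : x ∈ parrySet β)
    (hne : x ≠ quasiOne β) :
    ∃ k, β ^ (k + 1) * (val β x - 1) = val β (shift^[k + 1] x) - 1 - w (k + 1) := by
  have hlt : toLex x < toLex (quasiOne β) := lt_of_le_of_ne (hx 0) (by simpa using hne)
  obtain ⟨k, hk, hlt⟩ := lex_lt_iff.1 hlt
  refine ⟨k, ?_⟩
  have h1 := val_agree hβ w0 ws x k hk
  have h2 := val_rec_iter hβ.1 x k
  have h0 : (x k : ℕ) = 0 ∧ quasiDigit β k = 1 := by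
    have h3 : (x k : ℕ) < (quasiOne β k : ℕ) := hlt
    have h4 := (quasiOne β k).2
    rw [← quasiOne_val hβ]; omega
  rw [h0.1] at h2
  rw [ws, h0.2, pow_succ, mul_comm _ β, mul_assoc, h1]
  push_cast at h2 ⊢
  linarith

lemma val_le_one {β : ℝ} (hβ : 1 < β ∧ β ≤ 2) {x : ℕ → Fin 2} (hx : x ∈ parrySet β) :
    val β x ≤ 1 := by
  obtain ⟨w, w0, w1, ws, wd⟩ := quasi_orbit hβ
  obtain ⟨C, hC1, hC⟩ := val_le hβ.1
  have hb : 0 < β := by linarith [hβ.1]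
  have key : ∀ n, ∀ x ∈ parrySet β, val β x - 1 ≤ C * β⁻¹ ^ n := by
    intro n
    induction n with
    | zero => intro x _; simp; linarith [hC x]
    | succ n ih =>
      intro x hx
      by_cases hq : x = quasiOne β
      · have h1 := val_agree hβ w0 ws x (n + 1) (fun j _ => by rw [hq])
        have h2 : β ^ (n + 1) * (val β x - 1) ≤ C := by
          rw [h1]; linarith [hC (shift^[n + 1] x), (w1 (n + 1)).1]
        rw [inv_pow, ← div_eq_mul_inv, le_div_iff₀ (by positivity)]
        linarith
      · obtain ⟨k, hk⟩ := val_lt_aux hβ w0 ws hx hq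
        have h3 := ih _ (shift_iter_mem_parrySet hx (k + 1))
        have hpos : 0 ≤ C * β⁻¹ ^ n := by positivity
        have h4 : β ^ (k + 1) * (val β x - 1) ≤ C * β⁻¹ ^ n := by
          rw [hk]; linarith [(w1 (k + 1)).1]
        by_cases hv : val β x - 1 ≤ 0
        · exact hv.trans (by positivity)
        · push Not at hv
          have h5 : β * (val β x - 1) ≤ C * β⁻¹ ^ n := by
            refine le_trans (mul_le_mul_of_nonneg_right ?_ hv.le) h4
            exact le_self_pow₀ hβ.1.le (by omega)
          rw [pow_succ, ← mul_assoc, ← div_eq_mul_inv, le_div_iff₀ hb]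
          linarith
  have ht : Tendsto (fun n : ℕ => C * β⁻¹ ^ n) atTop (𝓝 (C * 0)) :=
    (tendsto_pow_atTop_nhds_zero_of_lt_one (by positivity)
      (inv_lt_one_of_one_lt₀ hβ.1)).const_mul C
  have := ge_of_tendsto' ht fun n => key n x hx
  linarith

lemma val_lt_one {β : ℝ} (hβ : 1 < β ∧ β ≤ 2) {x : ℕ → Fin 2} (hx : x ∈ parrySet β)
    (hne : x ≠ quasiOne β) : val β x < 1 := by
  obtain ⟨w, w0, w1, ws, wd⟩ := quasi_orbit hβ
  obtain ⟨k, hk⟩ := val_lt_aux hβ w0 ws hx hne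
  have h1 := val_le_one hβ (shift_iter_mem_parrySet hx (k + 1))
  have hb : 0 < β := by linarith [hβ.1]
  have h2 : β ^ (k + 1) * (val β x - 1) < 0 := by rw [hk]; linarith [(w1 (k + 1)).1]
  have := neg_of_mul_neg_right h2 (by positivity)
  linarith

lemma val_quasiOne_pos {β : ℝ} (hβ : 1 < β ∧ β ≤ 2) (n : ℕ) :
    0 < val β (shift^[n] (quasiOne β)) := by
  obtain ⟨w, w0, w1, ws, wd⟩ := quasi_orbit hβ
  have hb : 0 < β := by linarith [hβ.1]
  obtain ⟨C, hC1, hC⟩ := val_le hβ.1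
  have h1 : ∀ k, β ^ k * (val β (quasiOne β) - 1) = val β (shift^[k] (quasiOne β)) - w k :=
    fun k => val_agree hβ w0 ws _ k fun _ _ => rfl
  have h2 : ∀ k : ℕ, |val β (quasiOne β) - 1| ≤ (C + 1) * β⁻¹ ^ k := by
    intro k
    have h3 : β ^ k * |val β (quasiOne β) - 1| ≤ C + 1 := by
      rw [← abs_of_pos (show 0 < β ^ k by positivity), ← abs_mul, h1, abs_le]
      have := val_nonneg hβ.1 (shift^[k] (quasiOne β))
      constructor <;> linarith [hC (shift^[k] (quasiOne β)), w1 k]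
    rw [inv_pow, ← div_eq_mul_inv, le_div_iff₀ (by positivity)]
    linarith
  have ht : Tendsto (fun n : ℕ => (C + 1) * β⁻¹ ^ n) atTop (𝓝 ((C + 1) * 0)) :=
    (tendsto_pow_atTop_nhds_zero_of_lt_one (by positivity)
      (inv_lt_one_of_one_lt₀ hβ.1)).const_mul _
  have h4 := ge_of_tendsto' ht h2
  have h5 : val β (quasiOne β) - 1 = 0 := by
    rw [← abs_nonpos_iff]; simpa using h4
  have := h1 n
  rw [h5] at this
  linarith [(w1 n).1]

lemma digits_step {β : ℝ} (hβ : 1 < β) (d : Fin 2) {y : ℝ} (hy : y ∈ Ioo (0 : ℝ) 1) {z : ℝ}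
    (hz : z = ((d : ℕ) + y) / β) : ⌊β * z⌋₊ = d ∧ betaMap β z = y := by
  have hb : β ≠ 0 := by linarith
  have h1 : β * z = (d : ℕ) + y := by rw [hz]; field_simp
  have h2 : ⌊β * z⌋₊ = d := by
    rw [h1, Nat.floor_eq_iff (by have := hy.1; positivity)]
    constructor <;> linarith [hy.1, hy.2]
  refine ⟨h2, ?_⟩
  unfold betaMap
  rw [h2, h1]; ring

lemma exists_interval {β : ℝ} (hβ : 1 < β ∧ β ≤ 2) (N : ℕ) : ∀ x ∈ parrySet β,
    ∃ a b : ℝ, 0 ≤ a ∧ a < b ∧ b ≤ 1 ∧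
      (0 < val β (shift^[N] x) → b ≤ val β x) ∧ (val β (shift^[N] x) = 0 → a ≤ val β x) ∧
      ∀ y ∈ Ioo a b, ∀ n < N, greedyDigit β y n = x n := by
  have hb : 0 < β := by linarith [hβ.1]
  induction N with
  | zero =>
    intro x hx
    rcases (val_nonneg hβ.1 x).eq_or_lt with h | h
    · exact ⟨0, 1, le_rfl, one_pos, le_rfl, fun h' => absurd h' (by simp [← h]),
        fun _ => h.le, fun y _ n hn => absurd hn (by omega)⟩
    · exact ⟨0, val β x, le_rfl, h, val_le_one hβ hx, fun _ => le_rfl,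
        fun _ => h.le, fun y _ n hn => absurd hn (by omega)⟩
  | succ N ih =>
    intro x hx
    obtain ⟨a, b, ha, hab, hb1, h1, h2, h3⟩ := ih (shift x) (shift_mem_parrySet hx)
    simp only [← Function.iterate_succ_apply] at h1 h2
    have hrec := val_rec hβ.1 x
    have hle := val_le_one hβ hx
    have hlt : ((x 0 : ℕ) + a) / β < 1 := by
      rw [div_lt_one hb]
      rcases (val_nonneg hβ.1 (shift^[N + 1] x)).eq_or_lt with h | h
      · have hq : x ≠ quasiOne β := by
          rintro rfl; exact (val_quasiOne_pos hβ (N + 1)).ne h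
        have h4 := h2 h.symm
        have h5 := mul_lt_mul_of_pos_left (val_lt_one hβ hx hq) hb
        linarith
      · have h4 := h1 h
        have h5 := mul_le_mul_of_nonneg_left hle hb.le
        linarith
    refine ⟨((x 0 : ℕ) + a) / β, min (((x 0 : ℕ) + b) / β) 1, by positivity,
      lt_min (by gcongr) hlt, min_le_right _ _, ?_, ?_, ?_⟩
    · intro h
      refine (min_le_left _ _).trans ?_
      rw [div_le_iff₀ hb]
      linarith [h1 h]
    · intro h
      rw [div_le_iff₀ hb]
      linarith [h2 h]
    · intro z hz n hn
      have hz1 := hz.1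
      have hz2 := hz.2.trans_le (min_le_left _ _)
      rw [div_lt_iff₀ hb] at hz1
      rw [lt_div_iff₀ hb] at hz2
      have hy : β * z - (x 0 : ℕ) ∈ Ioo a b := ⟨by linarith, by linarith⟩
      obtain ⟨h4, h5⟩ := digits_step hβ.1 (x 0) (y := β * z - (x 0 : ℕ))
        ⟨ha.trans_lt hy.1, hy.2.trans_le hb1⟩ (z := z) (by field_simp; ring)
      rcases n with _ | n
      · simpa [greedyDigit] using h4
      · have := h3 _ hy n (by omega)
        unfold greedyDigit at this ⊢
        rw [Function.iterate_succ_apply, h5]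
        exact this

lemma countable_simple {β : ℝ} (hβ : 1 < β) : {y : ℝ | IsSimple β y}.Countable := by
  have hb : β ≠ 0 := by linarith
  have h : ∀ n, {y : ℝ | ∃ k : ℕ, β * (betaMap β)^[n] y = k}.Countable := by
    intro n
    induction n with
    | zero =>
      refine (countable_range fun k : ℕ => (k : ℝ) / β).mono ?_
      rintro y ⟨k, hk⟩
      exact ⟨k, by simp at hk; field_simp; linarith⟩
    | succ n ih =>
      refine ((ih.prod (countable_univ (α := ℕ))).image
        fun p : ℝ × ℕ => (p.1 + p.2) / β).mono ?_
      rintro y ⟨k, hk⟩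
      refine ⟨(betaMap β y, ⌊β * y⌋₊), ⟨⟨k, hk⟩, mem_univ _⟩, ?_⟩
      simp only [betaMap]
      field_simp; ring
  refine (countable_iUnion h).mono ?_
  rintro y ⟨n, k, -, hk⟩
  exact mem_iUnion.2 ⟨n, k, hk⟩

lemma parrySet_subset {β : ℝ} (hβ : 1 < β ∧ β ≤ 2) : parrySet β ⊆ betaSet β := by
  intro x hx
  have h : ∀ N, ∃ z ∈ codes β, ∀ n < N, z n = x n := by
    intro N
    obtain ⟨a, b, ha, hab, hb1, -, -, h⟩ := exists_interval hβ N x hx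
    obtain ⟨y, hy, hyI⟩ := ((countable_simple hβ.1).dense_compl ℝ).exists_mem_open isOpen_Ioo
      (nonempty_Ioo.2 hab)
    have hd : ∀ n, greedyDigit β y n ≤ 1 := by
      intro n
      have hns : ∀ j, ¬ HitsAt β y j := fun j hj => hy ⟨j, hj⟩
      have h2 := orbit_pos hβ (ha.trans_lt hyI.1) (hyI.2.le.trans hb1) n fun j _ => hns j
      exact (step_aux hβ h2.1 h2.2 (hns n)).2.2
    have hv : ∀ n, ((Fin.ofNat 2 (greedyDigit β y n) : Fin 2) : ℕ) = greedyDigit β y n := by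
      intro n; have := hd n; simp [Fin.ofNat]; omega
    refine ⟨fun n => Fin.ofNat 2 (greedyDigit β y n),
      ⟨y, ⟨ha.trans hyI.1.le, hyI.2.le.trans hb1⟩, hy, hv⟩, fun n hn => ?_⟩
    ext
    rw [hv, h y hyI n hn]
  choose z hz hzx using h
  refine mem_closure_of_tendsto (f := z) (b := atTop) ?_ (Eventually.of_forall hz)
  rw [tendsto_pi_nhds]
  intro n
  refine tendsto_nhds_of_eventually_eq ?_
  filter_upwards [eventually_gt_atTop n] with N hN using hzx N n hN

/-- Parry's theorem. -/
lemma mem_betaSet_iff {β : ℝ} (hβ : 1 < β ∧ β ≤ 2) {x : ℕ → Fin 2} :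
    x ∈ betaSet β ↔ ∀ n, toLex (shift^[n] x) ≤ toLex (quasiOne β) :=
  ⟨fun hx n => betaSet_shift_le hβ hx n, fun hx => parrySet_subset hβ hx⟩

lemma shift_mem_betaSet {β : ℝ} (hβ : 1 < β ∧ β ≤ 2) {x : ℕ → Fin 2} (hx : x ∈ betaSet β) :
    shift x ∈ betaSet β :=
  (mem_betaSet_iff hβ).2 fun n => by
    rw [← Function.iterate_succ_apply]; exact (mem_betaSet_iff hβ).1 hx (n + 1)

lemma quasiOne_mem {β : ℝ} (hβ : 1 < β ∧ β ≤ 2) : quasiOne β ∈ betaSet β := by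
  refine (mem_betaSet_iff hβ).2 fun n => ?_
  by_contra h
  obtain ⟨w, w0, w1, ws, wd⟩ := quasi_orbit hβ
  obtain ⟨i, hi, hlt⟩ := lex_lt_iff.1 (not_le.1 h)
  have hb : 0 < β := by linarith [hβ.1]
  have key : ∀ j ≤ i, w (j + n) ≤ w j := by
    intro j
    induction j with
    | zero => intro _; simpa [w0] using (w1 n).2
    | succ j ih =>
      intro hj
      have h1 := mul_le_mul_of_nonneg_left (ih (by omega)) hb.le
      have h2 : quasiDigit β j = quasiDigit β (j + n) := by
        rw [← quasiOne_val hβ, ← quasiOne_val hβ, hi j (by omega), shift_iter]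
      rw [show j + 1 + n = j + n + 1 by ring, ws, ws, h2]
      linarith
  have h1 := mul_le_mul_of_nonneg_left (key i le_rfl) hb.le
  rw [shift_iter] at hlt
  have h2 : quasiDigit β i + 1 ≤ quasiDigit β (i + n) := by
    rw [← quasiOne_val hβ, ← quasiOne_val hβ]; exact hlt
  have h2' : (quasiDigit β i : ℝ) + 1 ≤ quasiDigit β (i + n) := by exact_mod_cast h2
  linarith [ws i, (w1 (i + 1)).2, ws (i + n), (w1 (i + n + 1)).1]

/-! ### The beta-shift as a space -/

/-- The beta-shift `X_β`, with the topology induced by the product topology, its Borel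
σ-algebra and the lexicographic order. -/
@[ext]
structure BetaShift (β : ℝ) where
  /-- The underlying sequence. -/
  seq : ℕ → Fin 2
  mem : seq ∈ betaSet β

instance (β : ℝ) : TopologicalSpace (BetaShift β) := TopologicalSpace.induced BetaShift.seq inferInstance

instance (β : ℝ) : MeasurableSpace (BetaShift β) := borel _

instance (β : ℝ) : BorelSpace (BetaShift β) := ⟨rfl⟩

instance (β : ℝ) : LinearOrder (BetaShift β) :=
  LinearOrder.lift' (fun x : BetaShift β => toLex x.seq) fun _ _ h => BetaShift.ext h

lemma BetaShift.le_iff {β : ℝ} {x y : BetaShift β} : x ≤ y ↔ toLex x.seq ≤ toLex y.seq := Iff.rfl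

/-- The shift map on the beta-shift. -/
def sigma {β : ℝ} (hβ : 1 < β ∧ β ≤ 2) (x : BetaShift β) : BetaShift β :=
  ⟨shift x.seq, shift_mem_betaSet hβ x.mem⟩

/-! ### Functions of bounded variation -/

section variation

variable {α : Type*} [LinearOrder α]

lemma eVariationOn_add_le (f g : α → ℂ) (s : Set α) :
    eVariationOn (f + g) s ≤ eVariationOn f s + eVariationOn g s := by
  refine iSup_le fun p => ?_
  refine le_trans (Finset.sum_le_sum fun i _ => edist_add_add_le _ _ _ _) ?_
  rw [Finset.sum_add_distrib]
  exact add_le_add (eVariationOn.sum_le p.2.2.1 p.2.2.2) (eVariationOn.sum_le p.2.2.1 p.2.2.2)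

lemma eVariationOn_smul (c : ℂ) (f : α → ℂ) (s : Set α) :
    eVariationOn (c • f) s = ‖c‖ₑ * eVariationOn f s := by
  simp only [eVariationOn, ENNReal.mul_iSup, Finset.mul_sum]
  refine iSup_congr fun p => Finset.sum_congr rfl fun i _ => ?_
  simp only [Pi.smul_apply, edist_eq_enorm_sub, ← smul_sub, enorm_smul]

lemma eVariationOn_mul_le (f g : α → ℂ) (s : Set α) {A B : ENNReal} (hA : ∀ x, ‖f x‖ₑ ≤ A)
    (hB : ∀ x, ‖g x‖ₑ ≤ B) :
    eVariationOn (f * g) s ≤ A * eVariationOn g s + B * eVariationOn f s := by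
  refine iSup_le fun p => ?_
  have h : ∀ i, edist ((f * g) (p.2.1 (i + 1))) ((f * g) (p.2.1 i)) ≤
      A * edist (g (p.2.1 (i + 1))) (g (p.2.1 i)) +
        B * edist (f (p.2.1 (i + 1))) (f (p.2.1 i)) := by
    intro i
    simp only [edist_eq_enorm_sub, Pi.mul_apply]
    set a := f (p.2.1 (i + 1)); set b := f (p.2.1 i)
    set c := g (p.2.1 (i + 1)); set d := g (p.2.1 i)
    rw [show a * c - b * d = a * (c - d) + d * (a - b) by ring]
    refine (enorm_add_le _ _).trans ?_
    rw [enorm_mul, enorm_mul]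
    exact add_le_add (mul_le_mul_left (hA _) _) (mul_le_mul_left (hB _) _)
  refine le_trans (Finset.sum_le_sum fun i _ => h i) ?_
  rw [Finset.sum_add_distrib, ← Finset.mul_sum, ← Finset.mul_sum]
  exact add_le_add (mul_le_mul_right (eVariationOn.sum_le p.2.2.1 p.2.2.2) _)
    (mul_le_mul_right (eVariationOn.sum_le p.2.2.1 p.2.2.2) _)

open Classical in
lemma eVariationOn_indicator_lower {S : Set α} (hS : IsLowerSet S) :
    eVariationOn (S.indicator (1 : α → ℂ)) univ ≤ 1 := by
  set c : Bool → ℂ := fun b => if b then 0 else 1 with hc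
  set p : α → Bool := fun x => decide (x ∉ S) with hp
  have h1 : S.indicator (1 : α → ℂ) = c ∘ p := by
    ext x; by_cases hx : x ∈ S <;> simp [hc, hp, hx]
  have h2 : Monotone p := by
    intro x y hxy
    by_cases hx : x ∈ S
    · simp [hp, hx]
    · have hy : y ∉ S := fun hy => hx (hS hxy hy)
      simp [hp, hx, hy]
  rw [h1]
  refine (eVariationOn.comp_le_of_monotoneOn c (s := {false, true}) p (h2.monotoneOn _) ?_).trans ?_
  · intro x _; simp
  · rw [eVariationOn.pair]; simp [hc, edist_eq_enorm_sub]

lemma bounded_of_bv {f : α → ℂ} (hf : BoundedVariationOn f univ) :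
    BddAbove (range fun x => ‖f x‖) := by
  rcases isEmpty_or_nonempty α with h | ⟨⟨a⟩⟩
  · simp
  · refine ⟨‖f a‖ + (eVariationOn f univ).toReal, ?_⟩
    rintro _ ⟨x, rfl⟩
    have h1 := hf.dist_le (mem_univ x) (mem_univ a)
    rw [dist_eq_norm] at h1
    have h2 := norm_sub_norm_le (f x) (f a)
    simp only
    linarith

end variation

/-- Functions of bounded variation on the beta-shift, as a space of functions. The total
variation is `eVariationOn f univ`. -/
def bvFunctions (β : ℝ) : Submodule ℂ (BetaShift β → ℂ) where
  carrier := {f | BoundedVariationOn f univ}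
  zero_mem' := by
    have : eVariationOn (0 : BetaShift β → ℂ) univ = 0 :=
      eVariationOn.constant_on (by rintro _ ⟨x, -, rfl⟩ _ ⟨y, -, rfl⟩; rfl)
    change eVariationOn _ _ ≠ _
    rw [this]; simp
  add_mem' {f g} hf hg := ne_top_of_le_ne_top (ENNReal.add_ne_top.2 ⟨hf, hg⟩)
    (eVariationOn_add_le f g univ)
  smul_mem' c f hf := by
    change eVariationOn _ _ ≠ _
    rw [eVariationOn_smul]
    exact ENNReal.mul_ne_top (by simp) hf

/-- The space `BV` of functions of bounded variation on the beta-shift. -/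
structure BV (β : ℝ) where
  /-- The underlying function. -/
  toFun : BetaShift β → ℂ
  bv : toFun ∈ bvFunctions β

namespace BV

variable {β : ℝ}

instance : FunLike (BV β) (BetaShift β) ℂ where
  coe := BV.toFun
  coe_injective := fun f g h => by cases f; cases g; congr

lemma coe_mem (f : BV β) : (f : BetaShift β → ℂ) ∈ bvFunctions β := f.bv

lemma var_ne_top (f : BV β) : eVariationOn f univ ≠ ⊤ := f.bv

@[simp] lemma mk_apply (f : BetaShift β → ℂ) (h) (x : BetaShift β) : (⟨f, h⟩ : BV β) x = f x := rfl

instance : Zero (BV β) := ⟨⟨0, zero_mem _⟩⟩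
instance : Add (BV β) := ⟨fun f g => ⟨f + g, add_mem f.bv g.bv⟩⟩
instance : Neg (BV β) := ⟨fun f => ⟨-f, neg_mem f.bv⟩⟩
instance : Sub (BV β) := ⟨fun f g => ⟨f - g, sub_mem f.bv g.bv⟩⟩
instance : SMul ℂ (BV β) := ⟨fun c f => ⟨c • ⇑f, Submodule.smul_mem _ c f.bv⟩⟩
instance : SMul ℕ (BV β) := ⟨fun n f => ⟨n • ⇑f, nsmul_mem f.bv n⟩⟩
instance : SMul ℤ (BV β) := ⟨fun n f => ⟨n • ⇑f, zsmul_mem f.bv n⟩⟩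

instance : AddCommGroup (BV β) :=
  DFunLike.coe_injective.addCommGroup (fun f : BV β => (f : BetaShift β → ℂ)) rfl (fun _ _ => rfl)
    (fun _ => rfl) (fun _ _ => rfl) (fun _ _ => rfl) (fun _ _ => rfl)

/-- Evaluation as an additive map. -/
def coeHom : BV β →+ (BetaShift β → ℂ) where
  toFun f := f
  map_zero' := rfl
  map_add' _ _ := rfl

instance : Module ℂ (BV β) :=
  Function.Injective.module ℂ coeHom DFunLike.coe_injective fun _ _ => rfl

/-- The norm `|f|_∞ + var f`. -/
instance : Norm (BV β) := ⟨fun f => (⨆ x, ‖f x‖) + (eVariationOn f univ).toReal⟩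

lemma norm_def (f : BV β) : ‖f‖ = (⨆ x, ‖f x‖) + (eVariationOn f univ).toReal := rfl

lemma ext_iff' {f g : BV β} : f = g ↔ ∀ x, f x = g x := DFunLike.ext_iff

@[simp] lemma add_apply (f g : BV β) (x : BetaShift β) : (f + g) x = f x + g x := rfl
@[simp] lemma sub_apply (f g : BV β) (x : BetaShift β) : (f - g) x = f x - g x := rfl
@[simp] lemma smul_apply (c : ℂ) (f : BV β) (x : BetaShift β) : (c • f) x = c * f x := rfl
@[simp] lemma zero_apply (x : BetaShift β) : (0 : BV β) x = 0 := rfl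

lemma bddAbove (f : BV β) : BddAbove (range fun x => ‖f x‖) := bounded_of_bv f.var_ne_top

lemma sup_nonneg (f : BV β) : 0 ≤ ⨆ x, ‖f x‖ := Real.iSup_nonneg fun _ => norm_nonneg _

lemma norm_apply_le_sup (f : BV β) (x : BetaShift β) : ‖f x‖ ≤ ⨆ x, ‖f x‖ :=
  le_ciSup f.bddAbove x

lemma norm_apply_le (f : BV β) (x : BetaShift β) : ‖f x‖ ≤ ‖f‖ :=
  (f.norm_apply_le_sup x).trans (le_add_of_nonneg_right ENNReal.toReal_nonneg)

lemma core : NormedSpace.Core ℂ (BV β) where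
  norm_nonneg f := add_nonneg f.sup_nonneg ENNReal.toReal_nonneg
  norm_smul c f := by
    have h1 : eVariationOn (c • f : BV β) univ = ‖c‖ₑ * eVariationOn f univ :=
      eVariationOn_smul c f univ
    rw [norm_def, norm_def, h1, ENNReal.toReal_mul, mul_add, Real.mul_iSup_of_nonneg (norm_nonneg _)]
    simp
  norm_triangle f g := by
    have h1 : (eVariationOn (f + g : BV β) univ).toReal ≤
        (eVariationOn f univ).toReal + (eVariationOn g univ).toReal := by
      rw [← ENNReal.toReal_add f.var_ne_top g.var_ne_top]
      exact ENNReal.toReal_mono (ENNReal.add_ne_top.2 ⟨f.var_ne_top, g.var_ne_top⟩)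
        (eVariationOn_add_le f g univ)
    have h2 : (⨆ x, ‖(f + g : BV β) x‖) ≤ (⨆ x, ‖f x‖) + ⨆ x, ‖g x‖ :=
      Real.iSup_le (fun x => (norm_add_le _ _).trans
        (add_le_add (f.norm_apply_le_sup x) (g.norm_apply_le_sup x)))
        (add_nonneg f.sup_nonneg g.sup_nonneg)
    simp only [norm_def]
    linarith
  norm_eq_zero_iff f := by
    constructor
    · intro h
      rw [ext_iff']
      intro x
      have := f.norm_apply_le x
      rw [h] at this
      simpa using this
    · rintro rfl
      have : eVariationOn (0 : BV β) univ = 0 :=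
        eVariationOn.constant_on (by rintro _ ⟨x, -, rfl⟩ _ ⟨y, -, rfl⟩; rfl)
      simp [norm_def, this]

instance : NormedAddCommGroup (BV β) := NormedAddCommGroup.ofCore core

instance : NormedSpace ℂ (BV β) := NormedSpace.ofCore core

end BV

/-- The subspace of functions of bounded variation that vanish off a countable set. -/
def negligible (β : ℝ) : Submodule ℂ (BV β) where
  carrier := {f | ∃ C : Set (BetaShift β), C.Countable ∧ ∀ x ∉ C, f x = 0}
  zero_mem' := ⟨∅, countable_empty, fun _ _ => rfl⟩
  add_mem' := by
    rintro f g ⟨C, hC, hf⟩ ⟨D, hD, hg⟩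
    refine ⟨C ∪ D, hC.union hD, fun x hx => ?_⟩
    rw [mem_union, not_or] at hx
    rw [BV.add_apply, hf x hx.1, hg x hx.2, add_zero]
  smul_mem' := by
    rintro c f ⟨C, hC, hf⟩
    exact ⟨C, hC, fun x hx => by rw [BV.smul_apply, hf x hx, mul_zero]⟩

instance isClosed_negligible (β : ℝ) : IsClosed (negligible β : Set (BV β)) := by
  refine isClosed_of_closure_subset fun f hf => ?_
  obtain ⟨u, hu, hlim⟩ := mem_closure_iff_seq_limit.1 hf
  choose C hC hz using hu
  refine ⟨⋃ n, C n, countable_iUnion hC, fun x hx => ?_⟩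
  have h1 : ∀ n, ‖f x‖ ≤ ‖u n - f‖ := by
    intro n
    have h2 := (u n - f).norm_apply_le x
    rwa [BV.sub_apply, hz n x fun h => hx (mem_iUnion.2 ⟨n, h⟩), zero_sub, norm_neg] at h2
  have h3 := ge_of_tendsto' (tendsto_iff_norm_sub_tendsto_zero.1 hlim) h1
  simpa using h3

/-- The quotient Banach space `𝓑 = BV / 𝓝`, with the quotient norm. -/
abbrev BVQuot (β : ℝ) : Type := BV β ⧸ negligible β

/-- The class in `𝓑` of a function of bounded variation. -/
def cls {β : ℝ} (f : BV β) : BVQuot β := Submodule.Quotient.mk f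

/-- Finite linear combinations of indicator functions of intervals (order-convex sets). -/
def stepSpan (β : ℝ) : Submodule ℂ (BVQuot β) :=
  Submodule.span ℂ {b | ∃ f : BV β, ∃ I : Set (BetaShift β), I.OrdConnected ∧
    (∀ x, f x = I.indicator 1 x) ∧ b = cls f}

/-- The closed subspace `𝓕` of `𝓑` generated by the indicator functions of intervals. -/
def spaceF (β : ℝ) : Submodule ℂ (BVQuot β) := (stepSpan β).topologicalClosure

lemma isLowerSet_le (β : ℝ) (a : ℕ → Fin 2) :
    IsLowerSet {x : BetaShift β | toLex x.seq ≤ toLex a} :=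
  fun _ _ hyx hx => le_trans (BetaShift.le_iff.1 hyx) hx

/-- The indicator function of `[0, a] = {x ∈ X_β : x ≼ a}` as a function of bounded variation. -/
def chiBV (β : ℝ) (a : ℕ → Fin 2) : BV β :=
  ⟨{x : BetaShift β | toLex x.seq ≤ toLex a}.indicator 1,
    ne_top_of_le_ne_top ENNReal.one_ne_top (eVariationOn_indicator_lower (isLowerSet_le β a))⟩

/-- The constant function `1` as a function of bounded variation. -/
def oneBV (β : ℝ) : BV β :=
  ⟨fun _ => 1, by
    have : eVariationOn (fun _ : BetaShift β => (1 : ℂ)) univ = 0 :=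
      eVariationOn.constant_on (by rintro _ ⟨x, -, rfl⟩ _ ⟨y, -, rfl⟩; rfl)
    change eVariationOn _ _ ≠ _
    rw [this]; simp⟩

/-- The indicator function of `[0, a]` as an element of `𝓕`. -/
def chi (β : ℝ) (a : ℕ → Fin 2) : spaceF β :=
  ⟨cls (chiBV β a), (stepSpan β).le_topologicalClosure (Submodule.subset_span
    ⟨chiBV β a, _, (isLowerSet_le β a).ordConnected, fun _ => rfl, rfl⟩)⟩

/-- The constant function `1` as an element of `𝓕`. -/
def oneF (β : ℝ) : spaceF β :=
  ⟨cls (oneBV β), (stepSpan β).le_topologicalClosure (Submodule.subset_span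
    ⟨oneBV β, univ, ordConnected_univ, fun _ => by simp [oneBV], rfl⟩)⟩

/-! ### The transfer operator -/

/-- `(𝓛_φ f)(x) = ∑_{σ y = x} e^{φ(y)} f(y)`. -/
def transferFun {β : ℝ} (hβ : 1 < β ∧ β ≤ 2) (φ : BetaShift β → ℝ) (f : BetaShift β → ℂ)
    (x : BetaShift β) : ℂ :=
  ∑ᶠ y ∈ {y : BetaShift β | sigma hβ y = x}, (Real.exp (φ y) : ℂ) * f y

/-- The potential `t χ_{C₁}`, where `C₁ = {x : x₁ = 1}`. -/
def potential {β : ℝ} (t : ℝ) : BetaShift β → ℝ :=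
  {x : BetaShift β | x.seq 0 = 1}.indicator fun _ => t

/-- The sequence `d x`. -/
def cons (d : Fin 2) (x : ℕ → Fin 2) : ℕ → Fin 2
  | 0 => d
  | n + 1 => x n

lemma cons_le_cons {d : Fin 2} {x y : ℕ → Fin 2} (h : toLex x ≤ toLex y) :
    toLex (cons d x) ≤ toLex (cons d y) := by
  rcases h.eq_or_lt with h | h
  · rw [show x = y from toLex.injective h]
  · obtain ⟨i, hi, hlt⟩ := lex_lt_iff.1 h
    refine le_of_lt (lex_lt_iff.2 ⟨i + 1, fun j hj => ?_, hlt⟩)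
    rcases j with _ | j
    · rfl
    · exact hi j (by omega)

lemma cons_mem_of_le {β : ℝ} (hβ : 1 < β ∧ β ≤ 2) {d : Fin 2} {x y : BetaShift β} (h : x ≤ y)
    (hy : cons d y.seq ∈ betaSet β) : cons d x.seq ∈ betaSet β := by
  rw [mem_betaSet_iff hβ]
  intro n
  rcases n with _ | n
  · exact (cons_le_cons (BetaShift.le_iff.1 h)).trans ((mem_betaSet_iff hβ).1 hy 0)
  · exact (mem_betaSet_iff hβ).1 x.mem n

open Classical in
/-- The contribution of the preimage `d x` to the transfer operator (without weight). -/
def branch {β : ℝ} (d : Fin 2) (f : BetaShift β → ℂ) (x : BetaShift β) : ℂ :=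
  if h : cons d x.seq ∈ betaSet β then f ⟨cons d x.seq, h⟩ else 0

lemma sigma_eq_iff {β : ℝ} (hβ : 1 < β ∧ β ≤ 2) {x y : BetaShift β} :
    sigma hβ y = x ↔ y.seq = cons 0 x.seq ∨ y.seq = cons 1 x.seq := by
  constructor
  · rintro rfl
    have h : y.seq = cons (y.seq 0) (shift y.seq) := by
      ext n; cases n <;> rfl
    have h2 : ∀ d : Fin 2, d = 0 ∨ d = 1 := by decide
    rcases h2 (y.seq 0) with h0 | h0 <;> rw [h0] at h
    · exact Or.inl h
    · exact Or.inr h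
  · rintro (h | h) <;> refine BetaShift.ext ?_ <;> change shift y.seq = x.seq <;> rw [h] <;> rfl

lemma finsum_branch {β : ℝ} (t : ℝ) (f : BetaShift β → ℂ) (x : BetaShift β) (d : Fin 2) :
    ∑ᶠ y ∈ {y : BetaShift β | y.seq = cons d x.seq}, (Real.exp (potential t y) : ℂ) * f y =
      (Real.exp (t * (d : ℕ)) : ℂ) * branch d f x := by
  by_cases h : cons d x.seq ∈ betaSet β
  · have hs : {y : BetaShift β | y.seq = cons d x.seq} = {⟨cons d x.seq, h⟩} := by
      ext y; exact ⟨fun hy => BetaShift.ext hy, fun hy => congrArg BetaShift.seq hy⟩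
    rw [hs, finsum_mem_singleton, branch, dif_pos h]
    congr 3
    have h2 : ∀ d : Fin 2, d = 0 ∨ d = 1 := by decide
    rcases h2 d with rfl | rfl <;> simp [potential, cons, indicator]
  · have hs : {y : BetaShift β | y.seq = cons d x.seq} = ∅ := by
      ext y
      refine ⟨fun hy => h ?_, fun hy => hy.elim⟩
      have : y.seq = cons d x.seq := hy
      rw [← this]; exact y.mem
    rw [hs, finsum_mem_empty, branch, dif_neg h, mul_zero]

lemma transferFun_eq {β : ℝ} (hβ : 1 < β ∧ β ≤ 2) (t : ℝ) (f : BetaShift β → ℂ)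
    (x : BetaShift β) : transferFun hβ (potential t) f x =
      branch 0 f x + (Real.exp t : ℂ) * branch 1 f x := by
  have hfin : ∀ d, {y : BetaShift β | y.seq = cons d x.seq}.Finite := fun d =>
    Set.Subsingleton.finite fun y hy z hz => BetaShift.ext (Eq.trans hy (Eq.symm hz))
  have hs : {y : BetaShift β | sigma hβ y = x} =
      {y : BetaShift β | y.seq = cons 0 x.seq} ∪ {y : BetaShift β | y.seq = cons 1 x.seq} := by
    ext y; exact sigma_eq_iff hβ
  have hd : Disjoint {y : BetaShift β | y.seq = cons 0 x.seq} {y : BetaShift β | y.seq = cons 1 x.seq} := by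
    rw [Set.disjoint_left]
    intro y hy hz
    have h1 : cons 0 x.seq 0 = cons 1 x.seq 0 := congrFun (Eq.trans (Eq.symm hy) hz) 0
    exact absurd h1 (by simp [cons])
  rw [transferFun, hs, finsum_mem_union hd (hfin 0) (hfin 1), finsum_branch, finsum_branch]
  simp

open Classical in
/-- Monotone extension of the inverse branch `x ↦ d x`. -/
def branchMap {β : ℝ} (hβ : 1 < β ∧ β ≤ 2) (d : Fin 2) (x : BetaShift β) : BetaShift β :=
  if h : cons d x.seq ∈ betaSet β then ⟨cons d x.seq, h⟩ else ⟨quasiOne β, quasiOne_mem hβ⟩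

lemma branchMap_mono {β : ℝ} (hβ : 1 < β ∧ β ≤ 2) (d : Fin 2) :
    Monotone (branchMap hβ d) := by
  intro x y hxy
  by_cases hy : cons d y.seq ∈ betaSet β
  · have hx := cons_mem_of_le hβ hxy hy
    rw [branchMap, branchMap, dif_pos hx, dif_pos hy]
    exact cons_le_cons hxy
  · have : branchMap hβ d y = ⟨quasiOne β, quasiOne_mem hβ⟩ := dif_neg hy
    rw [this]
    exact (mem_betaSet_iff hβ).1 (branchMap hβ d x).mem 0

lemma branch_eq {β : ℝ} (hβ : 1 < β ∧ β ≤ 2) (d : Fin 2) (f : BetaShift β → ℂ) :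
    branch d f = {x : BetaShift β | cons d x.seq ∈ betaSet β}.indicator 1 * (f ∘ branchMap hβ d) := by
  ext x
  by_cases h : cons d x.seq ∈ betaSet β <;> simp [branch, branchMap, h, indicator]

lemma norm_branch_le {β : ℝ} (d : Fin 2) (f : BV β) (x : BetaShift β) :
    ‖branch d f x‖ ≤ ⨆ x, ‖f x‖ := by
  unfold branch
  split_ifs
  · exact f.norm_apply_le_sup _
  · simpa using f.sup_nonneg

lemma eVariationOn_branch_le {β : ℝ} (hβ : 1 < β ∧ β ≤ 2) (d : Fin 2) (f : BV β) :
    eVariationOn (branch d f) univ ≤ eVariationOn f univ + ENNReal.ofReal (⨆ x, ‖f x‖) := by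
  have hS : IsLowerSet {x : BetaShift β | cons d x.seq ∈ betaSet β} :=
    fun _ _ hyx hx => cons_mem_of_le hβ hyx hx
  rw [branch_eq hβ]
  refine (eVariationOn_mul_le _ _ _ (A := 1) (B := ENNReal.ofReal (⨆ x, ‖f x‖)) ?_ ?_).trans ?_
  · intro x
    by_cases h : cons d x.seq ∈ betaSet β <;> simp [indicator, h]
  · intro x
    rw [← ofReal_norm]
    exact ENNReal.ofReal_le_ofReal (f.norm_apply_le_sup _)
  · rw [one_mul]
    refine add_le_add (eVariationOn.comp_le_of_monotoneOn _ _ ((branchMap_mono hβ d).monotoneOn _)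
      fun _ _ => mem_univ _) ?_
    exact mul_le_of_le_one_right' (eVariationOn_indicator_lower hS)

/-- `branch d` on functions of bounded variation. -/
def branchBV {β : ℝ} (hβ : 1 < β ∧ β ≤ 2) (d : Fin 2) (f : BV β) : BV β :=
  ⟨branch d f, ne_top_of_le_ne_top (ENNReal.add_ne_top.2 ⟨f.var_ne_top, ENNReal.ofReal_ne_top⟩)
    (eVariationOn_branch_le hβ d f)⟩

lemma norm_branchBV_le {β : ℝ} (hβ : 1 < β ∧ β ≤ 2) (d : Fin 2) (f : BV β) :
    ‖branchBV hβ d f‖ ≤ 2 * ‖f‖ := by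
  have h1 : (⨆ x, ‖branchBV hβ d f x‖) ≤ ⨆ x, ‖f x‖ :=
    Real.iSup_le (norm_branch_le d f) f.sup_nonneg
  have h2 : (eVariationOn (branchBV hβ d f) univ).toReal ≤
      (eVariationOn f univ).toReal + ⨆ x, ‖f x‖ := by
    have h3 := ENNReal.toReal_mono (ENNReal.add_ne_top.2 ⟨f.var_ne_top, ENNReal.ofReal_ne_top⟩)
      (eVariationOn_branch_le hβ d f)
    rwa [ENNReal.toReal_add f.var_ne_top ENNReal.ofReal_ne_top, ENNReal.toReal_ofReal f.sup_nonneg] at h3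
  rw [BV.norm_def, BV.norm_def]
  have h4 : 0 ≤ (eVariationOn f univ).toReal := ENNReal.toReal_nonneg
  linarith

lemma branch_add {β : ℝ} (d : Fin 2) (f g : BetaShift β → ℂ) (x : BetaShift β) :
    branch d (f + g) x = branch d f x + branch d g x := by
  unfold branch; split_ifs <;> simp

lemma branch_smul {β : ℝ} (d : Fin 2) (c : ℂ) (f : BetaShift β → ℂ) (x : BetaShift β) :
    branch d (c • f) x = c * branch d f x := by
  unfold branch; split_ifs <;> simp

lemma transferFun_bv {β : ℝ} (hβ : 1 < β ∧ β ≤ 2) (t : ℝ) (f : BV β) :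
    transferFun hβ (potential t) f = (branchBV hβ 0 f + (Real.exp t : ℂ) • branchBV hβ 1 f : BV β) := by
  ext x; rw [transferFun_eq]; rfl

/-- The transfer operator with potential `t χ_{C₁}` as a bounded operator on `BV`. -/
def transferBV {β : ℝ} (hβ : 1 < β ∧ β ≤ 2) (t : ℝ) : BV β →L[ℂ] BV β :=
  LinearMap.mkContinuous
    { toFun := fun f => ⟨transferFun hβ (potential t) f, by
        rw [transferFun_bv]; exact BV.bv _⟩
      map_add' := fun f g => BV.ext_iff'.2 fun x => by
        change transferFun hβ (potential t) (⇑f + ⇑g) x =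
          transferFun hβ (potential t) f x + transferFun hβ (potential t) g x
        simp only [transferFun_eq, branch_add]; ring
      map_smul' := fun c f => BV.ext_iff'.2 fun x => by
        change transferFun hβ (potential t) (c • ⇑f) x = c * transferFun hβ (potential t) f x
        simp only [transferFun_eq, branch_smul]; ring }
    (2 + 2 * Real.exp t) fun f => by
      have h : (⟨transferFun hβ (potential t) f, by
        rw [transferFun_bv]; exact BV.bv _⟩ : BV β) =
          branchBV hβ 0 f + (Real.exp t : ℂ) • branchBV hβ 1 f :=
        DFunLike.coe_injective (transferFun_bv hβ t f)
      refine (congrArg norm h).trans_le ?_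
      refine (norm_add_le _ _).trans ?_
      rw [norm_smul, Complex.norm_real, Real.norm_of_nonneg (Real.exp_pos t).le]
      have h0 := norm_branchBV_le hβ 0 f
      have h1 := mul_le_mul_of_nonneg_left (norm_branchBV_le hβ 1 f) (Real.exp_pos t).le
      linarith

lemma transferBV_apply {β : ℝ} (hβ : 1 < β ∧ β ≤ 2) (t : ℝ) (f : BV β) (x : BetaShift β) :
    transferBV hβ t f x = transferFun hβ (potential t) f x := rfl

lemma transferBV_eq {β : ℝ} (hβ : 1 < β ∧ β ≤ 2) (t : ℝ) (f : BV β) :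
    transferBV hβ t f = branchBV hβ 0 f + (Real.exp t : ℂ) • branchBV hβ 1 f :=
  DFunLike.coe_injective (transferFun_bv hβ t f)

lemma branchBV_mem_negligible {β : ℝ} (hβ : 1 < β ∧ β ≤ 2) (d : Fin 2) {f : BV β}
    (hf : f ∈ negligible β) : branchBV hβ d f ∈ negligible β := by
  obtain ⟨C, hC, hf⟩ := hf
  refine ⟨sigma hβ '' C, hC.image _, fun x hx => ?_⟩
  change branch d f x = 0
  unfold branch
  split_ifs with h
  · refine hf _ fun hm => hx ⟨_, hm, ?_⟩
    exact BetaShift.ext rfl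
  · rfl

lemma transferBV_mem_negligible {β : ℝ} (hβ : 1 < β ∧ β ≤ 2) (t : ℝ) {f : BV β}
    (hf : f ∈ negligible β) : transferBV hβ t f ∈ negligible β := by
  rw [transferBV_eq]
  exact add_mem (branchBV_mem_negligible hβ 0 hf)
    (Submodule.smul_mem _ _ (branchBV_mem_negligible hβ 1 hf))

/-- The transfer operator on the quotient space `𝓑`. -/
def transferQuot {β : ℝ} (hβ : 1 < β ∧ β ≤ 2) (t : ℝ) : BVQuot β →L[ℂ] BVQuot β :=
  (negligible β).liftQL ((negligible β).mkQL.comp (transferBV hβ t)) fun f hf => by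
    have := transferBV_mem_negligible hβ t hf
    simpa using this

lemma transferQuot_cls {β : ℝ} (hβ : 1 < β ∧ β ≤ 2) (t : ℝ) (f : BV β) :
    transferQuot hβ t (cls f) = cls (transferBV hβ t f) := rfl

lemma branch_step {β : ℝ} (hβ : 1 < β ∧ β ≤ 2) (d : Fin 2) {f : BV β} {I : Set (BetaShift β)}
    (hI : I.OrdConnected) (hf : ∀ x, f x = I.indicator 1 x) :
    cls (branchBV hβ d f) ∈ stepSpan β := by
  refine Submodule.subset_span ⟨branchBV hβ d f,
    {x | ∃ h : cons d x.seq ∈ betaSet β, (⟨cons d x.seq, h⟩ : BetaShift β) ∈ I}, ?_, ?_, rfl⟩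
  · refine ⟨?_⟩
    rintro x ⟨hx, hxI⟩ y ⟨hy, hyI⟩ z hz
    have h := cons_mem_of_le hβ hz.2 hy
    have hm : (⟨cons d z.seq, h⟩ : BetaShift β) ∈
        Icc (⟨cons d x.seq, hx⟩ : BetaShift β) ⟨cons d y.seq, hy⟩ :=
      ⟨cons_le_cons hz.1, cons_le_cons hz.2⟩
    exact ⟨h, hI.out hxI hyI hm⟩
  · intro x
    change branch d f x = _
    unfold branch
    by_cases h : cons d x.seq ∈ betaSet β
    · rw [dif_pos h, hf]
      by_cases h2 : (⟨cons d x.seq, h⟩ : BetaShift β) ∈ I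
      · have h3 : x ∈ {x : BetaShift β | ∃ h : cons d x.seq ∈ betaSet β,
            (⟨cons d x.seq, h⟩ : BetaShift β) ∈ I} := ⟨h, h2⟩
        rw [indicator_of_mem h2, indicator_of_mem h3]; rfl
      · have h3 : x ∉ {x : BetaShift β | ∃ h : cons d x.seq ∈ betaSet β,
            (⟨cons d x.seq, h⟩ : BetaShift β) ∈ I} := fun ⟨_, h4⟩ => h2 h4
        rw [indicator_of_notMem h2, indicator_of_notMem h3]
    · have h3 : x ∉ {x : BetaShift β | ∃ h : cons d x.seq ∈ betaSet β,
          (⟨cons d x.seq, h⟩ : BetaShift β) ∈ I} := fun ⟨h4, _⟩ => h h4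
      rw [dif_neg h, indicator_of_notMem h3]

lemma transferQuot_mem {β : ℝ} (hβ : 1 < β ∧ β ≤ 2) (t : ℝ) :
    ∀ b ∈ spaceF β, transferQuot hβ t b ∈ spaceF β := by
  have h : stepSpan β ≤ (stepSpan β).comap (transferQuot hβ t : BVQuot β →ₗ[ℂ] BVQuot β) := by
    refine Submodule.span_le.2 ?_
    rintro _ ⟨f, I, hI, hf, rfl⟩
    change transferQuot hβ t (cls f) ∈ stepSpan β
    rw [transferQuot_cls, transferBV_eq]
    exact add_mem (branch_step hβ 0 hI hf) (Submodule.smul_mem _ _ (branch_step hβ 1 hI hf))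
  intro b hb
  exact map_mem_closure (transferQuot hβ t).continuous hb fun x hx => h hx

/-- The transfer operator `𝓛_t` on `𝓕`. -/
def transferOp {β : ℝ} (hβ : 1 < β ∧ β ≤ 2) (t : ℝ) : spaceF β →L[ℂ] spaceF β :=
  (transferQuot hβ t).restrict (transferQuot_mem hβ t)

/-! ### Objects in the theorem -/

/-- `H_n(t, a) = exp(t (a₁ + ⋯ + a_n))`. -/
def weight (t : ℝ) (a : ℕ → Fin 2) (n : ℕ) : ℝ :=
  Real.exp (∑ i ∈ Finset.range n, ((a i : ℕ) : ℝ) * t)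

/-- `r_t = limsup_n |exp(S_n φ)|_∞^{1/n}` for `φ = t χ_{C₁}`, where `S_n φ` is the Birkhoff sum. -/
def radius {β : ℝ} (hβ : 1 < β ∧ β ≤ 2) (t : ℝ) : ℝ :=
  limsup (fun n : ℕ => (⨆ x : BetaShift β,
    Real.exp (birkhoffSum (sigma hβ) (potential t) n x)) ^ (1 / (n : ℝ))) atTop

/-- `φ_t(z) = ∑_{n ≥ 1} q_n H_{n-1}(t, q) z^n`, where `q` is the quasi-greedy expansion of `1`. -/
def phi (β t : ℝ) (z : ℂ) : ℂ :=
  ∑' n : ℕ, ((quasiOne β n : ℕ) : ℂ) * (weight t (quasiOne β) n : ℂ) * z ^ (n + 1)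

/-- The summands `H_n(t, q) λ^{-n} χ_{[0, σⁿ q]}` of the eigenfunction series, in `𝓕`. -/
def eigenTerm (β t : ℝ) (lam : ℂ) (n : ℕ) : spaceF β :=
  ((weight t (quasiOne β) n : ℂ) / lam ^ n) • chi β (shift^[n] (quasiOne β))

/-- `lam` is an eigenvalue of `L` and an isolated point of the spectrum of `L`. -/
def IsIsolatedEigenvalue {β : ℝ} (L : spaceF β →L[ℂ] spaceF β) (lam : ℂ) : Prop :=
  Module.End.HasEigenvalue (L : Module.End ℂ (spaceF β)) lam ∧
    ∃ ε > 0, ∀ z ∈ spectrum ℂ L, dist z lam < ε → z = lam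

/-- `L^* ν = lam ν` for a bounded linear functional `ν`. -/
def IsEigenfunctional {β : ℝ} (L : spaceF β →L[ℂ] spaceF β) (lam : ℂ)
    (ν : spaceF β →L[ℂ] ℂ) : Prop :=
  ν.comp L = lam • ν

/-- An element of `𝓕` is nonnegative if it has a nonnegative representative. -/
def IsNonneg {β : ℝ} (f : spaceF β) : Prop :=
  ∃ g : BV β, cls g = f ∧ ∀ x, ∃ r : ℝ, 0 ≤ r ∧ g x = r

/-- `lam` is a positive eigenvalue of `𝓛_t` and `ν` a positive eigenfunctional for it, normalized
by `ν(1) = 1`. -/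
structure IsPerronPair {β : ℝ} (hβ : 1 < β ∧ β ≤ 2) (t lam : ℝ) (ν : spaceF β →L[ℂ] ℂ) :
    Prop where
  pos : 0 < lam
  eigenvalue : Module.End.HasEigenvalue (transferOp hβ t : Module.End ℂ (spaceF β)) (lam : ℂ)
  eigenfunctional : IsEigenfunctional (transferOp hβ t) lam ν
  nonneg : ∀ f, IsNonneg f → ∃ r : ℝ, 0 ≤ r ∧ ν f = r
  normalized : ν (oneF β) = 1

/-- The functional `ν` on `𝓕` is integration against the measure `m`. -/
def Represents {β : ℝ} (m : Measure (BetaShift β)) (ν : spaceF β →L[ℂ] ℂ) : Prop :=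
  ∀ (f : BV β) (hf : cls f ∈ spaceF β), Integrable f m ∧ ν ⟨cls f, hf⟩ = ∫ x, f x ∂m

/-- The summands of the normalizing constant `F(t) = ∑_{n ≥ 1} n q_n H_{n-1}(t, q) λ^{-n}`. -/
def normTerm (β t lam : ℝ) (n : ℕ) : ℝ :=
  (n + 1) * ((quasiOne β n : ℕ) : ℝ) * weight t (quasiOne β) n / lam ^ (n + 1)

/-- The summands of the series `∑_{n ≥ 0} H_n(t, q) λ^{-n} χ_{[0, σⁿ q]}(x)`. -/
def densityTerm {β : ℝ} (t lam : ℝ) (x : BetaShift β) (n : ℕ) : ℝ :=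
  weight t (quasiOne β) n / lam ^ n *
    {y : BetaShift β | toLex y.seq ≤ toLex (shift^[n] (quasiOne β))}.indicator 1 x

/-- `h_t = F(t)⁻¹ ∑_{n ≥ 0} H_n(t, q) λ^{-n} χ_{[0, σⁿ q]}`. -/
def density {β : ℝ} (t lam : ℝ) (x : BetaShift β) : ℝ :=
  (∑' n, normTerm β t lam n)⁻¹ * ∑' n, densityTerm t lam x n

/-- The measure `h_t m`. -/
def equilibrium {β : ℝ} (t lam : ℝ) (m : Measure (BetaShift β)) : Measure (BetaShift β) :=
  m.withDensity fun x => ENNReal.ofReal (density t lam x)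

/-- `|∫ f · g ∘ σⁿ dμ - ∫ f dμ ∫ g dμ|`. -/
def correlation {β : ℝ} (hβ : 1 < β ∧ β ≤ 2) (μ : Measure (BetaShift β)) (f g : BetaShift β → ℂ)
    (n : ℕ) : ℝ :=
  ‖(∫ x, f x * g ((sigma hβ)^[n] x) ∂μ) - (∫ x, f x ∂μ) * ∫ x, g x ∂μ‖

/-- Correlations of functions in `𝓕` against functions in `L¹(μ)` decay, with a uniform
constant, at least as fast as `ρⁿ`. -/
def HasCorrelationBound {β : ℝ} (hβ : 1 < β ∧ β ≤ 2) (μ : Measure (BetaShift β)) (ρ : ℝ) : Prop :=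
  ∃ K > 0, ∀ (f : BV β) (g : BetaShift β → ℂ), cls f ∈ spaceF β → Integrable g μ →
    ∀ n : ℕ, 1 ≤ n → correlation hβ μ f g n ≤ K * ‖cls f‖ * (∫ x, ‖g x‖ ∂μ) * ρ ^ n

end

end BetaRPF

open BetaRPF

/-!
# The transfer operator of the beta-shift with potential `t χ_{C₁}`

Write `q` for the quasi-greedy expansion of `1`, `χ_a` for the indicator function of `[0, a]` and
`V_z(a) = ∑ a_n H_{n-1}(t, a) z⁻ⁿ`, so that `φ_t(1/z) = V_z(q)`. Everything rests on the identity
`𝓛_t χ_a = a₁ + H₁(t, a) χ_{σ a}` (`transferOp_chi`) and on the structure of `𝓕`.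

**The space.** Modulo functions that vanish off a countable set, every `χ_a` vanishes or equals some
`χ_d` with `d` ending in infinitely many ones, and between two such `d` there are uncountably many
points. Hence the variation of a representative of `∑ c_d χ_d` controls `∑ |c_d|`, and every bounded
family `(G_d)` in a Banach space comes from a unique bounded operator with `χ_d ↦ G_d`
(`clm_ext`, `exists_clm`). Operators on `𝓕` are thus constructed and compared on the `χ_d`.

**The spectrum beyond `r_t`.** For `|z| > r_t` the series `u_a = ∑ H_n(t, a) z^{-n-1} χ_{σⁿ a}`
converges in `𝓕` and satisfies `(z - 𝓛_t) u_a = χ_a - V_z(a)`. So `χ_a ↦ u_a` inverts `z - 𝓛_t` up to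
rank one (`exists_quasi_resolvent`). If `φ_t(1/z) ≠ 1` this yields a genuine inverse; if
`φ_t(1/z) = 1`, the eigenfunctions are the multiples of `u_q`, and `χ_a ↦ V_z(a)` is the only
normalized eigenfunctional. Eigenvalues beyond `r_t` are isolated because `φ_t` is holomorphic.

**The leading root.** `V_z(q) > 1` for some `z > r_t` (`exists_one_lt_realDigitSeries`), so
`V_lam(q) = 1` for some `lam > r_t` (`exists_leading_root`). Comparing sequences at their first
difference shows that `V_lam` is nondecreasing with values in `[0, 1]`. It is therefore the
distribution function of a probability measure `m`, without atoms because `H_n lam⁻ⁿ` tends to zero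
(`measure_singleton_eq_zero`). This `m` represents the eigenfunctional at `lam`, which is positive. A positive
eigenfunctional does not vanish on `u_q` at `lam`, so `lam` is the eigenvalue of every Perron pair,
and it has no generalized eigenvectors. Comparing `φ_t(1/z)` with `φ_t(1/lam)` term by term shows that
all other roots have modulus less than `lam` (`norm_lt_of_phi_eq_one`).

**Invariance and mixing.** By comparison of distribution functions `m` is conformal
(`eq_add_map_branchMap`), that is, `∫ 𝓛_t f dm = lam ∫ f dm`; together with `𝓛_t h_t = lam h_t` this
makes `h_t m` invariant. The same identity turns a correlation into the integral of
`(lam⁻ⁿ 𝓛_tⁿ (f h_t) - m(f h_t) h_t) g` against `m`. The operator that remains of `𝓛_t` after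
subtracting the spectral projection at `lam` has its spectrum in the disc of radius `α`, so that the
first factor decays like `(θ / lam)ⁿ` in `𝓕`, for every `θ > α`, by Gelfand's formula.
-/

namespace BetaRPF

noncomputable section

-- Without this the operator norm on maps between these subspaces of quotients is not found.
set_option maxSynthPendingDepth 3

/-! ### Sequences in the beta-shift -/

lemma fin_two_cases (d : Fin 2) : d = 0 ∨ d = 1 := by
  revert d; decide

lemma lt_of_agree {x y : ℕ → Fin 2} {n : ℕ} (h : ∀ j < n, x j = y j) (hx : x n = 0)
    (hy : y n = 1) : toLex x < toLex y :=
  lex_lt_iff.2 ⟨n, h, by rw [hx, hy]; decide⟩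

lemma exists_first_difference {x y : ℕ → Fin 2} (h : toLex x < toLex y) :
    ∃ n, (∀ j < n, x j = y j) ∧ x n = 0 ∧ y n = 1 := by
  obtain ⟨n, hn, hlt⟩ := lex_lt_iff.1 h
  refine ⟨n, hn, ?_⟩
  revert hlt
  generalize x n = a
  generalize y n = b
  revert a b
  decide

lemma agree_shift {x y : ℕ → Fin 2} {n : ℕ} (h : ∀ j < n, x j = y j) (k : ℕ) :
    ∀ j < n - k, shift^[k] x j = shift^[k] y j := fun j hj => by
  rw [shift_iter, shift_iter, h _ (by omega)]

lemma zero_seq_mem {β : ℝ} (hβ : 1 < β ∧ β ≤ 2) : (0 : ℕ → Fin 2) ∈ betaSet β := by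
  refine (mem_betaSet_iff hβ).2 fun n => not_lt.1 fun h => ?_
  obtain ⟨k, -, -, hk⟩ := exists_first_difference h
  rw [shift_iter] at hk
  exact absurd hk (by simp)

lemma shift_iter_mem {β : ℝ} (hβ : 1 < β ∧ β ≤ 2) {x : ℕ → Fin 2} (hx : x ∈ betaSet β) (n : ℕ) :
    shift^[n] x ∈ betaSet β := by
  induction n with
  | zero => exact hx
  | succ n ih => rw [Function.iterate_succ_apply']; exact shift_mem_betaSet hβ ih

lemma le_quasiOne {β : ℝ} (hβ : 1 < β ∧ β ≤ 2) {x : ℕ → Fin 2} (hx : x ∈ betaSet β) :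
    toLex x ≤ toLex (quasiOne β) := (mem_betaSet_iff hβ).1 hx 0

lemma val_zero (β : ℝ) : val β 0 = 0 := by simp [val]

/-- The quasi-greedy expansion of `1` has infinitely many ones, since all its tails have positive
value. -/
lemma quasiOne_infinite {β : ℝ} (hβ : 1 < β ∧ β ≤ 2) (n : ℕ) :
    ∃ k ≥ n, quasiOne β k = 1 := by
  by_contra! h
  have h0 : shift^[n] (quasiOne β) = 0 := by
    ext k
    rw [shift_iter]
    rcases fin_two_cases (quasiOne β (k + n)) with h1 | h1
    · rw [h1]; rfl
    · exact absurd h1 (h _ (by omega))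
  have := val_quasiOne_pos hβ n
  rw [h0, val_zero] at this
  exact lt_irrefl _ this

lemma quasiOne_zero {β : ℝ} (hβ : 1 < β ∧ β ≤ 2) : quasiOne β 0 = 1 := by
  rcases fin_two_cases (quasiOne β 0) with h | h
  · exfalso
    obtain ⟨k, -, hk⟩ := quasiOne_infinite hβ 0
    have h1 := (mem_betaSet_iff hβ).1 (quasiOne_mem hβ) k
    exact absurd (lt_of_agree (n := 0) (by simp) h (by rw [shift_iter]; simpa using hk)) h1.not_gt
  · exact h

lemma cons_zero_mem {β : ℝ} (hβ : 1 < β ∧ β ≤ 2) {x : ℕ → Fin 2} (hx : x ∈ betaSet β) :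
    cons 0 x ∈ betaSet β := by
  refine (mem_betaSet_iff hβ).2 fun n => ?_
  rcases n with _ | n
  · exact (lt_of_agree (n := 0) (by simp) rfl (quasiOne_zero hβ)).le
  · exact (mem_betaSet_iff hβ).1 hx n

/-- The sequence `a₀ ⋯ aₙ₋₁ 0 u₀ u₁ ⋯`. -/
def splice (a : ℕ → Fin 2) (n : ℕ) (u : ℕ → Fin 2) : ℕ → Fin 2 := fun j =>
  if j < n then a j else if j = n then 0 else u (j - (n + 1))

lemma splice_of_lt {a u : ℕ → Fin 2} {n j : ℕ} (h : j < n) : splice a n u j = a j := if_pos h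

lemma splice_self {a u : ℕ → Fin 2} {n : ℕ} : splice a n u n = 0 := by simp [splice]

lemma shift_splice {a u : ℕ → Fin 2} {n : ℕ} : shift^[n + 1] (splice a n u) = u := by
  ext j
  rw [shift_iter]
  simp only [splice]
  rw [if_neg (by omega), if_neg (by omega)]
  congr 2
  omega

lemma splice_lt {a u : ℕ → Fin 2} {n : ℕ} (h : a n = 1) : toLex (splice a n u) < toLex a :=
  lt_of_agree (fun _ hj => splice_of_lt hj) splice_self h

lemma splice_mem {β : ℝ} (hβ : 1 < β ∧ β ≤ 2) {a u : ℕ → Fin 2} {n : ℕ} (ha : a ∈ betaSet β)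
    (hu : u ∈ betaSet β) (h : a n = 1) : splice a n u ∈ betaSet β := by
  refine (mem_betaSet_iff hβ).2 fun k => ?_
  by_cases hk : k ≤ n
  · refine le_trans (le_of_lt ?_) ((mem_betaSet_iff hβ).1 ha k)
    refine lt_of_agree (agree_shift (fun _ hj => splice_of_lt hj) k) ?_ ?_
    · rw [shift_iter, Nat.sub_add_cancel hk, splice_self]
    · rw [shift_iter, Nat.sub_add_cancel hk, h]
  · obtain ⟨m, rfl⟩ := Nat.exists_eq_add_of_lt (not_le.1 hk)
    rw [show n + m + 1 = m + (n + 1) by ring, Function.iterate_add_apply, shift_splice]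
    exact (mem_betaSet_iff hβ).1 hu m

/-- A sequence that agrees with `a` before `n` and is `0` at `n` is determined by its tail, and is
monotone in it. -/
lemma le_splice {a x u : ℕ → Fin 2} {n : ℕ} (h : ∀ j < n, x j = a j) (h0 : x n = 0)
    (hx : toLex (shift^[n + 1] x) ≤ toLex u) : toLex x ≤ toLex (splice a n u) := by
  refine not_lt.1 fun hlt => ?_
  obtain ⟨k, hk, hk0, hk1⟩ := exists_first_difference hlt
  rcases lt_trichotomy k n with hkn | rfl | hkn
  · rw [splice_of_lt hkn, ← h k hkn, hk1] at hk0
    exact absurd hk0 (by decide)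
  · rw [h0] at hk1; exact absurd hk1 (by decide)
  · obtain ⟨m, rfl⟩ := Nat.exists_eq_add_of_lt hkn
    refine absurd (lt_of_agree (n := m) (x := u) (y := shift^[n + 1] x) (fun j hj => ?_) ?_ ?_)
      hx.not_gt
    · have := hk (j + (n + 1)) (by omega)
      rwa [← shift_iter (splice a n u), ← shift_iter x, shift_splice] at this
    · rw [show n + m + 1 = m + (n + 1) by ring, ← shift_iter (splice a n u), shift_splice] at hk0
      exact hk0
    · rw [shift_iter, show m + (n + 1) = n + m + 1 by ring]; exact hk1

/-- The sequences of the beta-shift with infinitely many ones. Modulo countable sets every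
indicator function of an interval `[0, a]` is zero or that of `[0, d]` for exactly one such `d`. -/
def infiniteOnes (β : ℝ) : Set (ℕ → Fin 2) := {a | a ∈ betaSet β ∧ ∀ n, ∃ k ≥ n, a k = 1}

lemma quasiOne_mem_infiniteOnes {β : ℝ} (hβ : 1 < β ∧ β ≤ 2) : quasiOne β ∈ infiniteOnes β :=
  ⟨quasiOne_mem hβ, quasiOne_infinite hβ⟩

lemma shift_mem_infiniteOnes {β : ℝ} (hβ : 1 < β ∧ β ≤ 2) {a : ℕ → Fin 2}
    (ha : a ∈ infiniteOnes β) : shift a ∈ infiniteOnes β := by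
  refine ⟨shift_mem_betaSet hβ ha.1, fun n => ?_⟩
  obtain ⟨k, hk, h⟩ := ha.2 (n + 1)
  refine ⟨k - 1, by omega, ?_⟩
  change a (k - 1 + 1) = 1
  rwa [Nat.sub_add_cancel (by omega)]

lemma shift_iter_mem_infiniteOnes {β : ℝ} (hβ : 1 < β ∧ β ≤ 2) {a : ℕ → Fin 2}
    (ha : a ∈ infiniteOnes β) (n : ℕ) : shift^[n] a ∈ infiniteOnes β := by
  induction n with
  | zero => exact ha
  | succ n ih => rw [Function.iterate_succ_apply']; exact shift_mem_infiniteOnes hβ ih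

lemma splice_mem_infiniteOnes {β : ℝ} (hβ : 1 < β ∧ β ≤ 2) {a u : ℕ → Fin 2} {n : ℕ}
    (ha : a ∈ betaSet β) (hu : u ∈ infiniteOnes β) (h : a n = 1) :
    splice a n u ∈ infiniteOnes β := by
  refine ⟨splice_mem hβ ha hu.1 h, fun m => ?_⟩
  obtain ⟨k, hk, h1⟩ := hu.2 m
  refine ⟨k + (n + 1), by omega, ?_⟩
  rw [← shift_iter (splice a n u), shift_splice, h1]

/-- The beta-shift is uncountable: if `q_j = 1` is the second one of the quasi-greedy expansion of
`1`, sequences whose ones are at multiples of `j + 1` are admissible. -/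
lemma not_countable_betaSet {β : ℝ} (hβ : 1 < β ∧ β ≤ 2) : ¬ (betaSet β).Countable := by
  intro hc
  obtain ⟨j, hj, hj1⟩ := quasiOne_infinite hβ 1
  set e : Set ℕ → ℕ → Fin 2 := fun S n =>
    open Classical in if j + 1 ∣ n ∧ n / (j + 1) ∈ S then 1 else 0 with he
  have hmem : ∀ S, e S ∈ betaSet β := by
    intro S
    refine (mem_betaSet_iff hβ).2 fun n => ?_
    by_cases h0 : shift^[n] (e S) 0 = 0
    · exact (lt_of_agree (n := 0) (by simp) h0 (quasiOne_zero hβ)).le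
    · refine not_lt.1 fun hlt => ?_
      obtain ⟨k, hk, hk0, hk1⟩ := exists_first_difference hlt
      have hdiv : ∀ i, shift^[n] (e S) i ≠ 0 → j + 1 ∣ i + n := by
        intro i hi
        rw [shift_iter] at hi
        by_contra hd
        exact hi (if_neg fun h => hd h.1)
      have hd0 := hdiv 0 h0
      rw [zero_add] at hd0
      have hk' : j + 1 ∣ k := (Nat.dvd_add_iff_left hd0).2 (hdiv k (by rw [hk1]; decide))
      rcases Nat.eq_zero_or_pos k with rfl | hkp
      · rw [quasiOne_zero hβ] at hk0; exact absurd hk0 (by decide)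
      · have hle := Nat.le_of_dvd hkp hk'
        have h2 := hdiv j (by rw [← hk j (by omega), hj1]; decide)
        have h3 := Nat.le_of_dvd (by omega) ((Nat.dvd_add_iff_left hd0).2 h2)
        omega
  have hinj : Function.Injective e := by
    intro S T h
    ext n
    have h1 := congrFun h (n * (j + 1))
    simp only [he, dvd_mul_left, true_and, Nat.mul_div_cancel n (Nat.succ_pos j)] at h1
    by_cases hS : n ∈ S <;> by_cases hT : n ∈ T <;> simp_all
  have h2 : (univ : Set (Set ℕ)).Countable :=
    countable_of_injective_of_countable_image (f := e) (hinj.injOn)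
      (hc.mono (by rintro _ ⟨S, -, rfl⟩; exact hmem S))
  have h3 : Countable (Set ℕ) := countable_univ_iff.1 h2
  obtain ⟨f, hf⟩ := exists_injective_nat (Set ℕ)
  exact Function.cantor_injective f hf

lemma not_countable_splice {β : ℝ} (hβ : 1 < β ∧ β ≤ 2) {a : ℕ → Fin 2} {n : ℕ}
    (ha : a ∈ betaSet β) (h : a n = 1) :
    ¬ {x : BetaShift β | toLex x.seq < toLex a ∧ ∀ j < n, x.seq j = a j}.Countable := by
  intro hc
  refine not_countable_betaSet hβ ?_
  refine (hc.image fun x => shift^[n + 1] x.seq).mono fun u hu => ?_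
  exact ⟨(⟨splice a n u, splice_mem hβ ha hu h⟩ : BetaShift β),
    ⟨splice_lt h, fun j hj => splice_of_lt hj⟩, shift_splice⟩

/-- Between two points of `infiniteOnes β` there are uncountably many points. -/
lemma not_countable_Ioc {β : ℝ} (hβ : 1 < β ∧ β ≤ 2) {a b : ℕ → Fin 2}
    (hb : b ∈ infiniteOnes β) (hab : toLex a < toLex b) :
    ¬ {x : BetaShift β | toLex a < toLex x.seq ∧ toLex x.seq ≤ toLex b}.Countable := by
  obtain ⟨n, hn, hn0, hn1⟩ := exists_first_difference hab
  obtain ⟨m, hm, hm1⟩ := hb.2 (n + 1)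
  refine fun hc => not_countable_splice hβ hb.1 hm1 (hc.mono ?_)
  rintro x ⟨hx1, hx2⟩
  refine ⟨?_, hx1.le⟩
  refine lt_of_agree (n := n) (fun j hj => ?_) hn0 ?_
  · rw [hn j hj, hx2 j (by omega)]
  · rw [hx2 n (by omega), hn1]

lemma not_countable_Iic {β : ℝ} (hβ : 1 < β ∧ β ≤ 2) {b : ℕ → Fin 2}
    (hb : b ∈ infiniteOnes β) :
    ¬ {x : BetaShift β | toLex x.seq ≤ toLex b}.Countable := by
  obtain ⟨m, -, hm1⟩ := hb.2 0
  exact fun hc => not_countable_splice hβ hb.1 hm1 (hc.mono fun x hx => hx.1.le)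

/-! ### The order topology of the beta-shift -/

lemma isClosed_betaSet (β : ℝ) : IsClosed (betaSet β) := isClosed_closure

lemma BetaShift.isClosedEmbedding_seq (β : ℝ) :
    IsClosedEmbedding (BetaShift.seq : BetaShift β → ℕ → Fin 2) where
  eq_induced := rfl
  injective := fun _ _ h => BetaShift.ext h
  isClosed_range := by
    have : range (BetaShift.seq : BetaShift β → ℕ → Fin 2) = betaSet β := by
      ext x; exact ⟨by rintro ⟨y, rfl⟩; exact y.mem, fun hx => ⟨⟨x, hx⟩, rfl⟩⟩
    rw [this]; exact isClosed_betaSet β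

lemma BetaShift.continuous_seq (β : ℝ) : Continuous (BetaShift.seq : BetaShift β → ℕ → Fin 2) :=
  (BetaShift.isClosedEmbedding_seq β).continuous

instance (β : ℝ) : CompactSpace (BetaShift β) :=
  (BetaShift.isClosedEmbedding_seq β).compactSpace

instance (β : ℝ) : SecondCountableTopology (BetaShift β) :=
  (BetaShift.isClosedEmbedding_seq β).isEmbedding.secondCountableTopology

lemma isClosed_ge (q : ℕ → Fin 2) : IsClosed {x : ℕ → Fin 2 | toLex q ≤ toLex x} := by
  rw [← isOpen_compl_iff]
  have : {x : ℕ → Fin 2 | toLex q ≤ toLex x}ᶜ =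
      ⋃ i : ℕ, ({x | x i < q i} ∩ ⋂ j : Fin i, {x | x j = q j}) := by
    ext x
    simp only [mem_compl_iff, mem_ofPred_eq, not_le, mem_iUnion, mem_inter_iff, mem_iInter]
    refine Iff.trans lex_lt_iff ⟨?_, ?_⟩
    · rintro ⟨i, h1, h2⟩; exact ⟨i, h2, fun j => h1 j j.2⟩
    · rintro ⟨i, h2, h1⟩; exact ⟨i, fun j hj => h1 ⟨j, hj⟩, h2⟩
  rw [this]
  refine isOpen_iUnion fun i => IsOpen.inter ?_ (isOpen_iInter_of_finite fun j => ?_)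
  · exact (isOpen_discrete (Iio (q i))).preimage (continuous_apply (A := fun _ => Fin 2) i)
  · exact (isOpen_discrete {a : Fin 2 | a = q j}).preimage
      (continuous_apply (A := fun _ => Fin 2) (j : ℕ))

/-- The order topology is Hausdorff and coarser than the compact product topology, so the two
coincide. -/
instance (β : ℝ) : OrderTopology (BetaShift β) := by
  refine ⟨?_⟩
  have hle : (inferInstance : TopologicalSpace (BetaShift β)) ≤ Preorder.topology (BetaShift β) := by
    refine le_generateFrom ?_
    rintro s ⟨a, rfl | rfl⟩
    · have : Ioi a = (Iic a)ᶜ := by simp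
      rw [this]
      exact ((isClosed_le a.seq).preimage (BetaShift.continuous_seq β)).isOpen_compl
    · have : Iio a = (Ici a)ᶜ := by simp
      rw [this]
      exact ((isClosed_ge a.seq).preimage (BetaShift.continuous_seq β)).isOpen_compl
  have ht2 : @T2Space (BetaShift β) (Preorder.topology (BetaShift β)) :=
    letI := Preorder.topology (BetaShift β)
    haveI : OrderTopology (BetaShift β) := ⟨rfl⟩
    inferInstance
  refine le_antisymm hle ?_
  have h := @Continuous.isClosedMap _ _ inferInstance (Preorder.topology (BetaShift β))
    inferInstance ht2 (id : BetaShift β → BetaShift β) (continuous_id_of_le hle)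
  intro s hs
  have h2 := h sᶜ hs.isClosed_compl
  rw [image_id] at h2
  have h3 := @IsClosed.isOpen_compl _ (Preorder.topology _) _ h2
  rwa [compl_compl] at h3

/-! ### The Banach spaces `BV`, `𝓑` and `𝓕` -/

namespace BV

variable {β : ℝ}

lemma norm_le_of {f : BV β} {A B : ℝ} (hA : ∀ x, ‖f x‖ ≤ A) (hA0 : 0 ≤ A)
    (hB : eVariationOn f univ ≤ ENNReal.ofReal B) (hB0 : 0 ≤ B) : ‖f‖ ≤ A + B :=
  add_le_add (Real.iSup_le hA hA0) (ENNReal.toReal_le_of_le_ofReal hB0 hB)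

lemma eVariationOn_le_norm (f : BV β) : eVariationOn f univ ≤ ENNReal.ofReal ‖f‖ := by
  rw [← ENNReal.ofReal_toReal f.var_ne_top]
  exact ENNReal.ofReal_le_ofReal (by rw [norm_def]; linarith [f.sup_nonneg])

/-- Evaluation at a point as a bounded functional. -/
def eval (x : BetaShift β) : BV β →L[ℂ] ℂ :=
  LinearMap.mkContinuous
    { toFun := fun f => f x
      map_add' := fun _ _ => rfl
      map_smul' := fun _ _ => rfl } 1 fun f => by simpa using f.norm_apply_le x

@[simp] lemma eval_apply (x : BetaShift β) (f : BV β) : eval x f = f x := rfl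

/-- A Cauchy sequence in `BV` converges uniformly and, by lower semicontinuity of the variation, in
variation. -/
lemma exists_uniform_limit {u : ℕ → BV β} (hu : CauchySeq u) :
    ∃ f : BetaShift β → ℂ, ∀ ε > 0, ∃ N, ∀ n ≥ N, (∀ x, ‖f x - u n x‖ ≤ ε) ∧
      eVariationOn (f - ⇑(u n)) univ ≤ ENNReal.ofReal ε := by
  have hpt : ∀ x, ∃ y, Tendsto (fun n => u n x) atTop (𝓝 y) := fun x =>
    cauchySeq_tendsto_of_complete (u := fun n => eval x (u n))
      ((eval x).uniformContinuous.comp_cauchySeq hu)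
  choose f hf using hpt
  refine ⟨f, fun ε hε => ?_⟩
  obtain ⟨N, hN⟩ := Metric.cauchySeq_iff.1 hu ε hε
  have hN' : ∀ m ≥ N, ∀ n ≥ N, ‖u m - u n‖ ≤ ε := fun m hm n hn => by
    rw [← dist_eq_norm]; exact (hN m hm n hn).le
  refine ⟨N, fun n hn => ⟨fun x => ?_, ?_⟩⟩
  · refine le_of_tendsto ((hf x).sub_const (u n x)).norm ?_
    filter_upwards [eventually_ge_atTop N] with m hm
    exact ((u m - u n).norm_apply_le x).trans (hN' m hm n hn)
  · refine not_lt.1 fun hlt => ?_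
    have h1 := eVariationOn.lowerSemicontinuous_aux (F := fun m => ⇑(u m - u n)) (p := atTop)
      (f := f - ⇑(u n)) (s := univ) (fun x _ => (hf x).sub_const (u n x)) hlt
    obtain ⟨m, hm, hmN⟩ := (h1.and (eventually_ge_atTop N)).exists
    exact hm.not_ge ((eVariationOn_le_norm _).trans (ENNReal.ofReal_le_ofReal (hN' m hmN n hn)))

lemma mem_of_sub_mem {f : BetaShift β → ℂ} (g : BV β) (h : f - ⇑g ∈ bvFunctions β) :
    f ∈ bvFunctions β := by
  have := add_mem h g.coe_mem
  rwa [sub_add_cancel] at this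

instance : CompleteSpace (BV β) := by
  refine Metric.complete_of_cauchySeq_tendsto fun u hu => ?_
  obtain ⟨f, key⟩ := exists_uniform_limit hu
  obtain ⟨N, hN⟩ := key 1 one_pos
  have hbv : f ∈ bvFunctions β := mem_of_sub_mem (u N)
    (ne_top_of_le_ne_top ENNReal.ofReal_ne_top (hN N le_rfl).2)
  refine ⟨⟨f, hbv⟩, Metric.tendsto_atTop.2 fun ε hε => ?_⟩
  obtain ⟨N, hN⟩ := key (ε / 3) (by positivity)
  refine ⟨N, fun n hn => ?_⟩
  have h1 : ‖(⟨f, hbv⟩ : BV β) - u n‖ ≤ ε / 3 + ε / 3 :=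
    norm_le_of (fun x => (hN n hn).1 x) (by positivity) (hN n hn).2 (by positivity)
  have h2 : dist (u n) (⟨f, hbv⟩ : BV β) = ‖(⟨f, hbv⟩ : BV β) - u n‖ := by
    rw [dist_comm, dist_eq_norm]
  rw [h2]
  linarith

/-- Pointwise multiplication by a function of bounded variation. -/
def mul (f : BV β) : BV β →L[ℂ] BV β :=
  LinearMap.mkContinuous
    { toFun := fun g => ⟨⇑f * ⇑g, ne_top_of_le_ne_top (ENNReal.add_ne_top.2
        ⟨ENNReal.mul_ne_top ENNReal.ofReal_ne_top g.var_ne_top,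
          ENNReal.mul_ne_top ENNReal.ofReal_ne_top f.var_ne_top⟩)
        (eVariationOn_mul_le f g univ (A := ENNReal.ofReal (⨆ x, ‖f x‖))
          (B := ENNReal.ofReal (⨆ x, ‖g x‖))
          (fun x => by
            rw [← ofReal_norm]; exact ENNReal.ofReal_le_ofReal (f.norm_apply_le_sup x))
          fun x => by
            rw [← ofReal_norm]; exact ENNReal.ofReal_le_ofReal (g.norm_apply_le_sup x))⟩
      map_add' := fun g h => ext_iff'.2 fun x => mul_add _ _ _
      map_smul' := fun c g => ext_iff'.2 fun x => by
        change f x * (c * g x) = c * (f x * g x); ring } ‖f‖ fun g => by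
    have h1 := norm_le_of (f := ⟨⇑f * ⇑g, ne_top_of_le_ne_top (ENNReal.add_ne_top.2
        ⟨ENNReal.mul_ne_top ENNReal.ofReal_ne_top g.var_ne_top,
          ENNReal.mul_ne_top ENNReal.ofReal_ne_top f.var_ne_top⟩)
        (eVariationOn_mul_le f g univ (A := ENNReal.ofReal (⨆ x, ‖f x‖))
          (B := ENNReal.ofReal (⨆ x, ‖g x‖))
          (fun x => by
            rw [← ofReal_norm]; exact ENNReal.ofReal_le_ofReal (f.norm_apply_le_sup x))
          fun x => by
            rw [← ofReal_norm]; exact ENNReal.ofReal_le_ofReal (g.norm_apply_le_sup x))⟩)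
      (A := (⨆ x, ‖f x‖) * ⨆ x, ‖g x‖)
      (B := (⨆ x, ‖f x‖) * (eVariationOn g univ).toReal +
        (⨆ x, ‖g x‖) * (eVariationOn f univ).toReal)
      (fun x => by
        change ‖f x * g x‖ ≤ _
        rw [norm_mul]
        exact mul_le_mul (f.norm_apply_le_sup x) (g.norm_apply_le_sup x) (norm_nonneg _)
          f.sup_nonneg)
      (mul_nonneg f.sup_nonneg g.sup_nonneg)
      (by
        refine (eVariationOn_mul_le f g univ (A := ENNReal.ofReal (⨆ x, ‖f x‖))
          (B := ENNReal.ofReal (⨆ x, ‖g x‖))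
          (fun x => by
            rw [← ofReal_norm]; exact ENNReal.ofReal_le_ofReal (f.norm_apply_le_sup x))
          fun x => by
            rw [← ofReal_norm]; exact ENNReal.ofReal_le_ofReal (g.norm_apply_le_sup x)).trans ?_
        rw [ENNReal.ofReal_add (mul_nonneg f.sup_nonneg ENNReal.toReal_nonneg)
          (mul_nonneg g.sup_nonneg ENNReal.toReal_nonneg), ENNReal.ofReal_mul f.sup_nonneg,
          ENNReal.ofReal_mul g.sup_nonneg, ENNReal.ofReal_toReal g.var_ne_top,
          ENNReal.ofReal_toReal f.var_ne_top])
      (add_nonneg (mul_nonneg f.sup_nonneg ENNReal.toReal_nonneg)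
        (mul_nonneg g.sup_nonneg ENNReal.toReal_nonneg))
    refine h1.trans ?_
    rw [norm_def f, norm_def g]
    have h2 : 0 ≤ (eVariationOn f univ).toReal * (eVariationOn g univ).toReal :=
      mul_nonneg ENNReal.toReal_nonneg ENNReal.toReal_nonneg
    linarith

@[simp] lemma mul_apply (f g : BV β) (x : BetaShift β) : mul f g x = f x * g x := rfl

end BV

instance (β : ℝ) : CompleteSpace (BVQuot β) := inferInstance

instance (β : ℝ) : CompleteSpace (spaceF β) :=
  (Submodule.isClosed_topologicalClosure (stepSpan β)).completeSpace_coe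

lemma cls_add {β : ℝ} (f g : BV β) : cls (f + g) = cls f + cls g := rfl

lemma cls_sub {β : ℝ} (f g : BV β) : cls (f - g) = cls f - cls g := rfl

lemma cls_smul {β : ℝ} (c : ℂ) (f : BV β) : cls (c • f) = c • cls f := rfl

lemma cls_eq_iff {β : ℝ} {f g : BV β} :
    cls f = cls g ↔ ∃ C : Set (BetaShift β), C.Countable ∧ ∀ x ∉ C, f x = g x := by
  unfold cls
  rw [Submodule.Quotient.eq]
  refine ⟨?_, ?_⟩ <;> rintro ⟨C, hC, h⟩ <;> refine ⟨C, hC, fun x hx => ?_⟩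
  · exact sub_eq_zero.1 (h x hx)
  · exact sub_eq_zero.2 (h x hx)

lemma exists_cls_eq_norm_lt {β : ℝ} (f : BV β) {c : ℝ} (h : ‖cls f‖ < c) :
    ∃ g : BV β, cls g = cls f ∧ ‖g‖ < c := by
  obtain ⟨g, hg, hlt⟩ := Submodule.Quotient.norm_mk_lt (S := negligible β) (cls f)
    (sub_pos.2 h)
  exact ⟨g, hg, by linarith⟩

lemma norm_cls_le {β : ℝ} (f : BV β) : ‖cls f‖ ≤ ‖f‖ := Submodule.Quotient.norm_mk_le _ f

/-- The quotient norm dominates the essential supremum. -/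
lemma exists_countable_norm_le {β : ℝ} (f : BV β) :
    ∃ C : Set (BetaShift β), C.Countable ∧ ∀ x ∉ C, ‖f x‖ ≤ ‖cls f‖ := by
  have h : ∀ n : ℕ, ∃ C : Set (BetaShift β), C.Countable ∧
      ∀ x ∉ C, ‖f x‖ ≤ ‖cls f‖ + 1 / ((n : ℝ) + 1) := by
    intro n
    obtain ⟨g, hg, hlt⟩ := exists_cls_eq_norm_lt f
      (show ‖cls f‖ < ‖cls f‖ + 1 / ((n : ℝ) + 1) by
        have : (0 : ℝ) < 1 / ((n : ℝ) + 1) := by positivity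
        linarith)
    obtain ⟨C, hC, h⟩ := cls_eq_iff.1 hg
    exact ⟨C, hC, fun x hx => by rw [← h x hx]; exact (g.norm_apply_le x).trans hlt.le⟩
  choose C hC h using h
  refine ⟨⋃ n, C n, countable_iUnion hC, fun x hx => ?_⟩
  have hlim := (tendsto_one_div_add_atTop_nhds_zero_nat (𝕜 := ℝ)).const_add ‖cls f‖
  rw [add_zero] at hlim
  exact ge_of_tendsto' hlim fun n => h n x fun hn => hx (mem_iUnion.2 ⟨n, hn⟩)

/-! ### Indicator functions of initial intervals span `𝓕` -/

lemma chiBV_apply {β : ℝ} (a : ℕ → Fin 2) (x : BetaShift β) :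
    chiBV β a x = {x : BetaShift β | toLex x.seq ≤ toLex a}.indicator 1 x := rfl

lemma chiBV_of_le {β : ℝ} {a : ℕ → Fin 2} {x : BetaShift β} (h : toLex x.seq ≤ toLex a) :
    chiBV β a x = 1 := indicator_of_mem (s := {x : BetaShift β | toLex x.seq ≤ toLex a}) h _

lemma chiBV_of_not_le {β : ℝ} {a : ℕ → Fin 2} {x : BetaShift β} (h : ¬ toLex x.seq ≤ toLex a) :
    chiBV β a x = 0 := indicator_of_notMem (s := {x : BetaShift β | toLex x.seq ≤ toLex a}) h _

/-- A sequence with finitely many ones is `0` or ends in `1000⋯`; in the latter case its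
predecessor in the beta-shift is obtained by replacing this tail by `0q`. -/
lemma cls_chiBV_mem {β : ℝ} (hβ : 1 < β ∧ β ≤ 2) {a : ℕ → Fin 2} (ha : a ∈ betaSet β) :
    cls (chiBV β a) = 0 ∨ ∃ d ∈ infiniteOnes β, cls (chiBV β a) = cls (chiBV β d) := by
  classical
  by_cases hinf : ∀ n, ∃ k ≥ n, a k = 1
  · exact Or.inr ⟨a, ⟨ha, hinf⟩, rfl⟩
  push Not at hinf
  rcases Nat.eq_zero_or_pos (Nat.find hinf) with h0 | h0
  · left
    have h1 := Nat.find_spec hinf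
    rw [h0] at h1
    refine cls_eq_iff.2 ⟨{⟨a, ha⟩}, countable_singleton _, fun x hx => chiBV_of_not_le fun hle => ?_⟩
    rcases hle.eq_or_lt with h | h
    · exact hx (BetaShift.ext (toLex.injective h))
    · obtain ⟨k, -, -, hk⟩ := exists_first_difference h
      exact h1 k (Nat.zero_le k) hk
  · right
    obtain ⟨n, hn⟩ := Nat.exists_eq_succ_of_ne_zero h0.ne'
    have h1 := Nat.find_spec hinf
    have h2 := Nat.find_min hinf (show n < Nat.find hinf by omega)
    rw [hn] at h1
    push Not at h2
    obtain ⟨m, hm, hm1⟩ := h2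
    have hmn : m = n := by
      by_contra hne
      exact h1 m (by omega) hm1
    subst hmn
    refine ⟨splice a m (quasiOne β), splice_mem_infiniteOnes hβ ha
      (quasiOne_mem_infiniteOnes hβ) hm1, ?_⟩
    refine cls_eq_iff.2 ⟨{⟨a, ha⟩}, countable_singleton _, fun x hx => ?_⟩
    by_cases hle : toLex x.seq ≤ toLex (splice a m (quasiOne β))
    · rw [chiBV_of_le hle, chiBV_of_le (hle.trans (splice_lt hm1).le)]
    · rw [chiBV_of_not_le hle, chiBV_of_not_le fun hxa => hle ?_]
      have hlt : toLex x.seq < toLex a :=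
        lt_of_le_of_ne hxa fun h => hx (BetaShift.ext (toLex.injective h))
      obtain ⟨k, hk, hk0, hk1⟩ := exists_first_difference hlt
      rcases lt_trichotomy k m with hkm | rfl | hkm
      · refine (lt_of_agree (n := k) (fun j hj => ?_) hk0 ?_).le
        · rw [splice_of_lt (hj.trans hkm), hk j hj]
        · rw [splice_of_lt hkm, hk1]
      · exact le_splice hk hk0 ((mem_betaSet_iff hβ).1 x.mem _)
      · exact absurd hk1 (h1 k (by omega))

lemma exists_isLUB_betaShift {β : ℝ} {S : Set (BetaShift β)} (hS : S.Nonempty) :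
    ∃ a, IsLUB S a := by
  obtain ⟨a, ha⟩ := isClosed_closure.isCompact.exists_isGreatest hS.closure
  exact ⟨a, fun x hx => ha.2 (subset_closure hx), fun b hb =>
    closure_minimal (t := Iic b) hb isClosed_Iic ha.1⟩

/-- A lower set is an initial interval, up to its least upper bound. -/
lemma cls_lowerSet_mem {β : ℝ} (hβ : 1 < β ∧ β ≤ 2) {S : Set (BetaShift β)} (hS : IsLowerSet S)
    {f : BV β} (hf : ∀ x, f x = S.indicator 1 x) :
    cls f ∈ Submodule.span ℂ ((fun a => cls (chiBV β a)) '' infiniteOnes β) := by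
  rcases S.eq_empty_or_nonempty with rfl | hne
  · have : cls f = 0 := cls_eq_iff.2 ⟨∅, countable_empty, fun x _ => by rw [hf]; simp⟩
    rw [this]; exact zero_mem _
  obtain ⟨a, ha⟩ := exists_isLUB_betaShift hne
  have h1 : cls f = cls (chiBV β a.seq) := by
    refine cls_eq_iff.2 ⟨{a}, countable_singleton _, fun x hx => ?_⟩
    rw [hf]
    by_cases hxS : x ∈ S
    · rw [indicator_of_mem hxS, chiBV_of_le (ha.1 hxS)]; rfl
    · rw [indicator_of_notMem hxS, chiBV_of_not_le fun hle => ?_]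
      have hlt : x < a := lt_of_le_of_ne hle hx
      obtain ⟨y, hy, hxy⟩ := (lt_isLUB_iff ha).1 hlt
      exact hxS (hS hxy.le hy)
  rw [h1]
  rcases cls_chiBV_mem hβ a.mem with h | ⟨d, hd, h⟩
  · rw [h]; exact zero_mem _
  · rw [h]; exact Submodule.subset_span ⟨d, hd, rfl⟩

lemma indicator_bv {β : ℝ} {S : Set (BetaShift β)} (hS : IsLowerSet S) :
    S.indicator (1 : BetaShift β → ℂ) ∈ bvFunctions β :=
  ne_top_of_le_ne_top ENNReal.one_ne_top (eVariationOn_indicator_lower hS)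

/-- The indicator function of an interval is the difference of those of two lower sets. -/
lemma stepSpan_le {β : ℝ} (hβ : 1 < β ∧ β ≤ 2) :
    stepSpan β ≤ Submodule.span ℂ ((fun a => cls (chiBV β a)) '' infiniteOnes β) := by
  refine Submodule.span_le.2 ?_
  rintro _ ⟨f, I, hI, hf, rfl⟩
  have hA : IsLowerSet {x | ∃ y ∈ I, x ≤ y} := fun x z hzx ⟨y, hy, h⟩ => ⟨y, hy, hzx.trans h⟩
  have hB : IsLowerSet {x | ∀ y ∈ I, x < y} := fun x z hzx h y hy => hzx.trans_lt (h y hy)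
  have h1 : f = (⟨_, indicator_bv hA⟩ : BV β) - ⟨_, indicator_bv hB⟩ ∨ I = ∅ := by
    rcases I.eq_empty_or_nonempty with h | ⟨z, hz⟩
    · exact Or.inr h
    left
    rw [BV.ext_iff']
    intro x
    change f x = {x | ∃ y ∈ I, x ≤ y}.indicator 1 x - {x | ∀ y ∈ I, x < y}.indicator 1 x
    rw [hf]
    by_cases hx : x ∈ I
    · rw [indicator_of_mem hx, indicator_of_mem (show x ∈ {x | ∃ y ∈ I, x ≤ y} from ⟨x, hx, le_rfl⟩),
        indicator_of_notMem (show x ∉ {x | ∀ y ∈ I, x < y} from fun h => lt_irrefl _ (h x hx))]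
      simp
    · rw [indicator_of_notMem hx]
      by_cases hx2 : ∃ y ∈ I, x ≤ y
      · have h3 : x ∈ {x | ∀ y ∈ I, x < y} := by
          intro w hw
          by_contra hwx
          obtain ⟨y, hy, hxy⟩ := hx2
          exact hx (hI.out hw hy ⟨not_lt.1 hwx, hxy⟩)
        rw [indicator_of_mem (show x ∈ {x | ∃ y ∈ I, x ≤ y} from hx2), indicator_of_mem h3]
        simp
      · have h3 : x ∉ {x | ∀ y ∈ I, x < y} := fun h => hx2 ⟨z, hz, (h z hz).le⟩
        rw [indicator_of_notMem (show x ∉ {x | ∃ y ∈ I, x ≤ y} from hx2), indicator_of_notMem h3]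
        simp
  rcases h1 with rfl | rfl
  · exact sub_mem (cls_lowerSet_mem hβ hA fun _ => rfl) (cls_lowerSet_mem hβ hB fun _ => rfl)
  · have : cls f = 0 := cls_eq_iff.2 ⟨∅, countable_empty, fun x _ => by rw [hf]; simp⟩
    change cls f ∈ _
    rw [this]; exact zero_mem _

/-- The formal linear combinations of the `χ_{[0, d]}`, `d ∈ infiniteOnes β`, as elements
of `𝓕`. -/
def chiComb (β : ℝ) : ({d : BetaShift β // d.seq ∈ infiniteOnes β} →₀ ℂ) →ₗ[ℂ] spaceF β :=
  Finsupp.linearCombination ℂ fun d => chi β d.1.seq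

lemma denseRange_chiComb {β : ℝ} (hβ : 1 < β ∧ β ≤ 2) : DenseRange (chiComb β) := by
  intro x
  rw [IsInducing.subtypeVal.closure_eq_preimage_closure_image, mem_preimage]
  have h1 : stepSpan β ≤ (LinearMap.range (chiComb β)).map (spaceF β).subtype := by
    refine (stepSpan_le hβ).trans (Submodule.span_le.2 ?_)
    rintro _ ⟨d, hd, rfl⟩
    exact ⟨chi β d, ⟨Finsupp.single ⟨⟨d, hd.1⟩, hd⟩ 1, by simp [chiComb]⟩, rfl⟩
  refine closure_mono (fun y hy => ?_) (show (x : BVQuot β) ∈ closure (stepSpan β : Set _) from x.2)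
  obtain ⟨z, ⟨w, hw⟩, rfl⟩ := h1 hy
  exact ⟨z, ⟨w, hw⟩, rfl⟩

/-- Bounded operators on `𝓕` are determined by their values at the `χ_{[0, d]}`. -/
lemma clm_ext {β : ℝ} (hβ : 1 < β ∧ β ≤ 2) {Y : Type*} [NormedAddCommGroup Y] [NormedSpace ℂ Y]
    {S T : spaceF β →L[ℂ] Y} (h : ∀ a ∈ infiniteOnes β, S (chi β a) = T (chi β a)) : S = T := by
  refine DFunLike.coe_injective ((denseRange_chiComb hβ).equalizer S.continuous T.continuous ?_)
  ext c
  simp only [Function.comp, chiComb, Finsupp.linearCombination_apply, Finsupp.sum, map_sum,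
    map_smul]
  exact Finset.sum_congr rfl fun d _ => by rw [h _ d.2]

/-! ### Bounded operators on `𝓕` -/

/-- Summation by parts: if `g` is a representative of `∑ c_d χ_{[0, d]}` on `[x₀, ∞)`, choosing a
generic point between any two consecutive jumps bounds `∑ c_d G_d` by the variation of `g`. -/
lemma norm_sum_le_variation {β : ℝ} (hβ : 1 < β ∧ β ≤ 2) {Y : Type*} [NormedAddCommGroup Y]
    [NormedSpace ℂ Y] {G : (ℕ → Fin 2) → Y} {M : ℝ} (hG : ∀ a ∈ infiniteOnes β, ‖G a‖ ≤ M)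
    (g : BV β) {C : Set (BetaShift β)} (hC : C.Countable)
    (c : {d : BetaShift β // d.seq ∈ infiniteOnes β} → ℂ)
    (S : Finset {d : BetaShift β // d.seq ∈ infiniteOnes β}) :
    ∀ x₀ ∉ C, (∀ d ∈ S, x₀ ≤ d.1) →
      (∀ x ∉ C, x₀ ≤ x → g x = ∑ d ∈ S, c d * chiBV β d.1.seq x) →
      ‖∑ d ∈ S, c d • G d.1.seq‖ ≤
        M * ((eVariationOn g (Ici x₀)).toReal + ⨆ x, ‖g x‖) := by
  classical
  have hM : 0 ≤ M := (norm_nonneg _).trans (hG _ (quasiOne_mem_infiniteOnes hβ))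
  induction S using Finset.induction_on_min with
  | empty =>
    intro x₀ _ _ _
    simp only [Finset.sum_empty, norm_zero]
    exact mul_nonneg hM (add_nonneg ENNReal.toReal_nonneg g.sup_nonneg)
  | insert m S hm ih =>
    intro x₀ hx₀ hle hg
    have hmS : m ∉ S := fun h => lt_irrefl _ (hm m h)
    rw [Finset.sum_insert hmS]
    simp only [Finset.sum_insert hmS] at hg
    have hx₀m : chiBV β m.1.seq x₀ = 1 := chiBV_of_le (hle m (Finset.mem_insert_self _ _))
    have hterm : ‖c m • G m.1.seq‖ ≤ M * ‖c m‖ := by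
      rw [norm_smul, mul_comm]
      exact mul_le_mul_of_nonneg_right (hG _ m.2) (norm_nonneg _)
    rcases S.eq_empty_or_nonempty with rfl | hne
    · simp only [Finset.sum_empty, add_zero] at hg ⊢
      have h1 := hg x₀ hx₀ le_rfl
      rw [hx₀m, mul_one] at h1
      refine hterm.trans (mul_le_mul_of_nonneg_left ?_ hM)
      rw [← h1]
      exact (g.norm_apply_le_sup x₀).trans (le_add_of_nonneg_left ENNReal.toReal_nonneg)
    · set m₁ := S.min' hne
      have hm₁ : m₁ ∈ S := S.min'_mem hne
      obtain ⟨x₁, hx₁, hx₁C⟩ : ∃ x₁ : BetaShift β, (m.1 < x₁ ∧ x₁ ≤ m₁.1) ∧ x₁ ∉ C := by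
        by_contra! h
        exact not_countable_Ioc hβ m₁.2 (hm m₁ hm₁) (hC.mono fun x hx => h x hx)
      have hle₁ : ∀ d ∈ S, x₁ ≤ d.1 := fun d hd => hx₁.2.trans (S.min'_le d hd)
      have hx₀₁ : x₀ ≤ x₁ := (hle m (Finset.mem_insert_self _ _)).trans hx₁.1.le
      have hg₁ : ∀ x ∉ C, x₁ ≤ x → g x = ∑ d ∈ S, c d * chiBV β d.1.seq x := by
        intro x hx hxx
        rw [hg x hx (hx₀₁.trans hxx),
          chiBV_of_not_le (fun h : x ≤ m.1 => (hx₁.1.trans_le hxx).not_ge h), mul_zero, zero_add]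
      have h1 := ih x₁ hx₁C hle₁ hg₁
      have h2 : g x₀ - g x₁ = c m := by
        have hs : ∀ y : BetaShift β, (∀ d ∈ S, y ≤ d.1) →
            ∑ d ∈ S, c d * chiBV β d.1.seq y = ∑ d ∈ S, c d := fun y hy =>
          Finset.sum_congr rfl fun d hd => by
            rw [chiBV_of_le (show toLex y.seq ≤ toLex d.1.seq from hy d hd), mul_one]
        rw [hg x₀ hx₀ le_rfl, hg₁ x₁ hx₁C le_rfl, hx₀m, mul_one, hs x₁ hle₁,
          hs x₀ fun d hd => hle d (Finset.mem_insert_of_mem hd), add_sub_cancel_right]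
      have hfin : ∀ s : Set (BetaShift β), eVariationOn g s ≠ ⊤ := fun s =>
        ne_top_of_le_ne_top g.var_ne_top (eVariationOn.mono _ (subset_univ _))
      have h3 : ‖c m‖ + (eVariationOn g (Ici x₁)).toReal ≤ (eVariationOn g (Ici x₀)).toReal := by
        have h4 := eVariationOn.add_le_union (⇑g) (s := {x₀, x₁}) (t := Ici x₁) (by
          rintro x (rfl | rfl) y hy
          · exact hx₀₁.trans hy
          · exact hy)
        have h5 : eVariationOn g ({x₀, x₁} ∪ Ici x₁) ≤ eVariationOn g (Ici x₀) := by
          refine eVariationOn.mono _ ?_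
          rintro y ((rfl | rfl) | hy)
          · exact self_mem_Ici
          · exact hx₀₁
          · exact hx₀₁.trans hy
        have h6 := ENNReal.toReal_mono (hfin _) (h4.trans h5)
        rw [ENNReal.toReal_add (hfin _) (hfin _), eVariationOn.pair, edist_eq_enorm_sub, h2,
          toReal_enorm] at h6
        exact h6
      refine (norm_add_le _ _).trans ((add_le_add hterm h1).trans ?_)
      rw [← mul_add]
      refine mul_le_mul_of_nonneg_left ?_ hM
      linarith

/-- The space `𝓕` is freely generated, as a Banach space, by the `χ_{[0, d]}` with
`d ∈ infiniteOnes β`: it is isomorphic to `ℓ¹`. -/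
theorem exists_clm {β : ℝ} (hβ : 1 < β ∧ β ≤ 2) {Y : Type*} [NormedAddCommGroup Y]
    [NormedSpace ℂ Y] [CompleteSpace Y] {G : (ℕ → Fin 2) → Y} {M : ℝ}
    (hG : ∀ a ∈ infiniteOnes β, ‖G a‖ ≤ M) :
    ∃ T : spaceF β →L[ℂ] Y, ∀ a ∈ infiniteOnes β, T (chi β a) = G a := by
  set f : ({d : BetaShift β // d.seq ∈ infiniteOnes β} →₀ ℂ) →ₗ[ℂ] Y :=
    Finsupp.linearCombination ℂ fun d => G d.1.seq with hf
  have hM : 0 ≤ M := (norm_nonneg _).trans (hG _ (quasiOne_mem_infiniteOnes hβ))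
  have key : ∀ c, ‖f c‖ ≤ M * ‖chiComb β c‖ := by
    intro c
    set F : BV β := ∑ d ∈ c.support, c d • chiBV β d.1.seq with hF
    have hFv : ∀ x, F x = ∑ d ∈ c.support, c d * chiBV β d.1.seq x := by
      intro x
      rw [← BV.eval_apply, hF, map_sum]
      rfl
    have hcls : (chiComb β c : BVQuot β) = cls F := by
      rw [chiComb, Finsupp.linearCombination_apply, Finsupp.sum, Submodule.coe_sum, hF]
      change _ = (negligible β).mkQ _
      rw [map_sum]
      rfl
    have hbound : ∀ g : BV β, cls g = cls F → ‖f c‖ ≤ M * ‖g‖ := by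
      intro g hg
      obtain ⟨C, hC, h⟩ := cls_eq_iff.1 hg
      rw [hf, Finsupp.linearCombination_apply, Finsupp.sum]
      rcases c.support.eq_empty_or_nonempty with he | hne
      · rw [he, Finset.sum_empty, norm_zero]; positivity
      obtain ⟨x₀, hx₀, hx₀C⟩ : ∃ x₀ : BetaShift β, x₀ ≤ (c.support.min' hne).1 ∧ x₀ ∉ C := by
        by_contra! h'
        exact not_countable_Iic hβ (c.support.min' hne).2 (hC.mono fun x hx => h' x hx)
      refine (norm_sum_le_variation hβ hG g hC c c.support x₀ hx₀C
        (fun d hd => hx₀.trans (c.support.min'_le d hd)) fun x hx _ => by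
          rw [h x hx, hFv]).trans (mul_le_mul_of_nonneg_left ?_ hM)
      rw [BV.norm_def, add_comm]
      exact add_le_add le_rfl (ENNReal.toReal_mono g.var_ne_top
        (eVariationOn.mono _ (subset_univ _)))
    change _ ≤ M * ‖(chiComb β c : BVQuot β)‖
    rw [hcls]
    refine le_of_forall_pos_le_add fun ε hε => ?_
    obtain ⟨g, hg, hlt⟩ := exists_cls_eq_norm_lt F
      (show ‖cls F‖ < ‖cls F‖ + ε / (M + 1) by
        have : 0 < ε / (M + 1) := by positivity
        linarith)
    refine (hbound g hg).trans ((mul_le_mul_of_nonneg_left hlt.le hM).trans ?_)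
    rw [mul_add]
    have : M * (ε / (M + 1)) ≤ ε := by
      rw [mul_div_assoc', div_le_iff₀ (by positivity)]; nlinarith
    linarith
  refine ⟨f.extendOfNorm (chiComb β), fun a ha => ?_⟩
  have h1 := LinearMap.extendOfNorm_eq (f := f) (e := chiComb β) (denseRange_chiComb hβ) ⟨M, key⟩
    (Finsupp.single ⟨⟨a, ha.1⟩, ha⟩ 1)
  simpa [chiComb, hf] using h1

lemma norm_chiBV_le (β : ℝ) (a : ℕ → Fin 2) : ‖chiBV β a‖ ≤ 2 := by
  have := BV.norm_le_of (f := chiBV β a) (A := 1) (B := 1) (fun x => ?_) zero_le_one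
    (by rw [ENNReal.ofReal_one]; exact eVariationOn_indicator_lower (isLowerSet_le β a)) zero_le_one
  · linarith
  · by_cases h : toLex x.seq ≤ toLex a
    · simp [chiBV_of_le h]
    · simp [chiBV_of_not_le h]

lemma norm_chi_le (β : ℝ) (a : ℕ → Fin 2) : ‖chi β a‖ ≤ 2 :=
  (norm_cls_le (chiBV β a)).trans (norm_chiBV_le β a)

/-! ### Growth of the weights -/

@[simp] lemma weight_zero (t : ℝ) (a : ℕ → Fin 2) : weight t a 0 = 1 := by simp [weight]

lemma weight_pos (t : ℝ) (a : ℕ → Fin 2) (n : ℕ) : 0 < weight t a n := Real.exp_pos _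

lemma weight_add (t : ℝ) (a : ℕ → Fin 2) (m n : ℕ) :
    weight t a (m + n) = weight t a m * weight t (shift^[m] a) n := by
  rw [weight, weight, weight, ← Real.exp_add, Finset.sum_range_add]
  congr 2
  exact Finset.sum_congr rfl fun i _ => by rw [shift_iter, add_comm]

lemma weight_one (t : ℝ) (a : ℕ → Fin 2) : weight t a 1 = Real.exp (((a 0 : ℕ) : ℝ) * t) := by
  simp [weight]

lemma weight_succ (t : ℝ) (a : ℕ → Fin 2) (n : ℕ) :
    weight t a (n + 1) = weight t a n * Real.exp (((a n : ℕ) : ℝ) * t) := by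
  rw [weight_add, weight_one, shift_iter, zero_add]

lemma weight_succ' (t : ℝ) (a : ℕ → Fin 2) (n : ℕ) :
    weight t a (n + 1) = weight t a 1 * weight t (shift a) n := by
  rw [add_comm, weight_add]; rfl

lemma weight_congr (t : ℝ) {a b : ℕ → Fin 2} {n : ℕ} (h : ∀ j < n, a j = b j) :
    weight t a n = weight t b n := by
  rw [weight, weight]
  congr 1
  exact Finset.sum_congr rfl fun i hi => by rw [h i (Finset.mem_range.1 hi)]

lemma weight_zero_seq (t : ℝ) (n : ℕ) : weight t 0 n = 1 := by simp [weight]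

lemma weight_one_of_zero {t : ℝ} {a : ℕ → Fin 2} (h : a 0 = 0) : weight t a 1 = 1 := by
  rw [weight_one, h]; simp

lemma weight_one_of_one {t : ℝ} {a : ℕ → Fin 2} (h : a 0 = 1) : weight t a 1 = Real.exp t := by
  rw [weight_one, h]; simp

lemma weight_le_exp (t : ℝ) (a : ℕ → Fin 2) (n : ℕ) : weight t a n ≤ Real.exp (n * |t|) := by
  refine Real.exp_le_exp.2 ?_
  have h : ∀ i ∈ Finset.range n, ((a i : ℕ) : ℝ) * t ≤ |t| := fun i _ =>
    (le_abs_self _).trans (by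
      rw [abs_mul, Nat.abs_cast]; exact mul_le_of_le_one_left (abs_nonneg _) (digit_le a i))
  simpa using Finset.sum_le_card_nsmul _ _ _ h

lemma sigma_iterate_seq {β : ℝ} (hβ : 1 < β ∧ β ≤ 2) (n : ℕ) (x : BetaShift β) :
    ((sigma hβ)^[n] x).seq = shift^[n] x.seq := by
  induction n generalizing x with
  | zero => rfl
  | succ n ih => rw [Function.iterate_succ_apply, ih, Function.iterate_succ_apply]; rfl

lemma exp_birkhoffSum {β : ℝ} (hβ : 1 < β ∧ β ≤ 2) (t : ℝ) (n : ℕ) (x : BetaShift β) :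
    Real.exp (birkhoffSum (sigma hβ) (potential t) n x) = weight t x.seq n := by
  rw [birkhoffSum, weight]
  congr 1
  refine Finset.sum_congr rfl fun k _ => ?_
  have h : ((sigma hβ)^[k] x).seq 0 = x.seq k := by
    rw [sigma_iterate_seq, shift_iter, zero_add]
  rcases fin_two_cases (x.seq k) with h0 | h0 <;>
    simp [potential, indicator, h, h0]

/-- The largest weight of a word of length `n`. -/
def maxWeight (β t : ℝ) (n : ℕ) : ℝ := ⨆ x : BetaShift β, weight t x.seq n

lemma weight_le_maxWeight {β : ℝ} (t : ℝ) (n : ℕ) {a : ℕ → Fin 2} (ha : a ∈ betaSet β) :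
    weight t a n ≤ maxWeight β t n :=
  le_ciSup (f := fun x : BetaShift β => weight t x.seq n)
    ⟨_, by rintro _ ⟨x, rfl⟩; exact weight_le_exp t x.seq n⟩ ⟨a, ha⟩

lemma one_le_maxWeight {β : ℝ} (hβ : 1 < β ∧ β ≤ 2) (t : ℝ) (n : ℕ) : 1 ≤ maxWeight β t n := by
  have := weight_le_maxWeight t n (zero_seq_mem hβ)
  rwa [weight_zero_seq] at this

lemma maxWeight_add_le {β : ℝ} (hβ : 1 < β ∧ β ≤ 2) (t : ℝ) (m n : ℕ) :
    maxWeight β t (m + n) ≤ maxWeight β t m * maxWeight β t n := by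
  have : Nonempty (BetaShift β) := ⟨⟨0, zero_seq_mem hβ⟩⟩
  refine ciSup_le fun x => ?_
  rw [weight_add]
  exact mul_le_mul (weight_le_maxWeight t m x.mem)
    (weight_le_maxWeight t n (shift_iter_mem hβ x.mem m)) (weight_pos _ _ _).le
    (zero_le_one.trans (one_le_maxWeight hβ t m))

lemma subadditive_log_maxWeight {β : ℝ} (hβ : 1 < β ∧ β ≤ 2) (t : ℝ) :
    Subadditive fun n => Real.log (maxWeight β t n) := by
  intro m n
  have h := fun n => zero_lt_one.trans_le (one_le_maxWeight hβ t n)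
  rw [← Real.log_mul (h m).ne' (h n).ne']
  exact Real.log_le_log (h _) (maxWeight_add_le hβ t m n)

lemma bddBelow_log_maxWeight {β : ℝ} (hβ : 1 < β ∧ β ≤ 2) (t : ℝ) :
    BddBelow (range fun n : ℕ => Real.log (maxWeight β t n) / n) :=
  ⟨0, by
    rintro _ ⟨n, rfl⟩
    exact div_nonneg (Real.log_nonneg (one_le_maxWeight hβ t n)) n.cast_nonneg⟩

/-- By Fekete's lemma the upper limit in the definition of `r_t` is a limit. -/
lemma radius_eq {β : ℝ} (hβ : 1 < β ∧ β ≤ 2) (t : ℝ) :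
    radius hβ t = Real.exp (subadditive_log_maxWeight hβ t).lim := by
  have h1 := (subadditive_log_maxWeight hβ t).tendsto_lim (bddBelow_log_maxWeight hβ t)
  have h2 := (Real.continuous_exp.tendsto _).comp h1
  rw [← h2.limsup_eq, radius]
  congr 1
  ext n
  simp only [exp_birkhoffSum]
  change maxWeight β t n ^ (1 / (n : ℝ)) = _
  rw [Real.rpow_def_of_pos (zero_lt_one.trans_le (one_le_maxWeight hβ t n))]
  simp only [Function.comp, mul_one_div]

lemma radius_pow_le {β : ℝ} (hβ : 1 < β ∧ β ≤ 2) (t : ℝ) (n : ℕ) :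
    radius hβ t ^ n ≤ maxWeight β t n := by
  rcases Nat.eq_zero_or_pos n with rfl | hn
  · simpa using one_le_maxWeight hβ t 0
  · have h := (subadditive_log_maxWeight hβ t).lim_le_div (bddBelow_log_maxWeight hβ t) hn.ne'
    rw [le_div_iff₀ (by exact_mod_cast hn)] at h
    rw [radius_eq, ← Real.exp_nat_mul, mul_comm]
    exact (Real.exp_le_exp.2 h).trans_eq
      (Real.exp_log (zero_lt_one.trans_le (one_le_maxWeight hβ t n)))

lemma one_le_radius {β : ℝ} (hβ : 1 < β ∧ β ≤ 2) (t : ℝ) : 1 ≤ radius hβ t := by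
  rw [radius_eq]
  refine Real.one_le_exp ?_
  refine ge_of_tendsto' ((subadditive_log_maxWeight hβ t).tendsto_lim (bddBelow_log_maxWeight hβ t))
    fun n => div_nonneg (Real.log_nonneg (one_le_maxWeight hβ t n)) n.cast_nonneg

lemma exists_weight_le {β : ℝ} (hβ : 1 < β ∧ β ≤ 2) {t ρ : ℝ} (hρ : radius hβ t < ρ) :
    ∃ C > 0, ∀ a ∈ betaSet β, ∀ n, weight t a n ≤ C * ρ ^ n := by
  have hρ0 : 0 < ρ := (zero_lt_one.trans_le (one_le_radius hβ t)).trans hρ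
  have h1 := (subadditive_log_maxWeight hβ t).tendsto_lim (bddBelow_log_maxWeight hβ t)
  have h2 : (subadditive_log_maxWeight hβ t).lim < Real.log ρ := by
    rwa [Real.lt_log_iff_exp_lt hρ0, ← radius_eq]
  have h3 : ∀ᶠ n in atTop, maxWeight β t n / ρ ^ n ≤ 1 := by
    filter_upwards [h1.eventually_lt_const h2, eventually_gt_atTop 0] with n hn hn0
    rw [div_lt_iff₀ (by exact_mod_cast hn0), mul_comm, ← Real.log_pow] at hn
    rw [div_le_one (by positivity)]
    exact ((Real.log_lt_log_iff (zero_lt_one.trans_le (one_le_maxWeight hβ t n))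
      (by positivity)).1 hn).le
  obtain ⟨C, hC⟩ := (isBoundedUnder_of_eventually_le h3).bddAbove_range
  refine ⟨max C 1, lt_max_of_lt_right one_pos, fun a ha n => ?_⟩
  refine (weight_le_maxWeight t n ha).trans ?_
  rw [← div_le_iff₀ (by positivity)]
  exact (hC ⟨n, rfl⟩).trans (le_max_left _ _)

lemma tendsto_weight_div {β : ℝ} (hβ : 1 < β ∧ β ≤ 2) {t z : ℝ} (hz : radius hβ t < z)
    {a : ℕ → Fin 2} (ha : a ∈ betaSet β) :
    Tendsto (fun n => weight t a n / z ^ n) atTop (𝓝 0) := by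
  obtain ⟨ρ, hρ, hρz⟩ := exists_between hz
  have hρ0 : 0 < ρ := (zero_lt_one.trans_le (one_le_radius hβ t)).trans hρ
  have hz0 := hρ0.trans hρz
  obtain ⟨C, hC0, hC⟩ := exists_weight_le hβ hρ
  have h1 := (tendsto_pow_atTop_nhds_zero_of_lt_one (div_pos hρ0 hz0).le
    ((div_lt_one hz0).2 hρz)).const_mul C
  rw [mul_zero] at h1
  refine squeeze_zero (fun n => (div_pos (weight_pos _ _ _) (by positivity)).le) (fun n => ?_) h1
  rw [div_pow, mul_div_assoc']
  exact div_le_div_of_nonneg_right (hC a ha n) (by positivity)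

/-- Uniform summability, with a linear factor, of the weights against powers beyond `r_t`. -/
lemma exists_summable_bound {β : ℝ} (hβ : 1 < β ∧ β ≤ 2) {t z : ℝ} (hz : radius hβ t < z) :
    ∃ b : ℕ → ℝ, (Summable fun n : ℕ => ((n : ℝ) + 1) * b n) ∧ (∀ n, 0 ≤ b n) ∧
      ∀ a ∈ betaSet β, ∀ n, weight t a n / z ^ n ≤ b n := by
  obtain ⟨ρ, hρ, hρz⟩ := exists_between hz
  have hρ0 : 0 < ρ := (zero_lt_one.trans_le (one_le_radius hβ t)).trans hρ
  have hz0 := hρ0.trans hρz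
  obtain ⟨C, hC0, hC⟩ := exists_weight_le hβ hρ
  have hr : ‖ρ / z‖ < 1 := by
    rw [Real.norm_of_nonneg (div_pos hρ0 hz0).le]; exact (div_lt_one hz0).2 hρz
  refine ⟨fun n => C * (ρ / z) ^ n, ?_, fun n => by positivity, fun a ha n => ?_⟩
  · have h1 := (summable_pow_mul_geometric_of_norm_lt_one 1 hr).add
      (summable_geometric_of_norm_lt_one hr)
    refine (h1.mul_left C).congr fun n => ?_
    ring
  · change _ ≤ C * (ρ / z) ^ n
    rw [div_pow, mul_div_assoc']
    exact div_le_div_of_nonneg_right (hC a ha n) (by positivity)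

lemma exists_summable_bound' {β : ℝ} (hβ : 1 < β ∧ β ≤ 2) {t z : ℝ} (hz : radius hβ t < z) :
    ∃ b : ℕ → ℝ, Summable b ∧ (∀ n, 0 ≤ b n) ∧
      ∀ a ∈ betaSet β, ∀ n, weight t a n / z ^ n ≤ b n := by
  obtain ⟨b, hs, h0, hb⟩ := exists_summable_bound hβ hz
  refine ⟨b, Summable.of_nonneg_of_le h0 (fun n => ?_) hs, h0, hb⟩
  have := h0 n
  nlinarith [(n.cast_nonneg : (0 : ℝ) ≤ n)]

/-! ### The digit series -/

/-- The series `∑_{n ≥ 1} a_n H_{n-1}(t, a) z^{-n}`. -/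
def digitSeries (t : ℝ) (z : ℂ) (a : ℕ → Fin 2) : ℂ :=
  ∑' n : ℕ, ((a n : ℕ) : ℂ) * (weight t a n : ℂ) / z ^ (n + 1)

lemma phi_inv (β t : ℝ) (z : ℂ) : phi β t z⁻¹ = digitSeries t z (quasiOne β) := by
  unfold phi digitSeries
  simp only [inv_pow, div_eq_mul_inv]

lemma norm_digit_le (a : ℕ → Fin 2) (n : ℕ) : ‖((a n : ℕ) : ℂ)‖ ≤ 1 := by
  rw [Complex.norm_natCast]; exact digit_le a n

lemma norm_weight (t : ℝ) (a : ℕ → Fin 2) (n : ℕ) : ‖(weight t a n : ℂ)‖ = weight t a n := by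
  rw [Complex.norm_real, Real.norm_of_nonneg (weight_pos _ _ _).le]

lemma norm_digitTerm_le (t : ℝ) (z : ℂ) (a : ℕ → Fin 2) (n : ℕ) :
    ‖((a n : ℕ) : ℂ) * (weight t a n : ℂ) / z ^ (n + 1)‖ ≤ weight t a n / ‖z‖ ^ n * ‖z‖⁻¹ := by
  rw [norm_div, norm_mul, norm_weight, norm_pow, pow_succ, ← div_div, div_eq_mul_inv _ ‖z‖]
  refine mul_le_mul_of_nonneg_right (div_le_div_of_nonneg_right ?_ (by positivity)) (by positivity)
  exact mul_le_of_le_one_left (weight_pos _ _ _).le (norm_digit_le a n)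

lemma norm_pos_of_radius {β : ℝ} {hβ : 1 < β ∧ β ≤ 2} {t : ℝ} {z : ℂ} (hz : radius hβ t < ‖z‖) :
    0 < ‖z‖ := (zero_lt_one.trans_le (one_le_radius hβ t)).trans hz

lemma ne_zero_of_radius {β : ℝ} {hβ : 1 < β ∧ β ≤ 2} {t : ℝ} {z : ℂ} (hz : radius hβ t < ‖z‖) :
    z ≠ 0 := norm_pos_iff.1 (norm_pos_of_radius hz)

lemma hasSum_digitSeries {β : ℝ} (hβ : 1 < β ∧ β ≤ 2) {t : ℝ} {z : ℂ} (hz : radius hβ t < ‖z‖)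
    {a : ℕ → Fin 2} (ha : a ∈ betaSet β) :
    HasSum (fun n : ℕ => ((a n : ℕ) : ℂ) * (weight t a n : ℂ) / z ^ (n + 1))
      (digitSeries t z a) := by
  obtain ⟨b, hs, h0, hb⟩ := exists_summable_bound' hβ hz
  refine (Summable.of_norm_bounded (hs.mul_right ‖z‖⁻¹) fun n => ?_).hasSum
  exact (norm_digitTerm_le t z a n).trans
    (mul_le_mul_of_nonneg_right (hb a ha n) (by positivity))

lemma exists_norm_digitSeries_le {β : ℝ} (hβ : 1 < β ∧ β ≤ 2) {t : ℝ} {z : ℂ}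
    (hz : radius hβ t < ‖z‖) : ∃ M, ∀ a ∈ betaSet β, ‖digitSeries t z a‖ ≤ M := by
  obtain ⟨b, hs, h0, hb⟩ := exists_summable_bound' hβ hz
  refine ⟨∑' n, b n * ‖z‖⁻¹, fun a ha => ?_⟩
  exact tsum_of_norm_bounded (hs.mul_right ‖z‖⁻¹).hasSum fun n =>
    (norm_digitTerm_le t z a n).trans (mul_le_mul_of_nonneg_right (hb a ha n) (by positivity))

lemma digitSeries_rec {β : ℝ} (hβ : 1 < β ∧ β ≤ 2) {t : ℝ} {z : ℂ} (hz : radius hβ t < ‖z‖)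
    {a : ℕ → Fin 2} (ha : a ∈ betaSet β) :
    z * digitSeries t z a = ((a 0 : ℕ) : ℂ) + (weight t a 1 : ℂ) * digitSeries t z (shift a) := by
  have hz0 := ne_zero_of_radius hz
  have h1 := (hasSum_digitSeries hβ hz ha).mul_left z
  have h2 := (hasSum_digitSeries hβ hz (shift_mem_betaSet hβ ha)).mul_left (weight t a 1 : ℂ)
  have h3 : HasSum (fun n => z * (((a (n + 1) : ℕ) : ℂ) * (weight t a (n + 1) : ℂ) /
      z ^ (n + 1 + 1))) ((weight t a 1 : ℂ) * digitSeries t z (shift a)) := by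
    refine h2.congr_fun fun n => ?_
    rw [weight_succ', shift, pow_succ z (n + 1)]
    push_cast
    field_simp
  have h4 := ((hasSum_nat_add_iff' 1).2 h1).unique h3
  simp only [Finset.sum_range_one, weight_zero, zero_add, pow_one, Complex.ofReal_one, mul_one]
    at h4
  rw [mul_div_cancel₀ _ hz0] at h4
  linear_combination h4

/-! ### The transfer operator on indicator functions -/

lemma cons_shift (a : ℕ → Fin 2) : cons (a 0) (shift a) = a := by
  ext n; cases n <;> rfl

lemma cons_le_cons_iff {d : Fin 2} {x y : ℕ → Fin 2} :
    toLex (cons d x) ≤ toLex (cons d y) ↔ toLex x ≤ toLex y := by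
  refine ⟨fun h => not_lt.1 fun hlt => ?_, cons_le_cons⟩
  have hxy : x = y := congrArg shift (toLex.injective (h.antisymm (cons_le_cons hlt.le)))
  exact hlt.ne' (congrArg toLex hxy)

/-- The transfer operator maps `χ_{[0, a]}` to `a₁ + H₁(t, a) χ_{[0, σ a]}`, at every point. -/
lemma transferFun_chi {β : ℝ} (hβ : 1 < β ∧ β ≤ 2) (t : ℝ) {a : ℕ → Fin 2} (ha : a ∈ betaSet β)
    (x : BetaShift β) : transferFun hβ (potential t) (chiBV β a) x =
      ((a 0 : ℕ) : ℂ) + (weight t a 1 : ℂ) * chiBV β (shift a) x := by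
  have hb0 : branch 0 (chiBV β a) x = chiBV β a ⟨cons 0 x.seq, cons_zero_mem hβ x.mem⟩ :=
    dif_pos (cons_zero_mem hβ x.mem)
  rw [transferFun_eq, hb0]
  rcases fin_two_cases (a 0) with h0 | h0
  · have h1 : chiBV β a ⟨cons 0 x.seq, cons_zero_mem hβ x.mem⟩ = chiBV β (shift a) x := by
      by_cases hx : toLex x.seq ≤ toLex (shift a)
      · rw [chiBV_of_le hx, chiBV_of_le]
        rw [← cons_shift a, h0]; exact cons_le_cons hx
      · rw [chiBV_of_not_le hx, chiBV_of_not_le]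
        intro h
        rw [← cons_shift a, h0] at h
        exact hx (cons_le_cons_iff.1 h)
    have h2 : branch 1 (chiBV β a) x = 0 := by
      unfold branch
      split_ifs with h
      · exact chiBV_of_not_le (lt_of_agree (n := 0) (by simp) h0 rfl).not_ge
      · rfl
    rw [h1, h2, weight_one_of_zero h0, h0]
    simp
  · have h1 : chiBV β a ⟨cons 0 x.seq, cons_zero_mem hβ x.mem⟩ = 1 :=
      chiBV_of_le (lt_of_agree (n := 0) (by simp) rfl h0).le
    have h2 : branch 1 (chiBV β a) x = chiBV β (shift a) x := by
      unfold branch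
      by_cases hx : toLex x.seq ≤ toLex (shift a)
      · have hle : toLex (cons 1 x.seq) ≤ toLex a := by
          rw [← cons_shift a, h0]; exact cons_le_cons hx
        have hmem : cons 1 x.seq ∈ betaSet β :=
          cons_mem_of_le hβ (y := ⟨shift a, shift_mem_betaSet hβ ha⟩) hx
            (by rw [← h0, cons_shift]; exact ha)
        rw [dif_pos hmem, chiBV_of_le hx, chiBV_of_le hle]
      · rw [chiBV_of_not_le hx]
        split_ifs with h
        · refine chiBV_of_not_le fun hle => hx ?_
          rw [← cons_shift a, h0] at hle
          exact cons_le_cons_iff.1 hle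
        · rfl
    rw [h1, h2, weight_one_of_one h0, h0]
    simp

lemma coe_transferOp_mk {β : ℝ} (hβ : 1 < β ∧ β ≤ 2) (t : ℝ) (f : BV β) (hf : cls f ∈ spaceF β) :
    ((transferOp hβ t ⟨cls f, hf⟩ : spaceF β) : BVQuot β) = cls (transferBV hβ t f) := rfl

lemma chi_quasiOne {β : ℝ} (hβ : 1 < β ∧ β ≤ 2) : chi β (quasiOne β) = oneF β := by
  refine Subtype.ext (cls_eq_iff.2 ⟨∅, countable_empty, fun x _ => ?_⟩)
  exact chiBV_of_le (le_quasiOne hβ x.mem)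

lemma transferBV_chi {β : ℝ} (hβ : 1 < β ∧ β ≤ 2) (t : ℝ) {a : ℕ → Fin 2} (ha : a ∈ betaSet β) :
    transferBV hβ t (chiBV β a) =
      ((a 0 : ℕ) : ℂ) • oneBV β + (weight t a 1 : ℂ) • chiBV β (shift a) := by
  rw [BV.ext_iff']
  intro x
  rw [transferBV_apply, transferFun_chi hβ t ha, BV.add_apply, BV.smul_apply, BV.smul_apply,
    show oneBV β x = 1 from rfl, mul_one]

lemma transferOp_chi {β : ℝ} (hβ : 1 < β ∧ β ≤ 2) (t : ℝ) {a : ℕ → Fin 2} (ha : a ∈ betaSet β) :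
    transferOp hβ t (chi β a) =
      ((a 0 : ℕ) : ℂ) • oneF β + (weight t a 1 : ℂ) • chi β (shift a) :=
  Subtype.ext ((coe_transferOp_mk hβ t _ _).trans (by rw [transferBV_chi hβ t ha]; rfl))

/-! ### Solving the eigenvalue equation -/

/-- The series `∑_{n ≥ 0} H_n(t, a) z^{-n-1} χ_{[0, σⁿ a]}` in `𝓕`. -/
def orbitSeries (β t : ℝ) (z : ℂ) (a : ℕ → Fin 2) : spaceF β :=
  ∑' n : ℕ, ((weight t a n : ℂ) / z ^ (n + 1)) • chi β (shift^[n] a)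

lemma norm_orbitTerm_le (β t : ℝ) (z : ℂ) (a : ℕ → Fin 2) (n : ℕ) :
    ‖((weight t a n : ℂ) / z ^ (n + 1)) • chi β (shift^[n] a)‖ ≤
      weight t a n / ‖z‖ ^ n * (‖z‖⁻¹ * 2) := by
  rw [norm_smul, norm_div, norm_weight, norm_pow, pow_succ, ← div_div, div_eq_mul_inv _ ‖z‖,
    mul_assoc]
  have := weight_pos t a n
  exact mul_le_mul_of_nonneg_left (mul_le_mul_of_nonneg_left (norm_chi_le β _) (by positivity))
    (by positivity)

lemma hasSum_orbitSeries {β : ℝ} (hβ : 1 < β ∧ β ≤ 2) {t : ℝ} {z : ℂ} (hz : radius hβ t < ‖z‖)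
    {a : ℕ → Fin 2} (ha : a ∈ betaSet β) :
    HasSum (fun n : ℕ => ((weight t a n : ℂ) / z ^ (n + 1)) • chi β (shift^[n] a))
      (orbitSeries β t z a) := by
  obtain ⟨b, hs, h0, hb⟩ := exists_summable_bound' hβ hz
  refine (Summable.of_norm_bounded (hs.mul_right (‖z‖⁻¹ * 2)) fun n => ?_).hasSum
  exact (norm_orbitTerm_le β t z a n).trans
    (mul_le_mul_of_nonneg_right (hb a ha n) (by positivity))

lemma exists_norm_orbitSeries_le {β : ℝ} (hβ : 1 < β ∧ β ≤ 2) {t : ℝ} {z : ℂ}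
    (hz : radius hβ t < ‖z‖) : ∃ M, ∀ a ∈ betaSet β, ‖orbitSeries β t z a‖ ≤ M := by
  obtain ⟨b, hs, h0, hb⟩ := exists_summable_bound' hβ hz
  refine ⟨∑' n, b n * (‖z‖⁻¹ * 2), fun a ha => ?_⟩
  exact tsum_of_norm_bounded (hs.mul_right (‖z‖⁻¹ * 2)).hasSum fun n =>
    (norm_orbitTerm_le β t z a n).trans (mul_le_mul_of_nonneg_right (hb a ha n) (by positivity))

lemma orbitSeries_rec {β : ℝ} (hβ : 1 < β ∧ β ≤ 2) {t : ℝ} {z : ℂ} (hz : radius hβ t < ‖z‖)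
    {a : ℕ → Fin 2} (ha : a ∈ betaSet β) :
    z • orbitSeries β t z a = chi β a + (weight t a 1 : ℂ) • orbitSeries β t z (shift a) := by
  have hz0 := ne_zero_of_radius hz
  have h1 := (hasSum_orbitSeries hβ hz ha).const_smul z
  have h2 := (hasSum_orbitSeries hβ hz (shift_mem_betaSet hβ ha)).const_smul (weight t a 1 : ℂ)
  have h3 : HasSum (fun n => z • (((weight t a (n + 1) : ℂ) / z ^ (n + 1 + 1)) •
      chi β (shift^[n + 1] a))) ((weight t a 1 : ℂ) • orbitSeries β t z (shift a)) := by
    refine h2.congr_fun fun n => ?_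
    rw [weight_succ', Function.iterate_succ_apply, smul_smul, smul_smul, pow_succ z (n + 1)]
    congr 1
    push_cast
    field_simp
  have h4 := ((hasSum_nat_add_iff' 1).2 h1).unique h3
  simp only [Finset.sum_range_one, weight_zero, zero_add, pow_one, Complex.ofReal_one,
    smul_smul, mul_one_div_cancel hz0, one_smul, Function.iterate_zero, id] at h4
  rw [← h4]; abel

lemma hasSum_eigenTerm {β : ℝ} (hβ : 1 < β ∧ β ≤ 2) {t : ℝ} {z : ℂ} (hz : radius hβ t < ‖z‖) :
    HasSum (eigenTerm β t z) (z • orbitSeries β t z (quasiOne β)) := by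
  have hz0 := ne_zero_of_radius hz
  refine ((hasSum_orbitSeries hβ hz (quasiOne_mem hβ)).const_smul z).congr_fun fun n => ?_
  rw [smul_smul, eigenTerm, pow_succ]
  congr 1
  field_simp

/-- Beyond `r_t`, the equation `(z - 𝓛_t) f = g` can be solved up to one-dimensional errors. If
`u_a = ∑ H_n(a) z^{-n-1} χ_{[0, σⁿ a]}`, then `(z - 𝓛_t) u_a = χ_{[0, a]} - V(a)`, with `V` the digit
series. The operator `U` below sends `χ_{[0, a]}` to `u_a`, the functional `ν` sends it to `V(a)`
and `δ` sends it to `a₁`. -/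
lemma exists_quasi_resolvent {β : ℝ} (hβ : 1 < β ∧ β ≤ 2) {t : ℝ} {z : ℂ}
    (hz : radius hβ t < ‖z‖) :
    ∃ (U : spaceF β →L[ℂ] spaceF β) (ν δ : spaceF β →L[ℂ] ℂ),
      (∀ f, z • U f - transferOp hβ t (U f) = f - ν f • oneF β) ∧
      (∀ f, U (z • f - transferOp hβ t f) = f - δ f • orbitSeries β t z (quasiOne β)) ∧
      (∀ f, ν (z • f - transferOp hβ t f) = (1 - phi β t z⁻¹) * δ f) ∧
      (z • orbitSeries β t z (quasiOne β) - transferOp hβ t (orbitSeries β t z (quasiOne β)) =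
        (1 - phi β t z⁻¹) • oneF β) ∧
      ν (oneF β) = phi β t z⁻¹ ∧ ∀ a ∈ infiniteOnes β, ν (chi β a) = digitSeries t z a := by
  have hq := quasiOne_mem_infiniteOnes hβ
  obtain ⟨M₁, hM₁⟩ := exists_norm_orbitSeries_le hβ hz
  obtain ⟨M₂, hM₂⟩ := exists_norm_digitSeries_le hβ hz
  obtain ⟨U, hU⟩ := exists_clm hβ fun a (ha : a ∈ infiniteOnes β) => hM₁ a ha.1
  obtain ⟨ν, hν⟩ := exists_clm hβ fun a (ha : a ∈ infiniteOnes β) => hM₂ a ha.1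
  obtain ⟨δ, hδ⟩ := exists_clm hβ (G := fun a => ((a 0 : ℕ) : ℂ)) (M := 1)
    fun a _ => norm_digit_le a 0
  have hLchi : ∀ a ∈ infiniteOnes β, transferOp hβ t (chi β a) =
      ((a 0 : ℕ) : ℂ) • chi β (quasiOne β) + (weight t a 1 : ℂ) • chi β (shift a) := fun a ha => by
    rw [transferOp_chi hβ t ha.1, chi_quasiOne hβ]
  set L := transferOp hβ t
  have hLu : ∀ a ∈ infiniteOnes β, z • orbitSeries β t z a - L (orbitSeries β t z a) =
      chi β a - digitSeries t z a • oneF β := by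
    intro a ha
    have h1 := (hasSum_orbitSeries hβ hz ha.1)
    have h2 := h1.mapL L
    have h3 : HasSum (fun n : ℕ => (((a n : ℕ) : ℂ) * (weight t a n : ℂ) / z ^ (n + 1)) • oneF β)
        (digitSeries t z a • oneF β) := (hasSum_digitSeries hβ hz ha.1).smul_const _
    have h4 := (hasSum_orbitSeries hβ hz (shift_mem_betaSet hβ ha.1)).const_smul
      (weight t a 1 : ℂ)
    have h5 : L (orbitSeries β t z a) = digitSeries t z a • oneF β +
        (weight t a 1 : ℂ) • orbitSeries β t z (shift a) := by
      refine h2.unique ((h3.add h4).congr_fun fun n => ?_)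
      rw [map_smul, hLchi _ (shift_iter_mem_infiniteOnes hβ ha n), chi_quasiOne hβ, smul_add,
        smul_smul, smul_smul, smul_smul, ← Function.iterate_succ_apply' shift,
        Function.iterate_succ_apply shift, shift_iter, zero_add]
      have h6 : weight t a 1 * weight t (shift a) n =
          weight t a n * weight t (shift^[n] a) 1 := by rw [← weight_succ', weight_add]
      congr 2
      · ring
      · rw [← mul_div_assoc, ← Complex.ofReal_mul, h6]
        push_cast; ring
    rw [h5, orbitSeries_rec hβ hz ha.1]
    abel
  have hνone : ν (oneF β) = phi β t z⁻¹ := by rw [← chi_quasiOne hβ, hν _ hq, phi_inv]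
  have hUone : U (oneF β) = orbitSeries β t z (quasiOne β) := by rw [← chi_quasiOne hβ, hU _ hq]
  refine ⟨U, ν, δ, fun f => ?_, fun f => ?_, fun f => ?_, ?_, hνone, hν⟩
  · have h : (z • U - L.comp U) = ContinuousLinearMap.id ℂ _ - ν.smulRight (oneF β) := by
      refine clm_ext hβ fun a ha => ?_
      simp only [sub_apply, smul_apply,
        ContinuousLinearMap.comp_apply, ContinuousLinearMap.id_apply,
        ContinuousLinearMap.smulRight_apply]
      rw [hU a ha, hν a ha, hLu a ha]
    exact DFunLike.congr_fun h f
  · have h : U.comp (z • ContinuousLinearMap.id ℂ _ - L) = ContinuousLinearMap.id ℂ _ -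
        δ.smulRight (orbitSeries β t z (quasiOne β)) := by
      refine clm_ext hβ fun a ha => ?_
      simp only [sub_apply, smul_apply,
        ContinuousLinearMap.comp_apply, ContinuousLinearMap.id_apply,
        ContinuousLinearMap.smulRight_apply, hLchi a ha, map_sub, map_add, map_smul]
      rw [hU a ha, hU _ hq, hU _ (shift_mem_infiniteOnes hβ ha), hδ a ha,
        orbitSeries_rec hβ hz ha.1]
      abel
    exact DFunLike.congr_fun h f
  · have h : ν.comp (z • ContinuousLinearMap.id ℂ _ - L) = (1 - phi β t z⁻¹) • δ := by
      refine clm_ext hβ fun a ha => ?_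
      simp only [sub_apply, smul_apply,
        ContinuousLinearMap.comp_apply, ContinuousLinearMap.id_apply,
        hLchi a ha, map_sub, map_add, map_smul, smul_eq_mul]
      rw [hν a ha, hν _ hq, hν _ (shift_mem_infiniteOnes hβ ha), hδ a ha, ← phi_inv,
        digitSeries_rec hβ hz ha.1]
      ring
    exact DFunLike.congr_fun h f
  · rw [hLu _ hq, chi_quasiOne hβ, ← phi_inv, sub_smul, one_smul]

/-! ### Spectrum, eigenfunctions and eigenfunctionals beyond `r_t` -/

lemma bijective_smul_sub {β : ℝ} (hβ : 1 < β ∧ β ≤ 2) {t : ℝ} {z : ℂ} (hz : radius hβ t < ‖z‖)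
    (hφ : phi β t z⁻¹ ≠ 1) :
    Function.Bijective fun f : spaceF β => z • f - transferOp hβ t f := by
  obtain ⟨U, ν, δ, h1, h2, h3, h4, -, -⟩ := exists_quasi_resolvent hβ hz
  have hφ' : 1 - phi β t z⁻¹ ≠ 0 := sub_ne_zero.2 hφ.symm
  constructor
  · intro f g hfg
    have h0 : z • (f - g) - transferOp hβ t (f - g) = 0 := by
      have : z • f - transferOp hβ t f = z • g - transferOp hβ t g := hfg
      rw [smul_sub, map_sub, sub_sub_sub_comm, this, sub_self]
    have h5 := h3 (f - g)
    rw [h0, map_zero] at h5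
    have h6 : δ (f - g) = 0 := (mul_eq_zero.1 h5.symm).resolve_left hφ'
    have h7 := h2 (f - g)
    rw [h0, map_zero, h6, zero_smul, sub_zero] at h7
    exact (sub_eq_zero.1 h7.symm)
  · intro f
    refine ⟨U f + (ν f / (1 - phi β t z⁻¹)) • orbitSeries β t z (quasiOne β), ?_⟩
    simp only [smul_add, map_add, map_smul]
    have h5 : (ν f / (1 - phi β t z⁻¹)) • (z • orbitSeries β t z (quasiOne β) -
        transferOp hβ t (orbitSeries β t z (quasiOne β))) = ν f • oneF β := by
      rw [h4, smul_smul, div_mul_cancel₀ _ hφ']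
    rw [add_sub_add_comm, h1, smul_comm z, ← smul_sub, h5, sub_add_cancel]

lemma phi_eq_one_of_mem_spectrum {β : ℝ} (hβ : 1 < β ∧ β ≤ 2) {t : ℝ} {z : ℂ}
    (hz : radius hβ t < ‖z‖) (h : z ∈ spectrum ℂ (transferOp hβ t)) : phi β t z⁻¹ = 1 := by
  by_contra hφ
  rw [spectrum.mem_iff] at h
  refine h (ContinuousLinearMap.isUnit_iff_bijective.2 ?_)
  exact bijective_smul_sub hβ hz hφ

lemma phi_eq_one_of_eigenvector {β : ℝ} (hβ : 1 < β ∧ β ≤ 2) {t : ℝ} {z : ℂ}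
    (hz : radius hβ t < ‖z‖) {h : spaceF β} (h0 : h ≠ 0) (hh : transferOp hβ t h = z • h) :
    phi β t z⁻¹ = 1 := by
  by_contra hφ
  refine h0 ((bijective_smul_sub hβ hz hφ).1 ?_)
  simp [hh]

/-- Every eigenfunction is a multiple of the series `u_q`. -/
lemma eigenvector_eq_smul {β : ℝ} (hβ : 1 < β ∧ β ≤ 2) {t : ℝ} {z : ℂ}
    (hz : radius hβ t < ‖z‖) {h : spaceF β} (hh : transferOp hβ t h = z • h) :
    ∃ c : ℂ, h = c • orbitSeries β t z (quasiOne β) := by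
  obtain ⟨U, ν, δ, -, h2, -⟩ := exists_quasi_resolvent hβ hz
  refine ⟨δ h, ?_⟩
  have := h2 h
  rw [hh, sub_self, map_zero] at this
  exact sub_eq_zero.1 this.symm

lemma transferOp_orbitSeries {β : ℝ} (hβ : 1 < β ∧ β ≤ 2) {t : ℝ} {z : ℂ}
    (hz : radius hβ t < ‖z‖) (hφ : phi β t z⁻¹ = 1) :
    transferOp hβ t (orbitSeries β t z (quasiOne β)) = z • orbitSeries β t z (quasiOne β) := by
  obtain ⟨U, ν, δ, -, -, -, h4, -⟩ := exists_quasi_resolvent hβ hz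
  rw [hφ, sub_self, zero_smul] at h4
  exact (sub_eq_zero.1 h4).symm

/-- An eigenfunctional is determined by its value at the constant function `1`, and is given on
indicator functions by the digit series. -/
lemma eigenfunctional_chi {β : ℝ} (hβ : 1 < β ∧ β ≤ 2) {t : ℝ} {z : ℂ}
    (hz : radius hβ t < ‖z‖) {ν : spaceF β →L[ℂ] ℂ}
    (hν : IsEigenfunctional (transferOp hβ t) z ν) (h1 : ν (oneF β) = 1) {a : ℕ → Fin 2}
    (ha : a ∈ betaSet β) : ν (chi β a) = digitSeries t z a := by
  have hz0 := ne_zero_of_radius hz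
  have hrec : ∀ a ∈ betaSet β, z * (ν (chi β a) - digitSeries t z a) =
      (weight t a 1 : ℂ) * (ν (chi β (shift a)) - digitSeries t z (shift a)) := by
    intro a ha
    have h2 : ν (transferOp hβ t (chi β a)) = z * ν (chi β a) := DFunLike.congr_fun hν (chi β a)
    rw [transferOp_chi hβ t ha, map_add, map_smul, map_smul, h1, smul_eq_mul, smul_eq_mul,
      mul_one] at h2
    rw [mul_sub, digitSeries_rec hβ hz ha, ← h2]
    ring
  have hiter : ∀ n, ν (chi β a) - digitSeries t z a = (weight t a n : ℂ) / z ^ n *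
      (ν (chi β (shift^[n] a)) - digitSeries t z (shift^[n] a)) := by
    intro n
    induction n with
    | zero => simp
    | succ n ih =>
      have h2 := hrec _ (shift_iter_mem hβ ha n)
      rw [ih, weight_add, Function.iterate_succ_apply', pow_succ]
      push_cast
      field_simp
      linear_combination (weight t a n : ℂ) * h2
  obtain ⟨M, hM⟩ := exists_norm_digitSeries_le hβ hz
  have hlim := (tendsto_weight_div hβ hz ha).mul_const (‖ν‖ * 2 + M)
  rw [zero_mul] at hlim
  have hle : ‖ν (chi β a) - digitSeries t z a‖ ≤ 0 := by
    refine ge_of_tendsto' hlim fun n => ?_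
    rw [hiter n, norm_mul, norm_div, norm_weight, norm_pow]
    have hw := weight_pos t a n
    refine mul_le_mul_of_nonneg_left ?_ (by positivity)
    refine (norm_sub_le _ _).trans (add_le_add ?_ (hM _ (shift_iter_mem hβ ha n)))
    exact (ν.le_opNorm _).trans (mul_le_mul_of_nonneg_left (norm_chi_le β _) (norm_nonneg _))
  exact sub_eq_zero.1 (norm_le_zero_iff.1 hle)

lemma eigenfunctional_unique {β : ℝ} (hβ : 1 < β ∧ β ≤ 2) {t : ℝ} {z : ℂ}
    (hz : radius hβ t < ‖z‖) {ν ν' : spaceF β →L[ℂ] ℂ}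
    (hν : IsEigenfunctional (transferOp hβ t) z ν) (h1 : ν (oneF β) = 1)
    (hν' : IsEigenfunctional (transferOp hβ t) z ν') (h1' : ν' (oneF β) = 1) : ν = ν' :=
  clm_ext hβ fun a ha => by
    rw [eigenfunctional_chi hβ hz hν h1 ha.1, eigenfunctional_chi hβ hz hν' h1' ha.1]

lemma exists_eigenfunctional {β : ℝ} (hβ : 1 < β ∧ β ≤ 2) {t : ℝ} {z : ℂ}
    (hz : radius hβ t < ‖z‖) (hφ : phi β t z⁻¹ = 1) :
    ∃ ν : spaceF β →L[ℂ] ℂ, IsEigenfunctional (transferOp hβ t) z ν ∧ ν (oneF β) = 1 := by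
  obtain ⟨U, ν, δ, -, -, h3, -, h5, -⟩ := exists_quasi_resolvent hβ hz
  refine ⟨ν, ?_, h5.trans hφ⟩
  refine ContinuousLinearMap.ext fun f => ?_
  have := h3 f
  rw [hφ, sub_self, zero_mul, map_sub, map_smul] at this
  exact (sub_eq_zero.1 this).symm

lemma exists_eigenvector {β : ℝ} {L : spaceF β →L[ℂ] spaceF β} {z : ℂ}
    (h : Module.End.HasEigenvalue (L : Module.End ℂ (spaceF β)) z) :
    ∃ f, f ≠ 0 ∧ L f = z • f := by
  obtain ⟨f, hf⟩ := h.exists_hasEigenvector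
  exact ⟨f, hf.2, hf.apply_eq_smul⟩

theorem finrank_eigenspace {β : ℝ} (hβ : 1 < β ∧ β ≤ 2) {t : ℝ} {z : ℂ}
    (hz : radius hβ t < ‖z‖)
    (h : Module.End.HasEigenvalue (transferOp hβ t : Module.End ℂ (spaceF β)) z) :
    Module.finrank ℂ
      (Module.End.eigenspace (transferOp hβ t : Module.End ℂ (spaceF β)) z) = 1 := by
  obtain ⟨f, hf0, hf⟩ := exists_eigenvector h
  obtain ⟨c, rfl⟩ := eigenvector_eq_smul hβ hz hf
  have hc : c ≠ 0 := by rintro rfl; exact hf0 (zero_smul _ _)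
  refine finrank_eq_one_iff'.2 ⟨⟨_, Module.End.mem_eigenspace_iff.2 hf⟩, fun h0 =>
    hf0 (congrArg Subtype.val h0), fun ⟨w, hw⟩ => ?_⟩
  obtain ⟨d, rfl⟩ := eigenvector_eq_smul hβ hz (Module.End.mem_eigenspace_iff.1 hw)
  exact ⟨d / c, Subtype.ext (by
    change (d / c) • c • _ = _
    rw [smul_smul, div_mul_cancel₀ _ hc])⟩

/-- If an eigenfunctional does not vanish on `u_q`, the eigenvalue has no generalized
eigenvectors besides the eigenvectors. -/
theorem finrank_maxGenEigenspace {β : ℝ} (hβ : 1 < β ∧ β ≤ 2) {t : ℝ} {z : ℂ}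
    (hz : radius hβ t < ‖z‖)
    (h : Module.End.HasEigenvalue (transferOp hβ t : Module.End ℂ (spaceF β)) z)
    {ν : spaceF β →L[ℂ] ℂ} (hν : IsEigenfunctional (transferOp hβ t) z ν)
    (hνu : ν (orbitSeries β t z (quasiOne β)) ≠ 0) :
    Module.finrank ℂ
      (Module.End.maxGenEigenspace (transferOp hβ t : Module.End ℂ (spaceF β)) z) = 1 := by
  set L : Module.End ℂ (spaceF β) := (transferOp hβ t : Module.End ℂ (spaceF β)) with hL
  have hsub : ∀ f, (L - z • (1 : Module.End ℂ (spaceF β))) f = transferOp hβ t f - z • f :=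
    fun f => rfl
  have hstep : ∀ f, (L - z • (1 : Module.End ℂ (spaceF β))) f ∈ Module.End.eigenspace L z →
      f ∈ Module.End.eigenspace L z := by
    intro f hf
    obtain ⟨c, hc⟩ := eigenvector_eq_smul hβ hz (Module.End.mem_eigenspace_iff.1 hf)
    have h1 : ν (transferOp hβ t f) = z * ν f := DFunLike.congr_fun hν f
    have h2 := congrArg ν hc
    rw [hsub, map_sub, map_smul, map_smul, h1, smul_eq_mul, smul_eq_mul, sub_self] at h2
    rw [(mul_eq_zero.1 h2.symm).resolve_right hνu, zero_smul, hsub] at hc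
    exact Module.End.mem_eigenspace_iff.2 (sub_eq_zero.1 hc)
  have hpow : ∀ k f, ((L - z • (1 : Module.End ℂ (spaceF β))) ^ k) f = 0 →
      f ∈ Module.End.eigenspace L z := by
    intro k
    induction k with
    | zero => intro f hf; rw [pow_zero] at hf; rw [show f = 0 from hf]; exact zero_mem _
    | succ k ih => intro f hf; rw [pow_succ] at hf; exact hstep f (ih _ hf)
  have heq : Module.End.maxGenEigenspace L z = Module.End.eigenspace L z := by
    refine le_antisymm (fun f hf => ?_) fun f hf => ?_
    · obtain ⟨k, hk⟩ := Module.End.mem_maxGenEigenspace L z f |>.1 hf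
      exact hpow k f hk
    · refine (Module.End.mem_maxGenEigenspace L z f).2 ⟨1, ?_⟩
      rw [pow_one, hsub]
      exact sub_eq_zero.2 (Module.End.mem_eigenspace_iff.1 hf)
  rw [heq]
  exact finrank_eigenspace hβ hz h

/-! ### The leading root of `φ_t(1/z) = 1` -/

/-- The digit series at a real point. -/
def realDigitSeries (t z : ℝ) (a : ℕ → Fin 2) : ℝ :=
  ∑' n : ℕ, ((a n : ℕ) : ℝ) * weight t a n / z ^ (n + 1)

lemma ofReal_realDigitSeries (t z : ℝ) (a : ℕ → Fin 2) :
    (realDigitSeries t z a : ℂ) = digitSeries t z a := by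
  rw [realDigitSeries, digitSeries, Complex.ofReal_tsum]
  push_cast
  rfl

lemma pos_of_radius {β : ℝ} {hβ : 1 < β ∧ β ≤ 2} {t z : ℝ} (hz : radius hβ t < z) : 0 < z :=
  (zero_lt_one.trans_le (one_le_radius hβ t)).trans hz

lemma radius_lt_norm {β : ℝ} {hβ : 1 < β ∧ β ≤ 2} {t z : ℝ} (hz : radius hβ t < z) :
    radius hβ t < ‖(z : ℂ)‖ := by
  rwa [Complex.norm_real, Real.norm_of_nonneg (pos_of_radius hz).le]

lemma digitTerm_nonneg {t z : ℝ} (hz : 0 < z) (a : ℕ → Fin 2) (n : ℕ) :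
    0 ≤ ((a n : ℕ) : ℝ) * weight t a n / z ^ (n + 1) :=
  div_nonneg (mul_nonneg (Nat.cast_nonneg _) (weight_pos _ _ _).le) (by positivity)

section root

variable {β : ℝ} (hβ : 1 < β ∧ β ≤ 2) {t z : ℝ}

lemma hasSum_realDigitSeries (hz : radius hβ t < z) {a : ℕ → Fin 2} (ha : a ∈ betaSet β) :
    HasSum (fun n : ℕ => ((a n : ℕ) : ℝ) * weight t a n / z ^ (n + 1)) (realDigitSeries t z a) := by
  have h := hasSum_digitSeries hβ (radius_lt_norm hz) ha
  rw [← ofReal_realDigitSeries] at h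
  rw [← Complex.hasSum_ofReal]
  push_cast
  exact h

lemma realDigitSeries_nonneg (hz : radius hβ t < z) (a : ℕ → Fin 2) :
    0 ≤ realDigitSeries t z a := tsum_nonneg fun n => digitTerm_nonneg (pos_of_radius hz) a n

lemma realDigitSeries_zero (t z : ℝ) : realDigitSeries t z 0 = 0 := by simp [realDigitSeries]

lemma realDigitSeries_rec (hz : radius hβ t < z) {a : ℕ → Fin 2} (ha : a ∈ betaSet β) :
    z * realDigitSeries t z a =
      ((a 0 : ℕ) : ℝ) + weight t a 1 * realDigitSeries t z (shift a) := by
  have h := digitSeries_rec hβ (radius_lt_norm hz) ha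
  rw [← ofReal_realDigitSeries, ← ofReal_realDigitSeries] at h
  exact_mod_cast h

lemma realDigitSeries_iter (hz : radius hβ t < z) {a : ℕ → Fin 2} (ha : a ∈ betaSet β) (n : ℕ) :
    realDigitSeries t z a = ∑ k ∈ Finset.range n, ((a k : ℕ) : ℝ) * weight t a k / z ^ (k + 1) +
      weight t a n / z ^ n * realDigitSeries t z (shift^[n] a) := by
  have hz0 := pos_of_radius hz
  induction n with
  | zero => simp
  | succ n ih =>
    have h := realDigitSeries_rec hβ hz (shift_iter_mem hβ ha n)
    rw [ih, Finset.sum_range_succ, weight_add, Function.iterate_succ_apply']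
    rw [shift_iter, zero_add] at h
    have h2 : realDigitSeries t z (shift^[n] a) =
        (((a n : ℕ) : ℝ) + weight t (shift^[n] a) 1 *
          realDigitSeries t z (shift (shift^[n] a))) / z := by
      rw [← h]; field_simp
    rw [h2]
    field_simp
    ring

/-- The difference of the digit series at two sequences, in terms of their first difference. -/
lemma realDigitSeries_sub (hz : radius hβ t < z) {a b : ℕ → Fin 2} (ha : a ∈ betaSet β)
    (hb : b ∈ betaSet β) {n : ℕ} (h : ∀ j < n, a j = b j) (h0 : a n = 0) (h1 : b n = 1) :
    realDigitSeries t z b - realDigitSeries t z a = weight t b n / z ^ (n + 1) *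
      (1 + Real.exp t * realDigitSeries t z (shift^[n + 1] b) -
        realDigitSeries t z (shift^[n + 1] a)) := by
  have hz0 := pos_of_radius hz
  have h2 : ∑ k ∈ Finset.range n, ((a k : ℕ) : ℝ) * weight t a k / z ^ (k + 1) =
      ∑ k ∈ Finset.range n, ((b k : ℕ) : ℝ) * weight t b k / z ^ (k + 1) :=
    Finset.sum_congr rfl fun k hk => by
      have hk := Finset.mem_range.1 hk
      rw [h k hk, weight_congr t fun j hj => h j (hj.trans hk)]
  have hA := realDigitSeries_iter hβ hz ha (n + 1)
  have hB := realDigitSeries_iter hβ hz hb (n + 1)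
  rw [Finset.sum_range_succ, weight_succ, h0, h2, weight_congr t h] at hA
  rw [Finset.sum_range_succ, weight_succ, h1] at hB
  rw [hA, hB]
  simp
  ring

/-- If `V(q) ≤ 1`, then comparing `a` with `q` at their first difference, and going on with the
remaining tail of `a`, pushes `V(a) - 1` below arbitrarily small quantities. -/
lemma realDigitSeries_le_one (hz : radius hβ t < z) (hq : realDigitSeries t z (quasiOne β) ≤ 1)
    {a : ℕ → Fin 2} (ha : a ∈ betaSet β) : realDigitSeries t z a ≤ 1 := by
  have hz0 := pos_of_radius hz
  by_contra! hgt
  have key : ∀ N, ∃ n ≥ N, realDigitSeries t z a - 1 ≤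
      weight t a n / z ^ n * (realDigitSeries t z (shift^[n] a) - 1) := by
    intro N
    induction N with
    | zero => exact ⟨0, le_rfl, by simp⟩
    | succ N ih =>
      obtain ⟨n, hn, hle⟩ := ih
      have hwn := weight_pos t a n
      have hbn := shift_iter_mem hβ ha n
      rcases (le_quasiOne hβ hbn).eq_or_lt with he | hlt
      · rw [show shift^[n] a = quasiOne β from toLex.injective he] at hle
        have : weight t a n / z ^ n * (realDigitSeries t z (quasiOne β) - 1) ≤ 0 :=
          mul_nonpos_of_nonneg_of_nonpos (by positivity) (by linarith)
        linarith
      · obtain ⟨m, hm, hm0, hm1⟩ := exists_first_difference hlt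
        have h1 := realDigitSeries_sub hβ hz hbn (quasiOne_mem hβ) hm hm0 hm1
        have h2 : weight t (shift^[n] a) (m + 1) = weight t (quasiOne β) m := by
          rw [weight_succ, hm0, weight_congr t hm]; simp
        refine ⟨n + (m + 1), by omega, hle.trans ?_⟩
        rw [weight_add, h2, pow_add, mul_div_mul_comm, mul_assoc]
        refine mul_le_mul_of_nonneg_left ?_ (by positivity)
        rw [show shift^[n + (m + 1)] a = shift^[m + 1] (shift^[n] a) by
          rw [← Function.iterate_add_apply, add_comm]]
        have h3 := weight_pos t (quasiOne β) m
        have h4 : 0 ≤ weight t (quasiOne β) m / z ^ (m + 1) *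
            (Real.exp t * realDigitSeries t z (shift^[m + 1] (quasiOne β))) :=
          mul_nonneg (by positivity)
            (mul_nonneg (Real.exp_pos t).le (realDigitSeries_nonneg hβ hz _))
        nlinarith [h1]
  obtain ⟨M, hM⟩ := exists_norm_digitSeries_le hβ (radius_lt_norm hz)
  have hM' : ∀ b ∈ betaSet β, realDigitSeries t z b ≤ M := fun b hb => by
    have := hM b hb
    rw [← ofReal_realDigitSeries, Complex.norm_real] at this
    exact (le_abs_self _).trans this
  have hlim := (tendsto_weight_div hβ hz ha).mul_const M
  rw [zero_mul] at hlim
  obtain ⟨N, hN⟩ := eventually_atTop.1 (hlim.eventually_lt_const (sub_pos.2 hgt))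
  obtain ⟨n, hn, hle⟩ := key N
  have hw := weight_pos t a n
  have h1 : weight t a n / z ^ n * (realDigitSeries t z (shift^[n] a) - 1) ≤
      weight t a n / z ^ n * M :=
    mul_le_mul_of_nonneg_left (by linarith [hM' _ (shift_iter_mem hβ ha n)]) (by positivity)
  linarith [hN n hn]

lemma realDigitSeries_mono (hz : radius hβ t < z) (hq : realDigitSeries t z (quasiOne β) ≤ 1)
    {a b : ℕ → Fin 2} (ha : a ∈ betaSet β) (hb : b ∈ betaSet β) (hab : toLex a ≤ toLex b) :
    realDigitSeries t z a ≤ realDigitSeries t z b := by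
  have hz0 := pos_of_radius hz
  rcases hab.eq_or_lt with h | h
  · rw [toLex.injective h]
  · obtain ⟨n, hn, h0, h1⟩ := exists_first_difference h
    have h2 := realDigitSeries_sub hβ hz ha hb hn h0 h1
    have h3 := realDigitSeries_le_one hβ hz hq (shift_iter_mem hβ ha (n + 1))
    have h4 := mul_nonneg (Real.exp_pos t).le (realDigitSeries_nonneg hβ hz (shift^[n + 1] b))
    have h5 := weight_pos t b n
    have h6 : 0 ≤ weight t b n / z ^ (n + 1) *
      (1 + Real.exp t * realDigitSeries t z (shift^[n + 1] b) -
        realDigitSeries t z (shift^[n + 1] a)) := mul_nonneg (by positivity) (by linarith)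
    linarith

lemma radius_eq_one_of_nonpos (ht : t ≤ 0) : radius hβ t = 1 := by
  refine le_antisymm ?_ (one_le_radius hβ t)
  have : Nonempty (BetaShift β) := ⟨⟨0, zero_seq_mem hβ⟩⟩
  have h := radius_pow_le hβ t 1
  rw [pow_one] at h
  refine h.trans (ciSup_le fun x => ?_)
  rw [weight_one]
  exact Real.exp_le_one_iff.2 (mul_nonpos_of_nonneg_of_nonpos (Nat.cast_nonneg _) ht)

lemma weight_eq_exp (t : ℝ) (a : ℕ → Fin 2) (n : ℕ) :
    weight t a n = Real.exp ((∑ k ∈ Finset.range n, ((a k : ℕ) : ℝ)) * t) := by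
  rw [weight, Finset.sum_mul]

/-- Otherwise all partial sums of the digit series at `r_t` are at most `1`. Then `H_k(t, a)` is at
most of the order of `r_tᵏ` along every sequence, so it is exactly of this order along a word that
nearly maximizes the weight, and this word has boundedly many ones, which forces `r_t = 1`.
But for `r_t = 1` the partial sums for `q` exceed `1` from its second one on. -/
lemma exists_one_lt_realDigitSeries (t : ℝ) :
    ∃ z, radius hβ t < z ∧ 1 < realDigitSeries t z (quasiOne β) := by
  by_contra! hle
  set r := radius hβ t with hr
  have hr1 : 1 ≤ r := one_le_radius hβ t
  have hr0 : 0 < r := by linarith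
  have hpart : ∀ a ∈ betaSet β, ∀ N,
      ∑ k ∈ Finset.range N, ((a k : ℕ) : ℝ) * weight t a k / r ^ (k + 1) ≤ 1 := by
    intro a ha N
    have hc : ContinuousAt (fun z : ℝ => ∑ k ∈ Finset.range N,
        ((a k : ℕ) : ℝ) * weight t a k / z ^ (k + 1)) r :=
      tendsto_finsetSum _ fun k _ => (continuousAt_const.div (continuousAt_id.pow _)
        (pow_ne_zero _ hr0.ne'))
    refine le_of_tendsto (hc.tendsto.mono_left (nhdsWithin_le_nhds (s := Ioi r))) ?_
    filter_upwards [self_mem_nhdsWithin] with z hz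
    refine le_trans ?_ (realDigitSeries_le_one hβ hz (hle z hz) ha)
    exact (hasSum_realDigitSeries hβ hz ha).summable.sum_le_tsum _ fun k _ =>
      digitTerm_nonneg (pos_of_radius hz) a k
  rcases hr1.eq_or_lt with h1 | h1
  · obtain ⟨k, hk, hk1⟩ := quasiOne_infinite hβ 1
    have h2 := hpart _ (quasiOne_mem hβ) (k + 1)
    have h3 : ∑ j ∈ {0, k}, ((quasiOne β j : ℕ) : ℝ) * weight t (quasiOne β) j / r ^ (j + 1) ≤
        ∑ j ∈ Finset.range (k + 1),
          ((quasiOne β j : ℕ) : ℝ) * weight t (quasiOne β) j / r ^ (j + 1) := by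
      refine Finset.sum_le_sum_of_subset_of_nonneg ?_ fun j _ _ => digitTerm_nonneg hr0 _ j
      intro j hj
      simp only [Finset.mem_insert, Finset.mem_singleton] at hj
      rw [Finset.mem_range]; omega
    rw [Finset.sum_pair (by omega), hk1, quasiOne_zero hβ, ← h1] at h3
    have := weight_pos t (quasiOne β) k
    simp only [weight_zero, one_pow, div_one, mul_one, Fin.val_one, Nat.cast_one, one_mul] at h3
    rw [← h1] at h2
    simp only [one_pow, div_one] at h2
    linarith
  · have ht : 0 < t := by
      by_contra! ht
      rw [hr, radius_eq_one_of_nonpos hβ ht] at h1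
      exact lt_irrefl _ h1
    have hexp : 1 ≤ Real.exp t := Real.one_le_exp ht.le
    have hup : ∀ a ∈ betaSet β, ∀ k, weight t a k ≤ Real.exp t * r ^ k := by
      intro a ha k
      induction k with
      | zero => simpa using hexp
      | succ k ih =>
        rw [weight_succ]
        rcases fin_two_cases (a k) with h0 | h0
        · rw [h0]
          simp only [Fin.val_zero, Nat.cast_zero, zero_mul, Real.exp_zero, mul_one]
          refine ih.trans ?_
          gcongr
          omega
        · have h2 := (Finset.single_le_sum (f := fun k => ((a k : ℕ) : ℝ) * weight t a k /
            r ^ (k + 1)) (fun j _ => digitTerm_nonneg hr0 a j) (Finset.self_mem_range_succ k)).trans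
            (hpart a ha (k + 1))
          rw [h0, div_le_one (by positivity)] at h2
          rw [h0]
          simp only [Fin.val_one, Nat.cast_one, one_mul] at h2 ⊢
          nlinarith
    -- If `r_t > 1` this bound on `r_t ^ N`, uniform in `N`, is absurd.
    have hbound : ∀ N, r ^ N ≤ 2 * Real.exp (2 * r * Real.exp t * t) := by
      intro N
      obtain ⟨x, hx⟩ : ∃ x : BetaShift β, r ^ N / 2 < weight t x.seq N := by
        have : Nonempty (BetaShift β) := ⟨⟨0, zero_seq_mem hβ⟩⟩
        refine exists_lt_of_lt_ciSup ((half_lt_self (by positivity)).trans_le (radius_pow_le hβ t N))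
      have hlow : ∀ k ≤ N, r ^ k / (2 * Real.exp t) ≤ weight t x.seq k := by
        intro k hk
        obtain ⟨m, rfl⟩ := Nat.exists_eq_add_of_le hk
        rw [weight_add] at hx
        have h2 := mul_le_mul_of_nonneg_left (hup _ (shift_iter_mem hβ x.mem k) m)
          (weight_pos t x.seq k).le
        have h3 : r ^ k * r ^ m / 2 < weight t x.seq k * Real.exp t * r ^ m := by
          rw [← pow_add]; linarith
        have h4 : 0 < r ^ m := by positivity
        have h5 : r ^ k / 2 < weight t x.seq k * Real.exp t := by
          by_contra! h6
          have := mul_le_mul_of_nonneg_right h6 h4.le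
          linarith
        rw [div_le_iff₀ (by positivity)]
        linarith
      have hones : ∑ k ∈ Finset.range N, ((x.seq k : ℕ) : ℝ) ≤ 2 * r * Real.exp t := by
        have h2 : ∑ k ∈ Finset.range N, ((x.seq k : ℕ) : ℝ) * (2 * r * Real.exp t)⁻¹ ≤
            ∑ k ∈ Finset.range N, ((x.seq k : ℕ) : ℝ) * weight t x.seq k / r ^ (k + 1) := by
          refine Finset.sum_le_sum fun k hk => ?_
          rw [mul_div_assoc]
          refine mul_le_mul_of_nonneg_left ?_ (Nat.cast_nonneg _)
          rw [le_div_iff₀ (by positivity)]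
          refine (le_of_eq ?_).trans (hlow k (Finset.mem_range.1 hk).le)
          rw [pow_succ]
          field_simp
        have h3 := h2.trans (hpart x.seq x.mem N)
        rw [← Finset.sum_mul, ← div_eq_mul_inv, div_le_one (by positivity)] at h3
        exact h3
      have h2 : weight t x.seq N ≤ Real.exp (2 * r * Real.exp t * t) := by
        rw [weight_eq_exp]
        exact Real.exp_le_exp.2 (mul_le_mul_of_nonneg_right hones ht.le)
      linarith
    obtain ⟨N, hN⟩ := ((tendsto_pow_atTop_atTop_of_one_lt h1).eventually_gt_atTop
      (2 * Real.exp (2 * r * Real.exp t * t))).exists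
    exact hN.not_ge (hbound N)

lemma realDigitSeries_le_div {z₀ : ℝ} (hz₀ : radius hβ t < z₀) (hz : z₀ ≤ z) {a : ℕ → Fin 2}
    (ha : a ∈ betaSet β) : realDigitSeries t z a ≤ z₀ / z * realDigitSeries t z₀ a := by
  have h0 := pos_of_radius hz₀
  have hz0 := h0.trans_le hz
  refine hasSum_le (fun n => ?_) (hasSum_realDigitSeries hβ (hz₀.trans_le hz) ha)
    ((hasSum_realDigitSeries hβ hz₀ ha).mul_left _)
  have hw := weight_pos t a n
  rw [show z₀ / z * (((a n : ℕ) : ℝ) * weight t a n / z₀ ^ (n + 1)) =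
    ((a n : ℕ) : ℝ) * weight t a n / (z₀ ^ n * z) by field_simp; ring, pow_succ]
  gcongr

/-- If `V_{z₀}(q) > 1`, then `V_{z₁}(q) ≤ 1` for `z₁ = z₀ V_{z₀}(q)`. -/
theorem exists_leading_root (t : ℝ) :
    ∃ lam, radius hβ t < lam ∧ realDigitSeries t lam (quasiOne β) = 1 := by
  obtain ⟨z₀, hz₀, h1⟩ := exists_one_lt_realDigitSeries hβ t
  have h0 := pos_of_radius hz₀
  set z₁ := z₀ * realDigitSeries t z₀ (quasiOne β) with hz₁
  have h01 : z₀ ≤ z₁ := le_mul_of_one_le_right h0.le h1.le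
  have h2 : realDigitSeries t z₁ (quasiOne β) ≤ 1 := by
    refine (realDigitSeries_le_div hβ hz₀ h01 (quasiOne_mem hβ)).trans_eq ?_
    rw [div_mul_eq_mul_div, ← hz₁, div_self (h0.trans_le h01).ne']
  have hc : ContinuousOn (fun z => realDigitSeries t z (quasiOne β)) (Icc z₀ z₁) := by
    refine continuousOn_tsum (fun n => ?_)
      (hasSum_realDigitSeries hβ hz₀ (quasiOne_mem hβ)).summable fun n z hz => ?_
    · exact continuousOn_const.div (continuousOn_id.pow _) fun z hz =>
        pow_ne_zero _ (h0.trans_le hz.1).ne'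
    · rw [Real.norm_of_nonneg (digitTerm_nonneg (h0.trans_le hz.1) _ n)]
      have := weight_pos t (quasiOne β) n
      gcongr
      exact hz.1
  obtain ⟨lam, hlam, h3⟩ := intermediate_value_Icc' h01 hc ⟨h2, h1.le⟩
  exact ⟨lam, hz₀.trans_le hlam.1, h3⟩

end root

/-! ### Integration on `𝓕` against measures without atoms -/

section integration

variable {β : ℝ} (m : Measure (BetaShift β))

lemma ae_eq_of_cls_eq [NullSingletonClass m] {f g : BV β} (h : cls f = cls g) : f =ᵐ[m] g := by
  obtain ⟨C, hC, h⟩ := cls_eq_iff.1 h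
  filter_upwards [hC.ae_notMem m] with x hx using h x hx

lemma ae_norm_le_cls [NullSingletonClass m] (f : BV β) : ∀ᵐ x ∂m, ‖f x‖ ≤ ‖cls f‖ := by
  obtain ⟨C, hC, h⟩ := exists_countable_norm_le f
  filter_upwards [hC.ae_notMem m] with x hx using h x hx

lemma exists_measurable_of_mem_stepSpan {b : BVQuot β} (hb : b ∈ stepSpan β) :
    ∃ s : BV β, cls s = b ∧ Measurable s := by
  induction hb using Submodule.span_induction with
  | mem b hb =>
    obtain ⟨f, I, hI, hf, rfl⟩ := hb
    refine ⟨f, rfl, ?_⟩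
    rw [show ⇑f = I.indicator 1 from funext hf]
    exact measurable_const.indicator hI.measurableSet
  | zero => exact ⟨0, rfl, measurable_const⟩
  | add b c _ _ hb hc =>
    obtain ⟨s, rfl, hs⟩ := hb
    obtain ⟨s', rfl, hs'⟩ := hc
    exact ⟨s + s', rfl, hs.add hs'⟩
  | smul c b _ hb =>
    obtain ⟨s, rfl, hs⟩ := hb
    exact ⟨c • s, rfl, hs.const_smul c⟩

/-- Functions whose class lies in `𝓕` are almost everywhere limits of step functions. -/
lemma aestronglyMeasurable_of_mem [NullSingletonClass m] {f : BV β} (hf : cls f ∈ spaceF β) :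
    AEStronglyMeasurable f m := by
  obtain ⟨b, hb, hlim⟩ := mem_closure_iff_seq_limit.1 hf
  choose s hs hsm using fun n => exists_measurable_of_mem_stepSpan (hb n)
  refine aestronglyMeasurable_of_tendsto_ae atTop (f := fun n => s n)
    (fun n => (hsm n).aestronglyMeasurable) ?_
  filter_upwards [ae_all_iff.2 fun n => ae_norm_le_cls m (s n - f)] with x hx
  refine tendsto_iff_norm_sub_tendsto_zero.2 (squeeze_zero (fun _ => norm_nonneg _) hx ?_)
  simp only [cls_sub, hs]
  exact tendsto_iff_norm_sub_tendsto_zero.1 hlim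

lemma integral_chiBV (a : BetaShift β) : ∫ x, chiBV β a.seq x ∂m = m.real (Iic a) := by
  have h : ⇑(chiBV β a.seq) = (Iic a).indicator fun _ => (1 : ℂ) := rfl
  rw [h, integral_indicator measurableSet_Iic, setIntegral_const, Complex.real_smul, mul_one]

lemma nonneg_of_represents {ν : spaceF β →L[ℂ] ℂ} (h : Represents m ν) {f : spaceF β}
    (hf : IsNonneg f) : ∃ r : ℝ, 0 ≤ r ∧ ν f = r := by
  obtain ⟨g, hg, hpos⟩ := hf
  choose r hr0 hr using hpos
  refine ⟨∫ x, r x ∂m, integral_nonneg hr0, ?_⟩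
  have hm : cls g ∈ spaceF β := by rw [hg]; exact f.2
  have hfg : f = ⟨cls g, hm⟩ := Subtype.ext hg.symm
  rw [hfg, (h g hm).2, ← integral_complex_ofReal]
  exact integral_congr_ae (Eventually.of_forall hr)

variable [IsFiniteMeasure m] [NullSingletonClass m]

lemma integrable_of_mem {f : BV β} (hf : cls f ∈ spaceF β) : Integrable f m :=
  Integrable.of_bound (aestronglyMeasurable_of_mem m hf) ‖f‖
    (Eventually.of_forall f.norm_apply_le)

/-- A representative of a class in `𝓑`. -/
def repr (b : BVQuot β) : BV β := Quotient.out b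

lemma cls_repr (b : BVQuot β) : cls (repr b) = b := Quotient.out_eq b

lemma repr_mem (b : spaceF β) : cls (repr b.1) ∈ spaceF β := by
  rw [cls_repr]; exact b.2

/-- Integration against a finite measure without atoms, as a bounded functional on `𝓕`. -/
def integralF : spaceF β →L[ℂ] ℂ :=
  LinearMap.mkContinuous
    { toFun := fun b => ∫ x, repr b.1 x ∂m
      map_add' := fun b c => by
        rw [← integral_add (integrable_of_mem m (repr_mem b)) (integrable_of_mem m (repr_mem c))]
        refine integral_congr_ae (ae_eq_of_cls_eq m (g := repr b.1 + repr c.1) ?_)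
        rw [cls_add, cls_repr, cls_repr, cls_repr]; rfl
      map_smul' := fun c b => by
        rw [RingHom.id_apply, ← integral_smul]
        refine integral_congr_ae (ae_eq_of_cls_eq m (g := c • repr b.1) ?_)
        rw [cls_smul, cls_repr, cls_repr]; rfl }
    (m.real univ) fun b => by
      have h := norm_integral_le_of_norm_le_const (ae_norm_le_cls m (repr b.1))
      rw [cls_repr, mul_comm] at h
      exact h

lemma integralF_apply {f : BV β} (hf : cls f ∈ spaceF β) :
    integralF m ⟨cls f, hf⟩ = ∫ x, f x ∂m :=
  integral_congr_ae (ae_eq_of_cls_eq m (cls_repr _))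

lemma represents_of_chi (hβ : 1 < β ∧ β ≤ 2) {ν : spaceF β →L[ℂ] ℂ}
    (h : ∀ a : BetaShift β, ν (chi β a.seq) = m.real (Iic a)) : Represents m ν := by
  intro f hf
  refine ⟨integrable_of_mem m hf, ?_⟩
  have h1 : ν = integralF m := clm_ext hβ fun a ha => by
    rw [h ⟨a, ha.1⟩, ← integral_chiBV m ⟨a, ha.1⟩]
    exact (integralF_apply m _).symm
  rw [h1, integralF_apply]

end integration

/-! ### The conformal measure -/

section measure

variable {β : ℝ} (hβ : 1 < β ∧ β ≤ 2) {t lam : ℝ}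

lemma continuous_realDigitSeries (hlam : radius hβ t < lam) :
    Continuous fun x : BetaShift β => realDigitSeries t lam x.seq := by
  have h0 := pos_of_radius hlam
  obtain ⟨b, hs, -, hb⟩ := exists_summable_bound' hβ hlam
  have hcoord : ∀ n, Continuous fun x : BetaShift β => ((x.seq n : ℕ) : ℝ) := fun n =>
    (continuous_of_discreteTopology (f := fun d : Fin 2 => ((d : ℕ) : ℝ))).comp
      ((continuous_apply n).comp (BetaShift.continuous_seq β))
  refine continuous_tsum (u := fun n => b n * lam⁻¹) (fun n => ?_) (hs.mul_right _) fun n x => ?_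
  · refine ((hcoord n).mul ?_).div_const _
    unfold weight
    exact Real.continuous_exp.comp (continuous_finsetSum _ fun i _ => (hcoord i).mul_const t)
  · rw [Real.norm_of_nonneg (digitTerm_nonneg h0 _ n), pow_succ, ← div_div, div_eq_mul_inv _ lam]
    refine mul_le_mul_of_nonneg_right (le_trans ?_ (hb x.seq x.mem n)) (by positivity)
    refine div_le_div_of_nonneg_right ?_ (by positivity)
    exact mul_le_of_le_one_left (weight_pos _ _ _).le (digit_le x.seq n)

/-- The measure with distribution function `V`, the digit series at the leading root: the image of
Lebesgue measure on `[0, 1]` under `s ↦ min {a : V(a) ≥ s}`. -/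
lemma exists_measure (hlam : radius hβ t < lam) (hq : realDigitSeries t lam (quasiOne β) = 1) :
    ∃ m : Measure (BetaShift β), IsProbabilityMeasure m ∧
      ∀ a, m.real (Iic a) = realDigitSeries t lam a.seq := by
  set V : BetaShift β → ℝ := fun x => realDigitSeries t lam x.seq with hV
  have hVm : Monotone V := fun a b hab => realDigitSeries_mono hβ hlam hq.le a.mem b.mem hab
  have hV1 : ∀ a, V a ≤ 1 := fun a => realDigitSeries_le_one hβ hlam hq.le a.mem
  have hV0 : ∀ a, 0 ≤ V a := fun a => realDigitSeries_nonneg hβ hlam _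
  have hex : ∀ s : ℝ, ∃ a, IsLeast {a | min s 1 ≤ V a} a := fun s =>
    ((_root_.isClosed_le continuous_const (continuous_realDigitSeries hβ hlam)).isCompact).exists_isLeast
      ⟨⟨quasiOne β, quasiOne_mem hβ⟩, (min_le_right _ _).trans_eq hq.symm⟩
  choose T hT using hex
  have hTle : ∀ s a, T s ≤ a ↔ min s 1 ≤ V a := fun s a =>
    ⟨fun h => (hT s).1.trans (hVm h), fun h => (hT s).2 h⟩
  have hTm : Monotone T := fun s s' h =>
    (hTle _ _).2 ((min_le_min_right 1 h).trans (hT s').1)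
  have hTmeas : Measurable T := hTm.measurable
  have : IsProbabilityMeasure (volume.restrict (Ioc (0 : ℝ) 1)) := ⟨by simp⟩
  refine ⟨(volume.restrict (Ioc (0 : ℝ) 1)).map T, Measure.isProbabilityMeasure_map
    hTmeas.aemeasurable, fun a => ?_⟩
  rw [measureReal_def, Measure.map_apply hTmeas measurableSet_Iic,
    Measure.restrict_apply (hTmeas measurableSet_Iic)]
  have hset : T ⁻¹' Iic a ∩ Ioc 0 1 = Ioc 0 (V a) := by
    ext s
    simp only [mem_inter_iff, mem_preimage, mem_Iic, mem_Ioc, hTle]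
    constructor
    · rintro ⟨h1, h2, h3⟩
      rw [min_eq_left h3] at h1
      exact ⟨h2, h1⟩
    · rintro ⟨h1, h2⟩
      exact ⟨(min_le_left _ _).trans h2, h1, h2.trans (hV1 a)⟩
  rw [hset, Real.volume_Ioc, sub_zero, ENNReal.toReal_ofReal (hV0 a)]

/-- If `x_n = 1` (digits counted from `1`), the points above `x₁ ⋯ x_{n-1} 0 q` and up to `x` have
total mass `H_n(x) lam⁻ⁿ V(σⁿ x)`. This is zero if there are no further ones, and tends to zero if there
are infinitely many. -/
lemma measure_singleton_eq_zero (hlam : radius hβ t < lam)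
    (hq : realDigitSeries t lam (quasiOne β) = 1) {m : Measure (BetaShift β)}
    [IsProbabilityMeasure m] (hm : ∀ a, m.real (Iic a) = realDigitSeries t lam a.seq)
    (x : BetaShift β) : m {x} = 0 := by
  have h0 := pos_of_radius hlam
  have hle : ∀ n, x.seq n = 1 → m.real {x} ≤
      weight t x.seq (n + 1) / lam ^ (n + 1) * realDigitSeries t lam (shift^[n + 1] x.seq) := by
    intro n hn
    set y : BetaShift β := ⟨splice x.seq n (quasiOne β), splice_mem hβ x.mem (quasiOne_mem hβ) hn⟩
    have hyx : y < x := splice_lt hn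
    have h1 : m.real {x} ≤ m.real (Iic x) - m.real (Iic y) := by
      rw [← measureReal_sdiff (Iic_subset_Iic.2 hyx.le) measurableSet_Iic]
      refine measureReal_mono (singleton_subset_iff.2 ⟨self_mem_Iic, hyx.not_ge⟩)
    have h2 := realDigitSeries_sub hβ hlam y.mem x.mem (fun j hj => splice_of_lt hj)
      splice_self hn
    rw [hm, hm, h2, shift_splice, hq, add_sub_cancel_left] at h1
    refine h1.trans_eq ?_
    rw [weight_succ, hn]
    simp
    ring
  have hzero : m.real {x} = 0 := by
    refine le_antisymm ?_ measureReal_nonneg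
    by_cases hinf : ∀ N, ∃ n ≥ N, x.seq n = 1
    · refine ge_of_tendsto_of_frequently (tendsto_weight_div hβ hlam x.mem)
        (frequently_atTop.2 fun N => ?_)
      obtain ⟨n, hn, hn1⟩ := hinf N
      refine ⟨n + 1, by omega, (hle n hn1).trans (mul_le_of_le_one_right ?_ ?_)⟩
      · have := weight_pos t x.seq (n + 1)
        positivity
      · exact realDigitSeries_le_one hβ hlam hq.le (shift_iter_mem hβ x.mem _)
    · push Not at hinf
      classical
      have hz : ∀ n, (∀ k ≥ n, x.seq k ≠ 1) → shift^[n] x.seq = 0 := fun n h => by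
        ext k
        rw [shift_iter]
        rcases fin_two_cases (x.seq (k + n)) with h1 | h1
        · rw [h1]; rfl
        · exact absurd h1 (h _ (by omega))
      have hspec := hz _ (Nat.find_spec hinf)
      rcases Nat.eq_zero_or_pos (Nat.find hinf) with h1 | h1
      · rw [h1, Function.iterate_zero, id] at hspec
        refine (measureReal_mono (singleton_subset_iff.2 (self_mem_Iic (a := x)))).trans_eq ?_
        rw [hm, hspec, realDigitSeries_zero]
      · obtain ⟨n, hn⟩ := Nat.exists_eq_succ_of_ne_zero h1.ne'
        have h2 := Nat.find_min hinf (show n < Nat.find hinf by omega)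
        push Not at h2
        obtain ⟨k, hk, hk1⟩ := h2
        have hkn : k = n := by
          by_contra hne
          exact Nat.find_spec hinf k (by omega) hk1
        subst hkn
        refine (hle k hk1).trans_eq ?_
        rw [← Nat.succ_eq_add_one, ← hn, hspec, realDigitSeries_zero, mul_zero]
  exact (measureReal_eq_zero_iff).1 hzero

end measure

/-! ### The Perron pair -/

section perron

variable {β : ℝ} (hβ : 1 < β ∧ β ≤ 2) {t lam : ℝ}

lemma phi_inv_ofReal (β t lam : ℝ) :
    phi β t (lam : ℂ)⁻¹ = realDigitSeries t lam (quasiOne β) := by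
  rw [phi_inv, ofReal_realDigitSeries]

lemma isNonneg_chi (β : ℝ) (a : ℕ → Fin 2) : IsNonneg (chi β a) := by
  refine ⟨chiBV β a, rfl, fun x => ?_⟩
  by_cases h : toLex x.seq ≤ toLex a
  · exact ⟨1, zero_le_one, by rw [chiBV_of_le h, Complex.ofReal_one]⟩
  · exact ⟨0, le_rfl, by rw [chiBV_of_not_le h, Complex.ofReal_zero]⟩

/-- The first term of the series `u_q` is `1 / lam`, and the others are nonnegative. -/
lemma apply_orbitSeries_ne_zero (hlam : radius hβ t < lam) {ν : spaceF β →L[ℂ] ℂ}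
    (hν : ∀ f, IsNonneg f → ∃ r : ℝ, 0 ≤ r ∧ ν f = r) (h1 : ν (oneF β) = 1) :
    ν (orbitSeries β t lam (quasiOne β)) ≠ 0 := by
  have h0 := pos_of_radius hlam
  have hs := (hasSum_orbitSeries hβ (radius_lt_norm hlam) (quasiOne_mem hβ)).mapL ν
  choose r hr0 hr using fun n => hν _ (isNonneg_chi β (shift^[n] (quasiOne β)))
  have hs' : HasSum (fun n => weight t (quasiOne β) n / lam ^ (n + 1) * r n)
      (ν (orbitSeries β t lam (quasiOne β))).re := by
    refine (Complex.hasSum_re hs).congr_fun fun n => ?_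
    rw [map_smul, hr, smul_eq_mul, ← Complex.ofReal_pow, ← Complex.ofReal_div,
      ← Complex.ofReal_mul, Complex.ofReal_re]
  have hr0' : r 0 = 1 := by
    have := hr 0
    rw [Function.iterate_zero, id, chi_quasiOne hβ, h1] at this
    exact_mod_cast this.symm
  have h2 := le_hasSum hs' 0 fun n _ => mul_nonneg
    (div_nonneg (weight_pos _ _ _).le (by positivity)) (hr0 n)
  rw [hr0', weight_zero] at h2
  intro h
  rw [h, Complex.zero_re] at h2
  have : 0 < 1 / lam ^ (0 + 1) * 1 := by positivity
  linarith

lemma hasEigenvalue_of_ne_zero {z : ℂ} (hz : radius hβ t < ‖z‖) (hφ : phi β t z⁻¹ = 1)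
    (hu : orbitSeries β t z (quasiOne β) ≠ 0) :
    Module.End.HasEigenvalue (transferOp hβ t : Module.End ℂ (spaceF β)) z :=
  Module.End.hasEigenvalue_of_hasEigenvector
    ⟨Module.End.mem_eigenspace_iff.2 (transferOp_orbitSeries hβ hz hφ), hu⟩

lemma exists_perronPair_of_root (hlam : radius hβ t < lam)
    (hq : realDigitSeries t lam (quasiOne β) = 1) : ∃ ν, IsPerronPair hβ t lam ν := by
  have hφ : phi β t (lam : ℂ)⁻¹ = 1 := by rw [phi_inv_ofReal, hq, Complex.ofReal_one]
  obtain ⟨ν, hν, h1⟩ := exists_eigenfunctional hβ (radius_lt_norm hlam) hφ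
  obtain ⟨m, hm, hmV⟩ := exists_measure hβ hlam hq
  have : NullSingletonClass m := ⟨measure_singleton_eq_zero hβ hlam hq hmV⟩
  have hrep : Represents m ν := represents_of_chi m hβ fun a => by
    rw [eigenfunctional_chi hβ (radius_lt_norm hlam) hν h1 a.mem, hmV, ofReal_realDigitSeries]
  have hnn : ∀ f, IsNonneg f → ∃ r : ℝ, 0 ≤ r ∧ ν f = r := fun f => nonneg_of_represents m hrep
  refine ⟨ν, pos_of_radius hlam, hasEigenvalue_of_ne_zero hβ (radius_lt_norm hlam) hφ ?_, hν,
    hnn, h1⟩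
  intro h
  exact apply_orbitSeries_ne_zero hβ hlam hnn h1 (by rw [h, map_zero])

theorem exists_perronPair (t : ℝ) : ∃ (lam : ℝ) (ν : spaceF β →L[ℂ] ℂ), IsPerronPair hβ t lam ν := by
  obtain ⟨lam, hlam, hq⟩ := exists_leading_root hβ t
  exact ⟨lam, exists_perronPair_of_root hβ hlam hq⟩

/-- A positive eigenfunctional pairs nontrivially with the eigenfunction at the leading root,
so it belongs to the same eigenvalue. -/
theorem IsPerronPair.root {ν : spaceF β →L[ℂ] ℂ} (h : IsPerronPair hβ t lam ν) :
    radius hβ t < lam ∧ realDigitSeries t lam (quasiOne β) = 1 := by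
  obtain ⟨lam₀, hlam, hq⟩ := exists_leading_root hβ t
  have hφ : phi β t (lam₀ : ℂ)⁻¹ = 1 := by rw [phi_inv_ofReal, hq, Complex.ofReal_one]
  have h1 := congrArg ν (transferOp_orbitSeries hβ (radius_lt_norm hlam) hφ)
  have h2 : ν (transferOp hβ t (orbitSeries β t lam₀ (quasiOne β))) =
      lam * ν (orbitSeries β t lam₀ (quasiOne β)) := DFunLike.congr_fun h.eigenfunctional _
  rw [h2, map_smul, smul_eq_mul] at h1
  have h3 := mul_right_cancel₀ (apply_orbitSeries_ne_zero hβ hlam h.nonneg h.normalized) h1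
  have h4 : lam = lam₀ := by exact_mod_cast h3
  rw [h4]
  exact ⟨hlam, hq⟩

end perron

/-! ### Roots of `φ_t(1/z) = 1` -/

section roots

variable {β : ℝ} (hβ : 1 < β ∧ β ≤ 2) {t lam : ℝ}

lemma differentiableOn_phi {ρ : ℝ} (hρ : radius hβ t < ρ) :
    DifferentiableOn ℂ (phi β t) (Metric.ball 0 ρ⁻¹) := by
  have hρ0 := pos_of_radius hρ
  obtain ⟨b, hs, h0, hb⟩ := exists_summable_bound' hβ hρ
  refine Complex.differentiableOn_tsum_of_summable_norm (hs.mul_right ρ⁻¹) (fun n => by fun_prop)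
    Metric.isOpen_ball fun n w hw => ?_
  rw [mem_ball_zero_iff] at hw
  rw [norm_mul, norm_mul, norm_weight, norm_pow]
  have h1 := hb _ (quasiOne_mem hβ) n
  have h2 := weight_pos t (quasiOne β) n
  have h3 : ‖w‖ ^ (n + 1) ≤ ρ⁻¹ ^ (n + 1) := pow_le_pow_left₀ (norm_nonneg _) hw.le _
  calc ‖((quasiOne β n : ℕ) : ℂ)‖ * weight t (quasiOne β) n * ‖w‖ ^ (n + 1)
      ≤ 1 * weight t (quasiOne β) n * ρ⁻¹ ^ (n + 1) := by
        gcongr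
        exact norm_digit_le _ n
    _ = weight t (quasiOne β) n / ρ ^ n * ρ⁻¹ := by
        rw [one_mul, pow_succ, inv_pow]; ring
    _ ≤ b n * ρ⁻¹ := by gcongr

lemma exists_inv_mem_ball {z : ℂ} (hz : radius hβ t < ‖z‖) :
    ∃ ρ, radius hβ t < ρ ∧ z⁻¹ ∈ Metric.ball (0 : ℂ) ρ⁻¹ := by
  obtain ⟨ρ, hρ, hρz⟩ := exists_between hz
  refine ⟨ρ, hρ, ?_⟩
  rw [mem_ball_zero_iff, norm_inv]
  exact inv_strictAnti₀ (pos_of_radius hρ) hρz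

/-- The roots are isolated: `φ_t` is holomorphic, and not constant because `φ_t(0) = 0`. -/
lemma eventually_phi_inv_ne_one {z : ℂ} (hz : radius hβ t < ‖z‖) :
    ∀ᶠ w in 𝓝[≠] z, phi β t w⁻¹ ≠ 1 := by
  obtain ⟨ρ, hρ, hzρ⟩ := exists_inv_mem_ball hβ hz
  have hz0 := ne_zero_of_radius hz
  have han : AnalyticOnNhd ℂ (phi β t) (Metric.ball 0 ρ⁻¹) :=
    (differentiableOn_phi hβ hρ).analyticOnNhd Metric.isOpen_ball
  have hev : ∀ᶠ w in 𝓝[≠] z⁻¹, phi β t w ≠ 1 := by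
    rcases (han _ hzρ).eventually_eq_or_eventually_ne (analyticAt_const (v := (1 : ℂ))) with h | h
    · have h1 := han.eqOn_of_preconnected_of_eventuallyEq
        (analyticOnNhd_const (v := (1 : ℂ))) (convex_ball _ _).isPreconnected hzρ h
        (Metric.mem_ball_self (inv_pos.2 (pos_of_radius hρ)))
      simp [phi] at h1
    · exact h
  have hlim : Tendsto (fun w : ℂ => w⁻¹) (𝓝[≠] z) (𝓝[≠] z⁻¹) :=
    tendsto_nhdsWithin_iff.2 ⟨(continuousAt_inv₀ hz0).tendsto.mono_left nhdsWithin_le_nhds,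
      eventually_nhdsWithin_of_forall fun w hw => fun h => hw (inv_injective h)⟩
  exact hlim.eventually hev

/-- Beyond `r_t`, every eigenvalue is isolated. -/
lemma isIsolatedEigenvalue {z : ℂ} (hz : radius hβ t < ‖z‖)
    (h : Module.End.HasEigenvalue (transferOp hβ t : Module.End ℂ (spaceF β)) z) :
    IsIsolatedEigenvalue (transferOp hβ t) z := by
  refine ⟨h, ?_⟩
  have h1 := eventually_nhdsWithin_iff.1 (eventually_phi_inv_ne_one hβ hz)
  have h2 : ∀ᶠ w in 𝓝 z, radius hβ t < ‖w‖ := continuous_norm.continuousAt.eventually_const_lt hz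
  obtain ⟨ε, hε, h3⟩ := Metric.eventually_nhds_iff.1 (h1.and h2)
  refine ⟨ε, hε, fun w hw hwz => ?_⟩
  by_contra hne
  exact (h3 hwz).1 hne (phi_eq_one_of_mem_spectrum hβ (h3 hwz).2 hw)

/-- For `|z| ≥ lam` the real parts of the terms of `φ_t(1/z)` are at most the terms of
`φ_t(1/lam)`. If the sums agree, so do the first terms `Re (1/z)` and `1/lam`. -/
lemma norm_lt_of_phi_eq_one (hlam : radius hβ t < lam)
    (hq : realDigitSeries t lam (quasiOne β) = 1) {z : ℂ} (hφ : phi β t z⁻¹ = 1)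
    (hne : z ≠ lam) : ‖z‖ < lam := by
  by_contra! hle
  have h0 := pos_of_radius hlam
  have h1 := Complex.hasSum_re (hasSum_digitSeries hβ (hlam.trans_le hle) (quasiOne_mem hβ))
  rw [← phi_inv, hφ, Complex.one_re] at h1
  have h2 := hasSum_realDigitSeries hβ hlam (quasiOne_mem hβ)
  rw [hq] at h2
  have h3 := h2.sub h1
  rw [sub_self] at h3
  have h4 : ∀ n, 0 ≤ ((quasiOne β n : ℕ) : ℝ) * weight t (quasiOne β) n / lam ^ (n + 1) -
      (((quasiOne β n : ℕ) : ℂ) * (weight t (quasiOne β) n : ℂ) / z ^ (n + 1)).re := by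
    intro n
    refine sub_nonneg.2 ((Complex.re_le_norm _).trans ?_)
    rw [norm_div, norm_mul, norm_weight, norm_pow, Complex.norm_natCast]
    have := weight_pos t (quasiOne β) n
    gcongr
  have h5 := congrFun ((hasSum_zero_iff_of_nonneg h4).1 h3) 0
  simp only [quasiOne_zero hβ, weight_zero, Fin.val_one, Nat.cast_one, one_mul, zero_add, pow_one,
    Complex.ofReal_one, Pi.zero_apply, one_div] at h5
  have h6 : z⁻¹.re = lam⁻¹ := by linarith
  have h7 : ‖z⁻¹‖ ≤ lam⁻¹ := by
    rw [norm_inv]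
    exact inv_anti₀ h0 hle
  have h8 : z⁻¹.im = 0 := by
    have h9 := Complex.sq_norm z⁻¹
    rw [Complex.normSq_apply, h6] at h9
    have h10 : ‖z⁻¹‖ ^ 2 ≤ lam⁻¹ ^ 2 := pow_le_pow_left₀ (norm_nonneg _) h7 2
    nlinarith
  have h11 : z⁻¹ = ((lam⁻¹ : ℝ) : ℂ) := Complex.ext h6 h8
  rw [Complex.ofReal_inv] at h11
  exact hne (inv_injective h11)

/-- If there are roots beyond `r_t` other than `lam`, those of modulus at least that of a given one
form a compact set, because the roots are isolated, also at `lam`. -/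
theorem exists_isGreatest (hlam : radius hβ t < lam)
    (hq : realDigitSeries t lam (quasiOne β) = 1) :
    ∃ α, IsGreatest ({radius hβ t} ∪
      {s : ℝ | ∃ z : ℂ, 1 - phi β t z⁻¹ = 0 ∧ z ≠ lam ∧ s = ‖z‖}) α ∧ α < lam := by
  by_cases hex : ∃ z : ℂ, phi β t z⁻¹ = 1 ∧ z ≠ lam ∧ radius hβ t < ‖z‖
  · obtain ⟨z₁, h1, h2, h3⟩ := hex
    set S := {z : ℂ | (‖z₁‖ ≤ ‖z‖ ∧ ‖z‖ ≤ lam) ∧ phi β t z⁻¹ = 1 ∧ z ≠ lam} with hS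
    have hclosed : IsClosed S := by
      refine isClosed_of_closure_subset fun z hz => ?_
      have hmem : ‖z₁‖ ≤ ‖z‖ ∧ ‖z‖ ≤ lam :=
        closure_minimal (t := {z : ℂ | ‖z₁‖ ≤ ‖z‖ ∧ ‖z‖ ≤ lam}) (fun w hw => hw.1)
          ((_root_.isClosed_le continuous_const continuous_norm).inter
            (_root_.isClosed_le continuous_norm continuous_const)) hz
      have hzr : radius hβ t < ‖z‖ := h3.trans_le hmem.1
      have hfreq : ∃ᶠ w in 𝓝 z, w ∈ S := mem_closure_iff_frequently.1 hz
      by_contra hzS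
      have hev := eventually_nhdsWithin_iff.1 (eventually_phi_inv_ne_one hβ hzr)
      obtain ⟨w, hw, hw2⟩ := (hfreq.and_eventually hev).exists
      refine hw2 (fun h => hzS ?_) hw.2.1
      rw [← h]; exact hw
    have hcomp : IsCompact S := by
      refine (isCompact_closedBall (0 : ℂ) lam).of_isClosed_subset hclosed fun z hz => ?_
      rw [mem_closedBall_zero_iff]
      exact hz.1.2
    have hz₁ : z₁ ∈ S := ⟨⟨le_rfl, (norm_lt_of_phi_eq_one hβ hlam hq h1 h2).le⟩, h1, h2⟩
    obtain ⟨z, hz, hmax⟩ := hcomp.exists_isMaxOn ⟨z₁, hz₁⟩ continuous_norm.continuousOn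
    refine ⟨‖z‖, ⟨Or.inr ⟨z, by rw [hz.2.1, sub_self], hz.2.2, rfl⟩, ?_⟩,
      norm_lt_of_phi_eq_one hβ hlam hq hz.2.1 hz.2.2⟩
    rintro s (rfl | ⟨w, hw, hwl, rfl⟩)
    · exact (h3.trans_le hz.1.1).le
    · have hw1 : phi β t w⁻¹ = 1 := (sub_eq_zero.1 hw).symm
      rcases le_total ‖w‖ ‖z₁‖ with h | h
      · exact h.trans hz.1.1
      · exact hmax ⟨⟨h, (norm_lt_of_phi_eq_one hβ hlam hq hw1 hwl).le⟩, hw1, hwl⟩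
  · push Not at hex
    refine ⟨radius hβ t, ⟨Or.inl rfl, ?_⟩, hlam⟩
    rintro s (rfl | ⟨w, hw, hwl, rfl⟩)
    · exact le_rfl
    · exact hex w (sub_eq_zero.1 hw).symm hwl

end roots

/-! ### Isolated eigenvalues -/

section eigenvalues

variable {β : ℝ} (hβ : 1 < β ∧ β ≤ 2) {t : ℝ} {z : ℂ}

lemma existsUnique_eigenfunctional (hz : radius hβ t < ‖z‖) (hφ : phi β t z⁻¹ = 1) :
    ∃! ν : spaceF β →L[ℂ] ℂ, IsEigenfunctional (transferOp hβ t) z ν ∧ ν (oneF β) = 1 := by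
  obtain ⟨ν, h1, h2⟩ := exists_eigenfunctional hβ hz hφ
  exact ⟨ν, ⟨h1, h2⟩, fun ν' h => eigenfunctional_unique hβ hz h.1 h.2 h1 h2⟩

lemma hasSum_eigenfunctional_chi (hz : radius hβ t < ‖z‖) {ν : spaceF β →L[ℂ] ℂ}
    (hν : IsEigenfunctional (transferOp hβ t) z ν) (h1 : ν (oneF β) = 1) {a : ℕ → Fin 2}
    (ha : a ∈ betaSet β) :
    HasSum (fun n : ℕ => ((a n : ℕ) : ℂ) * (weight t a n : ℂ) / z ^ (n + 1)) (ν (chi β a)) := by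
  rw [eigenfunctional_chi hβ hz hν h1 ha]
  exact hasSum_digitSeries hβ hz ha

lemma exists_hasSum_eigenTerm (hz : radius hβ t < ‖z‖) :
    ∃ g : spaceF β, HasSum (eigenTerm β t z) g ∧
      ∀ h : spaceF β, transferOp hβ t h = z • h → ∃ C : ℂ, h = C • g := by
  refine ⟨_, hasSum_eigenTerm hβ hz, fun h hh => ?_⟩
  obtain ⟨c, rfl⟩ := eigenvector_eq_smul hβ hz hh
  exact ⟨c / z, by rw [smul_smul, div_mul_cancel₀ _ (ne_zero_of_radius hz)]⟩

end eigenvalues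

/-! ### Conformality and the transfer operator -/

lemma measurableSet_cons {β : ℝ} (hβ : 1 < β ∧ β ≤ 2) (d : Fin 2) :
    MeasurableSet {x : BetaShift β | cons d x.seq ∈ betaSet β} :=
  have h : IsLowerSet {x : BetaShift β | cons d x.seq ∈ betaSet β} :=
    fun _ _ hyx hx => cons_mem_of_le hβ hyx hx
  h.ordConnected.measurableSet

section conformal

variable {β : ℝ} (hβ : 1 < β ∧ β ≤ 2) {t lam : ℝ} {m : Measure (BetaShift β)}

lemma branchMap_of_mem {d : Fin 2} {x : BetaShift β} (h : cons d x.seq ∈ betaSet β) :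
    branchMap hβ d x = ⟨cons d x.seq, h⟩ := dif_pos h

/-- A measure with distribution function the digit series is conformal: it is the sum of its images
under the two inverse branches, with weights `1 / lam` and `e^t / lam`. -/
lemma eq_add_map_branchMap [IsFiniteMeasure m] (hlam : radius hβ t < lam)
    (hq : realDigitSeries t lam (quasiOne β) = 1)
    (hm : ∀ a, m.real (Iic a) = realDigitSeries t lam a.seq) :
    m = ENNReal.ofReal lam⁻¹ • (m.map (branchMap hβ 0) + ENNReal.ofReal (Real.exp t) •
      (m.restrict {x | cons 1 x.seq ∈ betaSet β}).map (branchMap hβ 1)) := by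
  have h0 := pos_of_radius hlam
  have hb0 : Measurable (branchMap hβ 0) := (branchMap_mono hβ 0).measurable
  have hb1 : Measurable (branchMap hβ 1) := (branchMap_mono hβ 1).measurable
  have hmI : ∀ a, m (Iic a) = ENNReal.ofReal (realDigitSeries t lam a.seq) := fun a => by
    rw [← hm, ofReal_measureReal]
  have hmU : m univ = 1 := by
    have h : (univ : Set (BetaShift β)) = Iic ⟨quasiOne β, quasiOne_mem hβ⟩ :=
      (eq_univ_of_forall fun x => le_quasiOne hβ x.mem).symm
    rw [h, hmI, hq, ENNReal.ofReal_one]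
  refine Measure.ext_of_Iic _ _ fun a => ?_
  rw [Measure.smul_apply, Measure.add_apply, Measure.smul_apply,
    Measure.map_apply hb0 measurableSet_Iic, Measure.map_apply hb1 measurableSet_Iic,
    Measure.restrict_apply (hb1 measurableSet_Iic), smul_eq_mul, smul_eq_mul]
  have hrec := realDigitSeries_rec hβ hlam a.mem
  have hV := realDigitSeries_nonneg hβ hlam (shift a.seq)
  have hrec' : realDigitSeries t lam a.seq = lam⁻¹ * (((a.seq 0 : ℕ) : ℝ) +
      weight t a.seq 1 * realDigitSeries t lam (shift a.seq)) := by
    rw [← hrec]; field_simp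
  have hcons : ∀ (d : Fin 2) (x : BetaShift β), a.seq 0 = d →
      (toLex (cons d x.seq) ≤ toLex a.seq ↔ x ≤ sigma hβ a) := by
    intro d x hd
    have h1 : a.seq = cons d (shift a.seq) := by rw [← hd, cons_shift]
    rw [h1, cons_le_cons_iff]
    exact Iff.rfl
  rcases fin_two_cases (a.seq 0) with ha | ha
  · have h1 : branchMap hβ 0 ⁻¹' Iic a = Iic (sigma hβ a) := by
      ext x
      rw [mem_preimage, mem_Iic, branchMap_of_mem hβ (cons_zero_mem hβ x.mem)]
      exact hcons 0 x ha
    have h2 : branchMap hβ 1 ⁻¹' Iic a ∩ {x | cons 1 x.seq ∈ betaSet β} = ∅ := by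
      refine eq_empty_of_forall_notMem fun x hx => ?_
      have h3 := hx.1
      rw [mem_preimage, mem_Iic, branchMap_of_mem hβ hx.2] at h3
      exact (lt_of_agree (n := 0) (by simp) ha rfl).not_ge h3
    rw [h1, h2, hmI, hmI, measure_empty, mul_zero, add_zero, hrec', ha,
      weight_one_of_zero ha, ENNReal.ofReal_mul (inv_nonneg.2 h0.le)]
    simp [sigma]
  · have h1 : branchMap hβ 0 ⁻¹' Iic a = univ := by
      refine eq_univ_of_forall fun x => ?_
      rw [mem_preimage, mem_Iic, branchMap_of_mem hβ (cons_zero_mem hβ x.mem)]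
      exact (lt_of_agree (n := 0) (by simp) rfl ha).le
    have h2 : branchMap hβ 1 ⁻¹' Iic a ∩ {x | cons 1 x.seq ∈ betaSet β} = Iic (sigma hβ a) := by
      ext x
      constructor
      · rintro ⟨h3, h4⟩
        rw [mem_preimage, mem_Iic, branchMap_of_mem hβ h4] at h3
        exact (hcons 1 x ha).1 h3
      · intro h3
        have h4 : cons 1 x.seq ∈ betaSet β := cons_mem_of_le hβ h3 (by
          rw [← ha]; change cons (a.seq 0) (shift a.seq) ∈ _; rw [cons_shift]; exact a.mem)
        refine ⟨?_, h4⟩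
        rw [mem_preimage, mem_Iic, branchMap_of_mem hβ h4]
        exact (hcons 1 x ha).2 h3
    rw [h1, h2, hmI, hmI, hmU, hrec', ha, weight_one_of_one ha,
      ENNReal.ofReal_mul (inv_nonneg.2 h0.le), ← ENNReal.ofReal_mul (Real.exp_pos t).le,
      ← ENNReal.ofReal_one, show (sigma hβ a).seq = shift a.seq from rfl,
      ← ENNReal.ofReal_add zero_le_one (mul_nonneg (Real.exp_pos t).le hV)]
    simp

lemma branch_zero_eq (f : BetaShift β → ℂ) (x : BetaShift β) :
    branch 0 f x = f (branchMap hβ 0 x) := by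
  rw [branchMap_of_mem hβ (cons_zero_mem hβ x.mem)]
  exact dif_pos (cons_zero_mem hβ x.mem)

lemma branch_one_eq (f : BetaShift β → ℂ) : branch 1 f =
    {x : BetaShift β | cons 1 x.seq ∈ betaSet β}.indicator fun x => f (branchMap hβ 1 x) := by
  rw [branch_eq hβ]
  ext x
  by_cases h : cons 1 x.seq ∈ betaSet β <;> simp [indicator, h]

/-- The conformal measure is an eigenmeasure of the transfer operator. -/
lemma integral_transferFun [IsFiniteMeasure m] (hlam : radius hβ t < lam)
    (hq : realDigitSeries t lam (quasiOne β) = 1)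
    (hm : ∀ a, m.real (Iic a) = realDigitSeries t lam a.seq) {f : BetaShift β → ℂ}
    (hf : Integrable f m) : ∫ x, transferFun hβ (potential t) f x ∂m = lam * ∫ x, f x ∂m := by
  have h0 := pos_of_radius hlam
  have hb0 : Measurable (branchMap hβ 0) := (branchMap_mono hβ 0).measurable
  have hb1 : Measurable (branchMap hβ 1) := (branchMap_mono hβ 1).measurable
  have hconf := eq_add_map_branchMap hβ hlam hq hm
  have hf' := hf
  rw [hconf, integrable_smul_measure (by simpa using h0) ENNReal.ofReal_ne_top,
    integrable_add_measure, integrable_smul_measure (by simpa using Real.exp_pos t)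
      ENNReal.ofReal_ne_top] at hf'
  obtain ⟨hf0, hf1⟩ := hf'
  have hi0 := (integrable_map_measure hf0.aestronglyMeasurable hb0.aemeasurable).1 hf0
  have hi1 := (integrable_map_measure hf1.aestronglyMeasurable hb1.aemeasurable).1 hf1
  have hi1' : Integrable (branch 1 f) m := by
    rw [branch_one_eq hβ]
    exact (integrable_indicator_iff (measurableSet_cons hβ 1)).2 hi1
  have hi0' : Integrable (branch 0 f) m :=
    hi0.congr (Eventually.of_forall fun x => (branch_zero_eq hβ f x).symm)
  have hint : ∫ x, f x ∂m = (lam⁻¹ : ℝ) * (∫ x, branch 0 f x ∂m +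
      (Real.exp t : ℂ) * ∫ x, branch 1 f x ∂m) := by
    rw [hconf, integral_smul_measure, integral_add_measure hf0
      ((integrable_smul_measure (by simpa using Real.exp_pos t) ENNReal.ofReal_ne_top).2 hf1),
      integral_smul_measure, integral_map hb0.aemeasurable hf0.aestronglyMeasurable,
      integral_map hb1.aemeasurable hf1.aestronglyMeasurable, ← hconf,
      ENNReal.toReal_ofReal (inv_nonneg.2 h0.le), ENNReal.toReal_ofReal (Real.exp_pos t).le,
      branch_one_eq hβ, integral_indicator (measurableSet_cons hβ 1)]
    simp only [Complex.real_smul, branch_zero_eq hβ]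
  rw [hint]
  simp only [transferFun_eq]
  rw [integral_add hi0' (hi1'.const_mul _), integral_const_mul]
  have : (lam : ℂ) ≠ 0 := by exact_mod_cast h0.ne'
  push_cast
  field_simp

lemma transferFun_mul_comp_sigma (t : ℝ) (f g : BetaShift β → ℂ) (x : BetaShift β) :
    transferFun hβ (potential t) (fun y => f y * g (sigma hβ y)) x =
      transferFun hβ (potential t) f x * g x := by
  have h : ∀ d, branch d (fun y => f y * g (sigma hβ y)) x = branch d f x * g x := fun d => by
    unfold branch
    split_ifs with h
    · have : sigma hβ ⟨cons d x.seq, h⟩ = x := BetaShift.ext rfl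
      simp only [this]
    · rw [zero_mul]
  rw [transferFun_eq, transferFun_eq, h, h]
  ring

end conformal

/-! ### The invariant density -/

/-- Summing the tails of a series counts its `n`-th term `n + 1` times. -/
lemma hasSum_tails {c : ℕ → ℝ} (h0 : ∀ n, 0 ≤ c n) (hs : Summable fun n : ℕ => ((n : ℝ) + 1) * c n) :
    HasSum (fun n => ∑' k, c (k + n)) (∑' n : ℕ, ((n : ℝ) + 1) * c n) := by
  set g : (Σ n : ℕ, Finset.HasAntidiagonal.antidiagonal n) → ℝ := fun x => c x.1 with hg
  have hfib : ∀ n, ∑' y : Finset.HasAntidiagonal.antidiagonal n, g ⟨n, y⟩ = ((n : ℝ) + 1) * c n := fun n => by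
    simp [hg, tsum_fintype]
  have hgs : Summable g := by
    refine (summable_sigma_of_nonneg fun x => h0 _).2 ⟨fun n => (hasSum_fintype _).summable,
      hs.congr fun n => (hfib n).symm⟩
  have hgt : ∑' x, g x = ∑' n : ℕ, ((n : ℝ) + 1) * c n := by
    rw [hgs.tsum_sigma]
    simp only [hfib]
  set f : ℕ × ℕ → ℝ := fun p => c (p.2 + p.1) with hf
  have hfg : f ∘ Finset.HasAntidiagonal.sigmaAntidiagonalEquivProd = g := by
    ext ⟨n, ⟨⟨k, l⟩, h⟩⟩
    have h' : k + l = n := Finset.HasAntidiagonal.mem_antidiagonal.1 h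
    simp [hf, hg, ← h', add_comm]
  have hfs : Summable f := by
    rw [← hfg] at hgs
    exact (Equiv.summable_iff _).1 hgs
  have hft : ∑' p, f p = ∑' n : ℕ, ((n : ℝ) + 1) * c n := by
    rw [← hgt, ← hfg]
    exact (Equiv.tsum_eq _ f).symm
  rw [← hft]
  exact hfs.hasSum.prod_fiberwise fun n => (hfs.prod_factor n).hasSum

section density

variable {β : ℝ} (hβ : 1 < β ∧ β ≤ 2) {t lam : ℝ}

lemma normTerm_eq (β t lam : ℝ) (n : ℕ) : normTerm β t lam n =
    ((n : ℝ) + 1) * (((quasiOne β n : ℕ) : ℝ) * weight t (quasiOne β) n / lam ^ (n + 1)) := by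
  rw [normTerm]; ring

lemma summable_normTerm (hlam : radius hβ t < lam) : Summable (normTerm β t lam) := by
  have h0 := pos_of_radius hlam
  obtain ⟨b, hs, hb0, hb⟩ := exists_summable_bound hβ hlam
  refine Summable.of_nonneg_of_le (fun n => ?_) (fun n => ?_) (hs.mul_right lam⁻¹)
  · rw [normTerm_eq]
    exact mul_nonneg (by positivity) (digitTerm_nonneg h0 _ _)
  · rw [normTerm_eq, mul_assoc]
    refine mul_le_mul_of_nonneg_left ?_ (by positivity)
    rw [pow_succ, ← div_div, div_eq_mul_inv _ lam]
    refine mul_le_mul_of_nonneg_right (le_trans ?_ (hb _ (quasiOne_mem hβ) n)) (by positivity)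
    have := weight_pos t (quasiOne β) n
    gcongr
    exact mul_le_of_le_one_left this.le (digit_le _ _)

lemma tsum_normTerm_pos (hlam : radius hβ t < lam) : 0 < ∑' n, normTerm β t lam n := by
  have h0 := pos_of_radius hlam
  refine (summable_normTerm hβ hlam).tsum_pos (fun n => ?_) 0 ?_
  · rw [normTerm_eq]
    exact mul_nonneg (by positivity) (digitTerm_nonneg h0 _ _)
  · simp [normTerm, quasiOne_zero hβ, h0]

/-- `F(t)` is the integral of the eigenfunction series against the conformal measure. -/
lemma hasSum_weight_mul_realDigitSeries (hlam : radius hβ t < lam) :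
    HasSum (fun n => weight t (quasiOne β) n / lam ^ n *
      realDigitSeries t lam (shift^[n] (quasiOne β))) (∑' n, normTerm β t lam n) := by
  have h0 := pos_of_radius hlam
  have hs := summable_normTerm hβ hlam
  simp only [funext (normTerm_eq β t lam)] at hs ⊢
  refine (hasSum_tails (fun n => digitTerm_nonneg h0 (quasiOne β) n) hs).congr_fun fun n => ?_
  have hV := hasSum_realDigitSeries hβ hlam (quasiOne_mem hβ)
  have h1 := hV.summable.sum_add_tsum_nat_add n
  rw [hV.tsum_eq, realDigitSeries_iter hβ hlam (quasiOne_mem hβ) n] at h1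
  linarith

/-- The eigenfunction series `∑ H_n(t, q) lam⁻ⁿ χ_{[0, σⁿ q]}` as a function of bounded variation. -/
def eigenBV (β t lam : ℝ) : BV β :=
  ∑' n : ℕ, ((weight t (quasiOne β) n / lam ^ n : ℝ) : ℂ) • chiBV β (shift^[n] (quasiOne β))

lemma hasSum_eigenBV (hlam : radius hβ t < lam) :
    HasSum (fun n : ℕ => ((weight t (quasiOne β) n / lam ^ n : ℝ) : ℂ) •
      chiBV β (shift^[n] (quasiOne β))) (eigenBV β t lam) := by
  have h0 := pos_of_radius hlam
  obtain ⟨b, hs, hb0, hb⟩ := exists_summable_bound' hβ hlam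
  refine (Summable.of_norm_bounded (hs.mul_right 2) fun n => ?_).hasSum
  have := weight_pos t (quasiOne β) n
  rw [norm_smul, Complex.norm_real, Real.norm_of_nonneg (by positivity)]
  exact mul_le_mul (hb _ (quasiOne_mem hβ) n) (norm_chiBV_le β _) (norm_nonneg _) (hb0 n)

lemma hasSum_densityTerm (hlam : radius hβ t < lam) (x : BetaShift β) :
    HasSum (fun n => (densityTerm t lam x n : ℂ)) (eigenBV β t lam x) := by
  refine ((hasSum_eigenBV hβ hlam).mapL (BV.eval x)).congr_fun fun n => ?_
  change _ = ((weight t (quasiOne β) n / lam ^ n : ℝ) : ℂ) * chiBV β (shift^[n] (quasiOne β)) x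
  rw [densityTerm, Complex.ofReal_mul, chiBV_apply]
  congr 1
  by_cases h : toLex x.seq ≤ toLex (shift^[n] (quasiOne β)) <;> simp [indicator, h]

lemma summable_densityTerm (hlam : radius hβ t < lam) (x : BetaShift β) :
    Summable (densityTerm t lam x) :=
  Complex.summable_ofReal.1 (hasSum_densityTerm hβ hlam x).summable

lemma ofReal_density (hlam : radius hβ t < lam) (x : BetaShift β) :
    (density t lam x : ℂ) = ((∑' n, normTerm β t lam n : ℝ) : ℂ)⁻¹ * eigenBV β t lam x := by
  have h : ((∑' n, densityTerm t lam x n : ℝ) : ℂ) = eigenBV β t lam x :=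
    (Complex.ofReal_tsum _).trans (hasSum_densityTerm hβ hlam x).tsum_eq
  rw [density, Complex.ofReal_mul, Complex.ofReal_inv, h]

lemma densityTerm_nonneg (hlam : 0 < lam) (x : BetaShift β) (n : ℕ) :
    0 ≤ densityTerm t lam x n := by
  have := weight_pos t (quasiOne β) n
  exact mul_nonneg (by positivity) (indicator_nonneg (fun _ _ => zero_le_one) _)

/-- The first term of the eigenfunction series is `1`. -/
lemma inv_le_density (hlam : radius hβ t < lam) (x : BetaShift β) :
    (∑' n, normTerm β t lam n)⁻¹ ≤ density t lam x := by
  have h0 := pos_of_radius hlam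
  refine le_mul_of_one_le_right (inv_nonneg.2 (tsum_normTerm_pos hβ hlam).le) ?_
  refine le_trans (le_of_eq ?_) ((summable_densityTerm hβ hlam x).le_tsum 0 fun n _ =>
    densityTerm_nonneg h0 x n)
  rw [densityTerm, indicator_of_mem (show x ∈ {y : BetaShift β | toLex y.seq ≤
    toLex (shift^[0] (quasiOne β))} from le_quasiOne hβ x.mem)]
  simp

lemma density_pos (hlam : radius hβ t < lam) (x : BetaShift β) : 0 < density t lam x :=
  (inv_pos.2 (tsum_normTerm_pos hβ hlam)).trans_le (inv_le_density hβ hlam x)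

lemma measurable_density (hlam : radius hβ t < lam) :
    Measurable (density t lam : BetaShift β → ℝ) := by
  have h0 := pos_of_radius hlam
  have h : Antitone fun x : BetaShift β => ∑' n, densityTerm t lam x n := by
    intro x y hxy
    refine (summable_densityTerm hβ hlam y).tsum_le_tsum (fun n => ?_)
      (summable_densityTerm hβ hlam x)
    have := weight_pos t (quasiOne β) n
    refine mul_le_mul_of_nonneg_left ?_ (by positivity)
    by_cases hy : toLex y.seq ≤ toLex (shift^[n] (quasiOne β))
    · rw [indicator_of_mem (show y ∈ {y : BetaShift β | toLex y.seq ≤ _} from hy),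
        indicator_of_mem (show x ∈ {y : BetaShift β | toLex y.seq ≤ _} from
          (BetaShift.le_iff.1 hxy).trans hy)]
      simp
    · rw [indicator_of_notMem (show y ∉ {y : BetaShift β | toLex y.seq ≤ _} from hy)]
      exact indicator_nonneg (fun _ _ => zero_le_one) _
  exact h.measurable.const_mul _

lemma transferBV_eigenBV (hlam : radius hβ t < lam)
    (hq : realDigitSeries t lam (quasiOne β) = 1) :
    transferBV hβ t (eigenBV β t lam) = (lam : ℂ) • eigenBV β t lam := by
  have h0 := pos_of_radius hlam
  have hone : chiBV β (quasiOne β) = oneBV β :=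
    BV.ext_iff'.2 fun x => chiBV_of_le (le_quasiOne hβ x.mem)
  have h1 := (hasSum_eigenBV hβ hlam).mapL (transferBV hβ t)
  have h2 := ((hasSum_realDigitSeries hβ hlam (quasiOne_mem hβ)).mul_left lam)
  rw [hq, mul_one] at h2
  have h3 := (Complex.hasSum_ofReal.2 h2).smul_const (oneBV β)
  have h4 := (hasSum_nat_add_iff' 1).2 (hasSum_eigenBV hβ hlam)
  refine h1.unique ?_
  have h5 := h3.add (h4.const_smul (lam : ℂ))
  simp only [Finset.sum_range_one, weight_zero, pow_zero, div_one, Complex.ofReal_one, one_smul,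
    Function.iterate_zero, id, hone, smul_sub, add_sub_cancel] at h5
  refine h5.congr_fun fun n => ?_
  rw [map_smul, transferBV_chi hβ t (shift_iter_mem hβ (quasiOne_mem hβ) n), smul_add, smul_smul,
    smul_smul, smul_smul, shift_iter, zero_add, ← Function.iterate_succ_apply' shift, weight_add]
  have : (lam : ℂ) ≠ 0 := by exact_mod_cast h0.ne'
  congr 2
  · push_cast
    field_simp
    ring
  · push_cast
    field_simp
    ring

lemma transferFun_density (hlam : radius hβ t < lam)
    (hq : realDigitSeries t lam (quasiOne β) = 1) (x : BetaShift β) :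
    transferFun hβ (potential t) (fun y => (density t lam y : ℂ)) x = lam * density t lam x := by
  have h : (fun y : BetaShift β => (density t lam y : ℂ)) =
      ⇑(((∑' n, normTerm β t lam n : ℝ) : ℂ)⁻¹ • eigenBV β t lam) :=
    funext fun y => by rw [ofReal_density hβ hlam, BV.smul_apply]
  rw [h, ← transferBV_apply, map_smul, transferBV_eigenBV hβ hlam hq, ofReal_density hβ hlam,
    BV.smul_apply, BV.smul_apply]
  ring

lemma cls_eigenBV (hlam : radius hβ t < lam) : cls (eigenBV β t lam) =
    (((lam : ℂ) • orbitSeries β t lam (quasiOne β) : spaceF β) : BVQuot β) := by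
  have h1 := (hasSum_eigenBV hβ hlam).mapL (negligible β).mkQL
  have h2 := (hasSum_eigenTerm hβ (radius_lt_norm hlam)).mapL (spaceF β).subtypeL
  refine h1.unique (h2.congr_fun fun n => ?_)
  rw [map_smul, eigenTerm, map_smul]
  push_cast
  rfl

lemma cls_eigenBV_mem (hlam : radius hβ t < lam) : cls (eigenBV β t lam) ∈ spaceF β := by
  rw [cls_eigenBV hβ hlam]
  exact Subtype.coe_prop _

end density

/-! ### The equilibrium measure -/

section equilibrium

variable {β : ℝ} (hβ : 1 < β ∧ β ≤ 2) {t lam : ℝ} {m : Measure (BetaShift β)}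

lemma integrable_density [IsFiniteMeasure m] [NullSingletonClass m] (hlam : radius hβ t < lam) :
    Integrable (fun x => (density t lam x : ℂ)) m := by
  simp only [ofReal_density hβ hlam]
  exact (integrable_of_mem m (cls_eigenBV_mem hβ hlam)).const_mul _

lemma integral_eigenBV [IsFiniteMeasure m] [NullSingletonClass m] (hlam : radius hβ t < lam)
    (hm : ∀ a, m.real (Iic a) = realDigitSeries t lam a.seq) :
    ∫ x, eigenBV β t lam x ∂m = (∑' n, normTerm β t lam n : ℝ) := by
  have h1 := (hasSum_eigenTerm hβ (radius_lt_norm hlam)).mapL (integralF m)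
  rw [← integralF_apply m (cls_eigenBV_mem hβ hlam), show
    (⟨cls (eigenBV β t lam), cls_eigenBV_mem hβ hlam⟩ : spaceF β) =
      (lam : ℂ) • orbitSeries β t lam (quasiOne β) from Subtype.ext (cls_eigenBV hβ hlam)]
  refine h1.unique ((Complex.hasSum_ofReal.2
    (hasSum_weight_mul_realDigitSeries hβ hlam)).congr_fun fun n => ?_)
  set a : BetaShift β := ⟨_, shift_iter_mem hβ (quasiOne_mem hβ) n⟩
  have h2 : integralF m (chi β (shift^[n] (quasiOne β))) = realDigitSeries t lam a.seq := by
    rw [← hm a, ← integral_chiBV m a]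
    exact integralF_apply m _
  rw [eigenTerm, map_smul, h2]
  push_cast
  rfl

lemma integral_density [IsFiniteMeasure m] [NullSingletonClass m] (hlam : radius hβ t < lam)
    (hm : ∀ a, m.real (Iic a) = realDigitSeries t lam a.seq) :
    ∫ x, (density t lam x : ℂ) ∂m = 1 := by
  simp only [ofReal_density hβ hlam]
  rw [integral_const_mul, integral_eigenBV hβ hlam hm]
  refine inv_mul_cancel₀ ?_
  exact_mod_cast (tsum_normTerm_pos hβ hlam).ne'

lemma integral_equilibrium (hlam : radius hβ t < lam) (g : BetaShift β → ℂ) :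
    ∫ x, g x ∂(equilibrium t lam m) = ∫ x, (density t lam x : ℂ) * g x ∂m := by
  rw [equilibrium, integral_withDensity_eq_integral_toReal_smul
    (measurable_density hβ hlam).ennreal_ofReal (Eventually.of_forall fun _ => ENNReal.ofReal_lt_top)]
  refine integral_congr_ae (Eventually.of_forall fun x => ?_)
  simp only [ENNReal.toReal_ofReal (density_pos hβ hlam x).le, Complex.real_smul]

lemma integrable_equilibrium_iff (hlam : radius hβ t < lam) (g : BetaShift β → ℂ) :
    Integrable g (equilibrium t lam m) ↔ Integrable (fun x => (density t lam x : ℂ) * g x) m := by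
  rw [equilibrium, integrable_withDensity_iff_integrable_smul'
    (measurable_density hβ hlam).ennreal_ofReal (Eventually.of_forall fun _ => ENNReal.ofReal_lt_top)]
  simp only [ENNReal.toReal_ofReal (density_pos hβ hlam _).le, Complex.real_smul]

lemma equilibrium_apply [IsFiniteMeasure m] [NullSingletonClass m] (hlam : radius hβ t < lam)
    {A : Set (BetaShift β)} (hA : MeasurableSet A) :
    equilibrium t lam m A =
      ENNReal.ofReal (∫ x, (density t lam x : ℂ) * A.indicator 1 x ∂m).re := by
  have h1 : Integrable (density t lam) m := (integrable_density hβ hlam).re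
  have h2 : ∀ x, (density t lam x : ℂ) * A.indicator 1 x =
      ((A.indicator (density t lam) x : ℝ) : ℂ) := fun x => by
    by_cases hx : x ∈ A <;> simp [hx]
  simp only [h2]
  rw [integral_complex_ofReal, Complex.ofReal_re, integral_indicator hA,
    ofReal_integral_eq_lintegral_ofReal h1.integrableOn
      (Eventually.of_forall fun x => (density_pos hβ hlam x).le), equilibrium,
    withDensity_apply _ hA]

lemma isProbabilityMeasure_equilibrium [IsFiniteMeasure m] [NullSingletonClass m]
    (hlam : radius hβ t < lam) (hm : ∀ a, m.real (Iic a) = realDigitSeries t lam a.seq) :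
    IsProbabilityMeasure (equilibrium t lam m) := by
  refine ⟨?_⟩
  rw [equilibrium_apply hβ hlam MeasurableSet.univ]
  simp [integral_density hβ hlam hm]

lemma measurable_sigma : Measurable (sigma hβ) := by
  refine Continuous.measurable (continuous_induced_rng.2 ?_)
  exact continuous_shift.comp (BetaShift.continuous_seq β)

/-- By conformality, `∫ h · 1_A ∘ σ dm = lam⁻¹ ∫ (𝓛 h) 1_A dm = ∫ h 1_A dm`. -/
lemma measurePreserving_sigma [IsFiniteMeasure m] [NullSingletonClass m] (hlam : radius hβ t < lam)
    (hq : realDigitSeries t lam (quasiOne β) = 1)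
    (hm : ∀ a, m.real (Iic a) = realDigitSeries t lam a.seq) :
    MeasurePreserving (sigma hβ) (equilibrium t lam m) (equilibrium t lam m) := by
  refine ⟨measurable_sigma hβ, Measure.ext fun A hA => ?_⟩
  have h0 : (lam : ℂ) ≠ 0 := by exact_mod_cast (pos_of_radius hlam).ne'
  rw [Measure.map_apply (measurable_sigma hβ) hA, equilibrium_apply hβ hlam hA,
    equilibrium_apply hβ hlam (measurable_sigma hβ hA)]
  have hint : Integrable (fun x => (density t lam x : ℂ) *
      A.indicator (1 : BetaShift β → ℂ) (sigma hβ x)) m := by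
    refine (integrable_density hβ hlam).mul_bdd (c := 1) ?_ (Eventually.of_forall fun x => ?_)
    · exact ((measurable_const.indicator hA).comp (measurable_sigma hβ)).aestronglyMeasurable
    · by_cases hx : sigma hβ x ∈ A <;> simp [hx]
  have h1 := integral_transferFun hβ hlam hq hm hint
  simp only [transferFun_mul_comp_sigma, transferFun_density hβ hlam hq, mul_assoc] at h1
  rw [integral_const_mul] at h1
  rw [mul_left_cancel₀ h0 h1]
  rfl

end equilibrium

/-! ### Multiplication on `𝓕` -/

section multiplication

variable {β : ℝ}

/-- Multiplication by a function of bounded variation on the quotient space `𝓑`. -/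
def mulQuot (g : BV β) : BVQuot β →L[ℂ] BVQuot β :=
  (negligible β).liftQL ((negligible β).mkQL.comp (BV.mul g)) fun f hf => by
    obtain ⟨C, hC, hf⟩ := hf
    have h : BV.mul g f ∈ negligible β :=
      ⟨C, hC, fun x hx => by rw [BV.mul_apply, hf x hx, mul_zero]⟩
    simpa using h

lemma mulQuot_chiBV_mem (a : ℕ → Fin 2) {b : BVQuot β} (hb : b ∈ spaceF β) :
    mulQuot (chiBV β a) b ∈ spaceF β := by
  have h : stepSpan β ≤ (stepSpan β).comap (mulQuot (chiBV β a) : BVQuot β →ₗ[ℂ] BVQuot β) := by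
    refine Submodule.span_le.2 ?_
    rintro _ ⟨f, I, hI, hf, rfl⟩
    refine Submodule.subset_span ⟨BV.mul (chiBV β a) f, _,
      (isLowerSet_le β a).ordConnected.inter hI, fun x => ?_, rfl⟩
    rw [BV.mul_apply, hf, chiBV_apply, inter_indicator_one]
    rfl
  exact map_mem_closure (mulQuot (chiBV β a)).continuous hb fun x hx => h hx

lemma mulQuot_eigenBV_mem (hβ : 1 < β ∧ β ≤ 2) {t lam : ℝ} (hlam : radius hβ t < lam) {f : BV β}
    (hf : cls f ∈ spaceF β) : cls (BV.mul (eigenBV β t lam) f) ∈ spaceF β := by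
  have hcomm : BV.mul (eigenBV β t lam) f = BV.mul f (eigenBV β t lam) :=
    BV.ext_iff'.2 fun x => mul_comm _ _
  rw [hcomm]
  have h1 := ((hasSum_eigenBV hβ hlam).mapL (BV.mul f)).mapL (negligible β).mkQL
  have hclosed : IsClosed (spaceF β : Set (BVQuot β)) :=
    Submodule.isClosed_topologicalClosure (stepSpan β)
  refine hclosed.mem_of_tendsto h1 (Eventually.of_forall fun s => sum_mem fun n _ => ?_)
  rw [map_smul, map_smul]
  refine Submodule.smul_mem _ _ ?_
  have hcomm' : BV.mul f (chiBV β (shift^[n] (quasiOne β))) =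
      BV.mul (chiBV β (shift^[n] (quasiOne β))) f := BV.ext_iff'.2 fun x => mul_comm _ _
  rw [hcomm']
  exact mulQuot_chiBV_mem _ hf

end multiplication

/-! ### The spectral gap -/

lemma exists_norm_pow_le {A : Type*} [NormedRing A] [NormedAlgebra ℂ A] [CompleteSpace A] (a : A)
    {α θ : ℝ} (hα : ∀ z ∈ spectrum ℂ a, ‖z‖ ≤ α) (h0 : 0 ≤ α) (hθ : α < θ) :
    ∃ K, ∀ n, ‖a ^ n‖ ≤ K * θ ^ n := by
  have hθ0 : 0 < θ := h0.trans_lt hθ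
  have h1 : spectralRadius ℂ a ≤ ENNReal.ofReal α := by
    refine iSup₂_le fun z hz => ?_
    rw [← enorm_eq_nnnorm, ← ofReal_norm]
    exact ENNReal.ofReal_le_ofReal (hα z hz)
  have h2 : ∀ᶠ n : ℕ in atTop, ‖a ^ n‖ / θ ^ n ≤ 1 := by
    filter_upwards [(spectrum.pow_norm_pow_one_div_tendsto_nhds_spectralRadius a).eventually_lt_const
      (h1.trans_lt ((ENNReal.ofReal_lt_ofReal_iff hθ0).2 hθ)), eventually_gt_atTop 0] with n hn hn0
    rw [ENNReal.ofReal_lt_ofReal_iff hθ0, one_div] at hn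
    rw [div_le_one (by positivity)]
    have h3 := pow_le_pow_left₀ (Real.rpow_nonneg (norm_nonneg _) _) hn.le n
    rwa [Real.rpow_inv_natCast_pow (norm_nonneg _) hn0.ne'] at h3
  obtain ⟨K, hK⟩ := (isBoundedUnder_of_eventually_le h2).bddAbove_range
  refine ⟨K, fun n => ?_⟩
  rw [← div_le_iff₀ (by positivity)]
  exact hK ⟨n, rfl⟩

section gap

variable {β : ℝ} (hβ : 1 < β ∧ β ≤ 2) {t lam α : ℝ} {ν : spaceF β →L[ℂ] ℂ}

/-- Beyond `r_t`, the equation `(z - 𝓛_t) g = f` can be solved for `f` in the kernel of the eigenfunctional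
for `z`. -/
lemma exists_smul_sub_eq {z : ℂ} (hz : radius hβ t < ‖z‖) (hφ : phi β t z⁻¹ = 1)
    (hν : IsEigenfunctional (transferOp hβ t) z ν) (h1 : ν (oneF β) = 1) {f : spaceF β}
    (hf : ν f = 0) : ∃ g, z • g - transferOp hβ t g = f := by
  obtain ⟨U, ν', δ, hU, -, h3, -, h5, -⟩ := exists_quasi_resolvent hβ hz
  have hν' : IsEigenfunctional (transferOp hβ t) z ν' := ContinuousLinearMap.ext fun f => by
    have := h3 f
    rw [hφ, sub_self, zero_mul, map_sub, map_smul] at this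
    exact (sub_eq_zero.1 this).symm
  have heq := eigenfunctional_unique hβ hz hν h1 hν' (h5.trans hφ)
  refine ⟨U f, ?_⟩
  rw [hU, ← heq, hf, zero_smul, sub_zero]

/-- After subtracting the spectral projection at `lam`, the spectrum of `𝓛_t` lies in the disc whose
radius is the largest modulus of the other roots. -/
lemma norm_le_of_mem_spectrum_sub (hlam : radius hβ t < lam)
    (hq : realDigitSeries t lam (quasiOne β) = 1) (hr : radius hβ t ≤ α)
    (hα : ∀ z : ℂ, phi β t z⁻¹ = 1 → z ≠ lam → ‖z‖ ≤ α)
    (hν : IsEigenfunctional (transferOp hβ t) lam ν) (h1 : ν (oneF β) = 1)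
    (hu : ν (orbitSeries β t lam (quasiOne β)) ≠ 0) {z : ℂ}
    (hz : z ∈ spectrum ℂ (transferOp hβ t - ((lam : ℂ) / ν (orbitSeries β t lam (quasiOne β))) •
      ν.smulRight (orbitSeries β t lam (quasiOne β)))) : ‖z‖ ≤ α := by
  by_contra! hlt
  have hzr : radius hβ t < ‖z‖ := hr.trans_lt hlt
  have hz0 := ne_zero_of_radius hzr
  have hφ : phi β t (lam : ℂ)⁻¹ = 1 := by rw [phi_inv_ofReal, hq, Complex.ofReal_one]
  have hLu := transferOp_orbitSeries hβ (radius_lt_norm hlam) hφ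
  set u := orbitSeries β t lam (quasiOne β) with hu_def
  set N := transferOp hβ t - ((lam : ℂ) / ν u) • ν.smulRight u with hN
  have hNf : ∀ f, N f = transferOp hβ t f - (lam / ν u * ν f) • u := fun f => by
    rw [hN]
    simp [smul_smul]
  have hνL : ∀ f, ν (transferOp hβ t f) = lam * ν f := fun f => DFunLike.congr_fun hν f
  have hνN : ∀ f, ν (N f) = 0 := fun f => by
    rw [hNf, map_sub, map_smul, hνL, smul_eq_mul]
    field_simp
    ring
  refine spectrum.mem_iff.1 hz (ContinuousLinearMap.isUnit_iff_bijective.2 ?_)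
  have happ : ∀ f, (algebraMap ℂ (spaceF β →L[ℂ] spaceF β) z - N) f = z • f - N f := fun f => rfl
  constructor
  · refine (injective_iff_map_eq_zero _).2 fun f hf => ?_
    rw [happ] at hf
    have h2 : ν f = 0 := by
      have h3 := congrArg ν hf
      rw [map_sub, hνN, sub_zero, map_smul, map_zero] at h3
      exact (mul_eq_zero.1 h3).resolve_left hz0
    rw [hNf, h2, mul_zero, zero_smul, sub_zero] at hf
    by_cases hne : z = lam
    · obtain ⟨c, rfl⟩ := eigenvector_eq_smul hβ (radius_lt_norm hlam)
        (show transferOp hβ t f = (lam : ℂ) • f by rw [← hne]; exact (sub_eq_zero.1 hf).symm)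
      rw [map_smul] at h2
      rw [(mul_eq_zero.1 h2).resolve_right hu, zero_smul]
    · refine (bijective_smul_sub hβ hzr fun h => ?_).1 (a₁ := f) (a₂ := 0) (by simpa using hf)
      exact hlt.not_ge (hα z h hne)
  · intro f
    -- Applying `ν` to `z g - N g = f` forces `ν g = ν f / z`.
    set f' := f - (lam / z / ν u * ν f) • u with hf'
    have hνf' : ν f' = (z - lam) * (ν f / z) := by
      rw [hf', map_sub, map_smul, smul_eq_mul]
      field_simp
    suffices h : ∃ g, z • g - transferOp hβ t g = f' ∧ ν g = ν f / z by
      obtain ⟨g, hg, hνg⟩ := h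
      refine ⟨g, ?_⟩
      rw [happ, hNf, hνg, ← sub_add, hg, hf', sub_add, sub_eq_self, sub_eq_zero]
      congr 1
      field_simp
    by_cases hne : z = lam
    · subst hne
      obtain ⟨g, hg⟩ := exists_smul_sub_eq hβ hzr hφ hν h1
        (show ν f' = 0 by rw [hνf', sub_self, zero_mul])
      refine ⟨g + ((ν f / lam - ν g) / ν u) • u, ?_, ?_⟩
      · rw [smul_add, map_add, map_smul, hLu, smul_comm (lam : ℂ), add_sub_add_right_eq_sub, hg]
      · rw [map_add, map_smul, smul_eq_mul, div_mul_cancel₀ _ hu]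
        ring
    · obtain ⟨g, hg⟩ := (bijective_smul_sub hβ hzr fun h => hlt.not_ge (hα z h hne)).2 f'
      refine ⟨g, hg, ?_⟩
      have h2 := congrArg ν hg
      simp only [map_sub, map_smul, hνL, smul_eq_mul] at h2
      rw [hνf', ← sub_mul] at h2
      exact mul_left_cancel₀ (sub_ne_zero.2 hne) h2

/-- Exponential convergence of `lam⁻ⁿ 𝓛_tⁿ` to the spectral projection. -/
theorem exists_norm_pow_sub_le (hlam : radius hβ t < lam)
    (hq : realDigitSeries t lam (quasiOne β) = 1) (hr : radius hβ t ≤ α)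
    (hα : ∀ z : ℂ, phi β t z⁻¹ = 1 → z ≠ lam → ‖z‖ ≤ α)
    (hν : IsEigenfunctional (transferOp hβ t) lam ν) (h1 : ν (oneF β) = 1)
    (hu : ν (orbitSeries β t lam (quasiOne β)) ≠ 0) {θ : ℝ} (hθ : α < θ) :
    ∃ K, ∀ n f, ‖(transferOp hβ t ^ n) f - ((lam : ℂ) ^ n * (ν f /
      ν (orbitSeries β t lam (quasiOne β)))) • orbitSeries β t lam (quasiOne β)‖ ≤
        K * ‖f‖ * θ ^ n := by
  have hα0 : 0 ≤ α := (zero_le_one.trans (one_le_radius hβ t)).trans hr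
  have hφ : phi β t (lam : ℂ)⁻¹ = 1 := by rw [phi_inv_ofReal, hq, Complex.ofReal_one]
  obtain ⟨K, hK⟩ := exists_norm_pow_le _
    (fun z hz => norm_le_of_mem_spectrum_sub hβ hlam hq hr hα hν h1 hu hz) hα0 hθ
  have hLu := transferOp_orbitSeries hβ (radius_lt_norm hlam) hφ
  set u := orbitSeries β t lam (quasiOne β) with hu_def
  set N := transferOp hβ t - ((lam : ℂ) / ν u) • ν.smulRight u with hN
  have hNf : ∀ f, ν f = 0 → N f = transferOp hβ t f := fun f hf => by
    rw [hN]
    simp [hf]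
  have hνL : ∀ f, ν (transferOp hβ t f) = lam * ν f := fun f => DFunLike.congr_fun hν f
  have hpow : ∀ n f, ν f = 0 → (transferOp hβ t ^ n) f = (N ^ n) f := by
    intro n
    induction n with
    | zero => intro f _; rfl
    | succ n ih =>
      intro f hf
      rw [pow_succ, pow_succ]
      change (transferOp hβ t ^ n) (transferOp hβ t f) = (N ^ n) (N f)
      rw [hNf f hf, ih _ (by rw [hνL, hf, mul_zero])]
  have hpowu : ∀ n, (transferOp hβ t ^ n) u = (lam : ℂ) ^ n • u := by
    intro n
    induction n with
    | zero => simp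
    | succ n ih =>
      rw [pow_succ]
      change (transferOp hβ t ^ n) (transferOp hβ t u) = _
      rw [hLu, map_smul, ih, smul_smul, pow_succ']
  have hK0 : 0 ≤ K := by
    have := hK 0
    rw [pow_zero θ, mul_one] at this
    exact (norm_nonneg _).trans this
  refine ⟨K * (1 + ‖ν‖ / ‖ν u‖ * ‖u‖), fun n f => ?_⟩
  have h2 : ν (f - (ν f / ν u) • u) = 0 := by
    rw [map_sub, map_smul, smul_eq_mul, div_mul_cancel₀ _ hu, sub_self]
  have h3 := hpow n _ h2
  rw [map_sub, map_smul, hpowu, smul_smul, mul_comm (ν f / ν u)] at h3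
  rw [h3]
  refine ((N ^ n).le_opNorm _).trans ?_
  have h4 : ‖f - (ν f / ν u) • u‖ ≤ (1 + ‖ν‖ / ‖ν u‖ * ‖u‖) * ‖f‖ := by
    refine (norm_sub_le _ _).trans ?_
    rw [norm_smul, norm_div, add_mul, one_mul]
    have h5 := ν.le_opNorm f
    have h6 : ‖ν f‖ / ‖ν u‖ ≤ ‖ν‖ * ‖f‖ / ‖ν u‖ := by gcongr
    have h7 := mul_le_mul_of_nonneg_right h6 (norm_nonneg u)
    have h8 : ‖ν‖ * ‖f‖ / ‖ν u‖ * ‖u‖ = ‖ν‖ / ‖ν u‖ * ‖u‖ * ‖f‖ := by ring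
    linarith
  have hθ0 : 0 ≤ θ ^ n := pow_nonneg (hα0.trans hθ.le) n
  calc ‖N ^ n‖ * ‖f - (ν f / ν u) • u‖
      ≤ (K * θ ^ n) * ((1 + ‖ν‖ / ‖ν u‖ * ‖u‖) * ‖f‖) :=
        mul_le_mul (hK n) h4 (norm_nonneg _) (mul_nonneg hK0 hθ0)
    _ = _ := by ring

end gap

/-! ### Decay of correlations -/

section decay

variable {β : ℝ} (hβ : 1 < β ∧ β ≤ 2) {t lam : ℝ} {m : Measure (BetaShift β)}

lemma HasCorrelationBound.mono {hβ : 1 < β ∧ β ≤ 2} {μ : Measure (BetaShift β)} {ρ ρ' : ℝ}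
    (h : HasCorrelationBound hβ μ ρ) (h0 : 0 ≤ ρ) (hρ : ρ ≤ ρ') : HasCorrelationBound hβ μ ρ' := by
  obtain ⟨K, hK, h⟩ := h
  refine ⟨K, hK, fun f g hf hg n hn => (h f g hf hg n hn).trans ?_⟩
  have : 0 ≤ ∫ x, ‖g x‖ ∂μ := integral_nonneg fun _ => norm_nonneg _
  gcongr

/-- The density is bounded below by `1 / F(t)`. -/
lemma integrable_of_equilibrium (hlam : radius hβ t < lam) {g : BetaShift β → ℂ}
    (hg : Integrable g (equilibrium t lam m)) : Integrable g m := by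
  have h1 := (integrable_equilibrium_iff hβ hlam g).1 hg
  have h2 : Integrable (fun x => ((density t lam x)⁻¹ : ℂ) * ((density t lam x : ℂ) * g x)) m := by
    refine h1.bdd_mul (c := ∑' n, normTerm β t lam n) ?_ (Eventually.of_forall fun x => ?_)
    · exact (Complex.measurable_ofReal.comp (measurable_density hβ hlam)).inv.aestronglyMeasurable
    · rw [← Complex.ofReal_inv, Complex.norm_real,
        Real.norm_of_nonneg (inv_nonneg.2 (density_pos hβ hlam x).le)]
      exact inv_le_of_inv_le₀ (tsum_normTerm_pos hβ hlam) (inv_le_density hβ hlam x)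
  refine h2.congr (Eventually.of_forall fun x => ?_)
  have : (density t lam x : ℂ) ≠ 0 := by exact_mod_cast (density_pos hβ hlam x).ne'
  change (density t lam x : ℂ)⁻¹ * (density t lam x * g x) = g x
  rw [inv_mul_cancel_left₀ this]

lemma integral_norm_le_equilibrium (hlam : radius hβ t < lam) {g : BetaShift β → ℂ}
    (hg : Integrable g (equilibrium t lam m)) :
    ∫ x, ‖g x‖ ∂m ≤ (∑' n, normTerm β t lam n) * ∫ x, ‖g x‖ ∂(equilibrium t lam m) := by
  have hF := tsum_normTerm_pos hβ hlam
  have h1 : ∫ x, ‖g x‖ ∂(equilibrium t lam m) = ∫ x, density t lam x * ‖g x‖ ∂m := by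
    rw [equilibrium, integral_withDensity_eq_integral_toReal_smul
      (measurable_density hβ hlam).ennreal_ofReal
      (Eventually.of_forall fun _ => ENNReal.ofReal_lt_top)]
    simp only [ENNReal.toReal_ofReal (density_pos hβ hlam _).le, smul_eq_mul]
  have h2 : Integrable (fun x => density t lam x * ‖g x‖) m := by
    refine ((integrable_equilibrium_iff hβ hlam g).1 hg).norm.congr (Eventually.of_forall fun x => ?_)
    change ‖(density t lam x : ℂ) * g x‖ = _
    rw [norm_mul, Complex.norm_real, Real.norm_of_nonneg (density_pos hβ hlam x).le]
  rw [h1, ← integral_const_mul]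
  refine integral_mono (integrable_of_equilibrium hβ hlam hg).norm (h2.const_mul _) fun x => ?_
  have h3 := inv_le_density hβ hlam x
  rw [inv_le_iff_one_le_mul₀ hF] at h3
  change ‖g x‖ ≤ _ * (density t lam x * ‖g x‖)
  rw [← mul_assoc]
  refine le_mul_of_one_le_left (norm_nonneg _) ?_
  linarith

lemma cls_transferBV_iterate (t : ℝ) (n : ℕ) {k : BV β} (hk : cls k ∈ spaceF β) :
    cls ((transferBV hβ t ^ n) k) = ((transferOp hβ t ^ n) ⟨cls k, hk⟩ : spaceF β) := by
  induction n generalizing k with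
  | zero => rfl
  | succ n ih =>
    rw [pow_succ, pow_succ]
    exact ih (transferQuot_mem hβ t _ hk)

/-- Conformality, iterated. -/
lemma integral_mul_comp_iterate [IsFiniteMeasure m] [NullSingletonClass m]
    (hlam : radius hβ t < lam) (hq : realDigitSeries t lam (quasiOne β) = 1)
    (hm : ∀ a, m.real (Iic a) = realDigitSeries t lam a.seq) {g : BetaShift β → ℂ}
    (hg : ∀ n, Integrable (fun x => g ((sigma hβ)^[n] x)) m) (n : ℕ) {k : BV β}
    (hk : cls k ∈ spaceF β) :
    (lam : ℂ) ^ n * ∫ x, k x * g ((sigma hβ)^[n] x) ∂m = ∫ x, (transferBV hβ t ^ n) k x * g x ∂m := by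
  induction n generalizing k with
  | zero => simp
  | succ n ih =>
    have hint : Integrable (fun x => k x * g ((sigma hβ)^[n + 1] x)) m :=
      (hg (n + 1)).bdd_mul (aestronglyMeasurable_of_mem m hk) (Eventually.of_forall k.norm_apply_le)
    have h1 := integral_transferFun hβ hlam hq hm hint
    have h2 : ∀ x, transferFun hβ (potential t) (fun y => k y * g ((sigma hβ)^[n + 1] y)) x =
        transferBV hβ t k x * g ((sigma hβ)^[n] x) := fun x =>
      transferFun_mul_comp_sigma hβ t k (fun y => g ((sigma hβ)^[n] y)) x
    simp only [h2] at h1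
    rw [pow_succ, mul_assoc, ← h1, pow_succ]
    exact ih (transferQuot_mem hβ t _ hk)

lemma norm_integral_mul_le [IsFiniteMeasure m] [NullSingletonClass m] (d : BV β)
    {g : BetaShift β → ℂ} (hg : Integrable g m) :
    ‖∫ x, d x * g x ∂m‖ ≤ ‖cls d‖ * ∫ x, ‖g x‖ ∂m := by
  rw [← integral_const_mul]
  refine norm_integral_le_of_norm_le (hg.norm.const_mul _) ?_
  filter_upwards [ae_norm_le_cls m d] with x hx
  rw [norm_mul]
  gcongr

/-- With `k = f h_t`, the correlation is the integral of `(lam⁻ⁿ 𝓛_tⁿ k - ν(k) h_t) g` against the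
conformal measure, and the first factor decays in `𝓕`. -/
theorem hasCorrelationBound [IsProbabilityMeasure m] [NullSingletonClass m] {α : ℝ}
    (hlam : radius hβ t < lam) (hq : realDigitSeries t lam (quasiOne β) = 1)
    (hm : ∀ a, m.real (Iic a) = realDigitSeries t lam a.seq) (hr : radius hβ t ≤ α)
    (hα : ∀ z : ℂ, phi β t z⁻¹ = 1 → z ≠ lam → ‖z‖ ≤ α) {ν : spaceF β →L[ℂ] ℂ}
    (hν : IsEigenfunctional (transferOp hβ t) lam ν) (h1 : ν (oneF β) = 1)
    (hrep : Represents m ν) {θ : ℝ} (hθ : α < θ) :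
    HasCorrelationBound hβ (equilibrium t lam m) (θ / lam) := by
  have h0 := pos_of_radius hlam
  have hlam0 : (lam : ℂ) ≠ 0 := by exact_mod_cast h0.ne'
  have hθ0 : 0 < θ := (zero_lt_one.trans_le (one_le_radius hβ t)).trans_le (hr.trans hθ.le)
  have hu := apply_orbitSeries_ne_zero hβ hlam (fun f => nonneg_of_represents m hrep) h1
  obtain ⟨K, hK⟩ := exists_norm_pow_sub_le hβ hlam hq hr hα hν h1 hu hθ
  set u := orbitSeries β t lam (quasiOne β) with hu_def
  set E := eigenBV β t lam with hE
  have hEF := cls_eigenBV_mem hβ hlam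
  have hEu : (⟨cls E, hEF⟩ : spaceF β) = (lam : ℂ) • u := Subtype.ext (cls_eigenBV hβ hlam)
  set F : ℝ := ∑' n, normTerm β t lam n with hF_def
  have hF : 0 < F := tsum_normTerm_pos hβ hlam
  have hF0 : (F : ℂ) ≠ 0 := by exact_mod_cast hF.ne'
  have hνE : lam * ν u = F := by
    rw [← integral_eigenBV hβ hlam hm, ← (hrep E hEF).2, hEu, map_smul, smul_eq_mul]
  have hpres := measurePreserving_sigma hβ hlam hq hm
  have hprob := isProbabilityMeasure_equilibrium hβ hlam hm
  set Q := mulQuot ((F : ℂ)⁻¹ • E) with hQ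
  have hK0 : 0 ≤ max K 0 := le_max_right _ _
  refine ⟨max K 0 * ‖Q‖ * F + 1, by positivity, fun f g hf hg n _ => ?_⟩
  set k : BV β := BV.mul ((F : ℂ)⁻¹ • E) f with hk_def
  have hkx : ∀ x, k x = density t lam x * f x := fun x => by
    rw [hk_def, BV.mul_apply, BV.smul_apply, ofReal_density hβ hlam]
  have hkE : k = (F : ℂ)⁻¹ • BV.mul E f := BV.ext_iff'.2 fun x => by
    rw [hk_def, BV.mul_apply, BV.smul_apply, BV.smul_apply, BV.mul_apply, mul_assoc]
  have hk : cls k ∈ spaceF β := by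
    rw [hkE, cls_smul]
    exact Submodule.smul_mem _ _ (mulQuot_eigenBV_mem hβ hlam hf)
  set κ : spaceF β := ⟨cls k, hk⟩ with hκ
  have hκn : ‖κ‖ ≤ ‖Q‖ * ‖cls f‖ := Q.le_opNorm (cls f)
  have hg' : ∀ n, Integrable (fun x => g ((sigma hβ)^[n] x)) m := fun n =>
    integrable_of_equilibrium hβ hlam ((hpres.iterate n).integrable_comp_of_integrable hg)
  have hgm : Integrable g m := hg' 0
  -- The function whose integral against `g` is the correlation.
  set d : BV β := ((lam : ℂ) ^ n)⁻¹ • (transferBV hβ t ^ n) k - (ν κ * (F : ℂ)⁻¹) • E with hd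
  have hcorr : (∫ x, f x * g ((sigma hβ)^[n] x) ∂(equilibrium t lam m)) -
      (∫ x, f x ∂(equilibrium t lam m)) * ∫ x, g x ∂(equilibrium t lam m) =
        ∫ x, d x * g x ∂m := by
    have e1 : ∫ x, f x * g ((sigma hβ)^[n] x) ∂(equilibrium t lam m) =
        ((lam : ℂ) ^ n)⁻¹ * ∫ x, (transferBV hβ t ^ n) k x * g x ∂m := by
      rw [← integral_mul_comp_iterate hβ hlam hq hm hg' n hk, inv_mul_cancel_left₀
        (pow_ne_zero _ hlam0), integral_equilibrium hβ hlam]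
      simp only [hkx, mul_assoc]
    have e2 : ∫ x, f x ∂(equilibrium t lam m) = ν κ := by
      rw [(hrep k hk).2, integral_equilibrium hβ hlam]
      simp only [hkx]
    have e3 : ∫ x, g x ∂(equilibrium t lam m) = (F : ℂ)⁻¹ * ∫ x, E x * g x ∂m := by
      rw [integral_equilibrium hβ hlam, ← integral_const_mul]
      simp only [ofReal_density hβ hlam, mul_assoc]
      rfl
    have i1 : Integrable (fun x => (transferBV hβ t ^ n) k x * g x) m := by
      refine hgm.bdd_mul (aestronglyMeasurable_of_mem m ?_)
        (Eventually.of_forall ((transferBV hβ t ^ n) k).norm_apply_le)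
      rw [cls_transferBV_iterate hβ t n hk]
      exact Subtype.coe_prop _
    have i2 : Integrable (fun x => E x * g x) m :=
      hgm.bdd_mul (aestronglyMeasurable_of_mem m hEF) (Eventually.of_forall E.norm_apply_le)
    rw [e1, e2, e3, ← mul_assoc, ← integral_const_mul, ← integral_const_mul,
      ← integral_sub (i1.const_mul _) (i2.const_mul _)]
    refine integral_congr_ae (Eventually.of_forall fun x => ?_)
    simp only [hd, BV.sub_apply, BV.smul_apply]
    ring
  have hdn : ‖cls d‖ ≤ max K 0 * ‖κ‖ * (θ / lam) ^ n := by
    have h2 : cls d = ((((lam : ℂ) ^ n)⁻¹ • ((transferOp hβ t ^ n) κ -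
        ((lam : ℂ) ^ n * (ν κ / ν u)) • u) : spaceF β) : BVQuot β) := by
      rw [hd, cls_sub, cls_smul, cls_smul, cls_transferBV_iterate hβ t n hk,
        show cls E = (((lam : ℂ) • u : spaceF β) : BVQuot β) from congrArg Subtype.val hEu,
        smul_sub, smul_smul, inv_mul_cancel_left₀ (pow_ne_zero _ hlam0)]
      push_cast
      rw [smul_smul]
      congr 2
      rw [← hνE]
      field_simp
    rw [h2, ← Submodule.coe_norm, norm_smul, norm_inv, norm_pow, Complex.norm_real,
      Real.norm_of_nonneg h0.le, div_pow, inv_mul_eq_div, ← mul_div_assoc (max K 0 * ‖κ‖)]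
    refine div_le_div_of_nonneg_right ((hK n κ).trans ?_) (by positivity)
    gcongr
    exact le_max_left _ _
  rw [correlation, hcorr]
  have hG : 0 ≤ ∫ x, ‖g x‖ ∂(equilibrium t lam m) := integral_nonneg fun _ => norm_nonneg _
  calc ‖∫ x, d x * g x ∂m‖ ≤ ‖cls d‖ * ∫ x, ‖g x‖ ∂m := norm_integral_mul_le d hgm
    _ ≤ (max K 0 * (‖Q‖ * ‖cls f‖) * (θ / lam) ^ n) *
        (F * ∫ x, ‖g x‖ ∂(equilibrium t lam m)) := by
      refine mul_le_mul (hdn.trans ?_) (integral_norm_le_equilibrium hβ hlam hg)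
        (integral_nonneg fun _ => norm_nonneg _) (by positivity)
      gcongr
    _ = (max K 0 * ‖Q‖ * F) * ‖cls f‖ * (∫ x, ‖g x‖ ∂(equilibrium t lam m)) * (θ / lam) ^ n := by
      ring
    _ ≤ _ := by
      gcongr
      linarith

end decay

end

end BetaRPF

open BetaRPF

theorem theorem3p7 (β : ℝ) (hβ : 1 < β ∧ β ≤ 2) (t : ℝ) :
    (∀ lam : ℂ, IsIsolatedEigenvalue (transferOp hβ t) lam → radius hβ t < ‖lam‖ →
      Module.finrank ℂ
          (Module.End.eigenspace (transferOp hβ t : Module.End ℂ (spaceF β)) lam) = 1 ∧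
      (∃! ν : spaceF β →L[ℂ] ℂ, IsEigenfunctional (transferOp hβ t) lam ν ∧ ν (oneF β) = 1) ∧
      (∀ ν : spaceF β →L[ℂ] ℂ, IsEigenfunctional (transferOp hβ t) lam ν → ν (oneF β) = 1 →
        ∀ a ∈ betaSet β, HasSum
          (fun n : ℕ => ((a n : ℕ) : ℂ) * (weight t a n : ℂ) / lam ^ (n + 1)) (ν (chi β a))) ∧
      (∃ g : spaceF β, HasSum (eigenTerm β t lam) g ∧
        ∀ h : spaceF β, transferOp hβ t h = lam • h → ∃ C : ℂ, h = C • g)) ∧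
    (∃ (lam : ℝ) (ν : spaceF β →L[ℂ] ℂ), IsPerronPair hβ t lam ν) ∧
    ∀ (lam : ℝ) (ν : spaceF β →L[ℂ] ℂ), IsPerronPair hβ t lam ν →
      radius hβ t < lam ∧
      IsIsolatedEigenvalue (transferOp hβ t) lam ∧
      Module.finrank ℂ
          (Module.End.maxGenEigenspace (transferOp hβ t : Module.End ℂ (spaceF β)) lam) = 1 ∧
      (Summable (normTerm β t lam) ∧ 0 < ∑' n, normTerm β t lam n) ∧
      (∀ x : BetaShift β, Summable (densityTerm t lam x)) ∧
      (∀ z : ℂ, IsIsolatedEigenvalue (transferOp hβ t) z → radius hβ t < ‖z‖ → z ≠ lam →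
        ‖z‖ < lam) ∧
      ∃ m : Measure (BetaShift β), IsProbabilityMeasure m ∧ (∀ x, m {x} = 0) ∧ Represents m ν ∧
        (∀ a : BetaShift β, HasSum
          (fun n : ℕ => ((a.seq n : ℕ) : ℝ) * weight t a.seq n / lam ^ (n + 1))
          (m.real (Set.Iic a))) ∧
        IsProbabilityMeasure (equilibrium t lam m) ∧
        MeasurePreserving (sigma hβ) (equilibrium t lam m) (equilibrium t lam m) ∧
        ∃ α : ℝ,
          IsGreatest ({radius hβ t} ∪
            {s : ℝ | ∃ z : ℂ, 1 - phi β t z⁻¹ = 0 ∧ z ≠ lam ∧ s = ‖z‖}) α ∧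
          radius hβ t ≤ α ∧ α < lam ∧
          HasCorrelationBound hβ (equilibrium t lam m) α ∧
          (∀ θ : ℝ, α < θ → HasCorrelationBound hβ (equilibrium t lam m) (θ / lam)) ∧
          ∃ ρ : ℝ, 0 < ρ ∧ ρ < 1 ∧ HasCorrelationBound hβ (equilibrium t lam m) ρ := by
  refine ⟨fun lam hlam hr => ?_, exists_perronPair hβ t, fun lam ν h => ?_⟩
  · obtain ⟨f, hf0, hf⟩ := exists_eigenvector hlam.1
    have hφ := phi_eq_one_of_eigenvector hβ hr hf0 hf
    exact ⟨finrank_eigenspace hβ hr hlam.1, existsUnique_eigenfunctional hβ hr hφ,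
      fun ν hν h1 a ha => hasSum_eigenfunctional_chi hβ hr hν h1 ha, exists_hasSum_eigenTerm hβ hr⟩
  · obtain ⟨hlam, hq⟩ := h.root hβ
    have hnorm := radius_lt_norm hlam
    have hu := apply_orbitSeries_ne_zero hβ hlam h.nonneg h.normalized
    obtain ⟨m, hm, hmV⟩ := exists_measure hβ hlam hq
    have hatom := measure_singleton_eq_zero hβ hlam hq hmV
    have : NullSingletonClass m := ⟨hatom⟩
    have hrep : Represents m ν := represents_of_chi m hβ fun a => by
      rw [eigenfunctional_chi hβ hnorm h.eigenfunctional h.normalized a.mem, hmV,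
        ofReal_realDigitSeries]
    obtain ⟨α, hα, hαlam⟩ := exists_isGreatest hβ hlam hq
    have hr : radius hβ t ≤ α := hα.2 (Or.inl rfl)
    have hroots : ∀ z : ℂ, phi β t z⁻¹ = 1 → z ≠ lam → ‖z‖ ≤ α := fun z hz hne =>
      hα.2 (Or.inr ⟨z, by rw [hz, sub_self], hne, rfl⟩)
    have hα1 : 1 ≤ α := (one_le_radius hβ t).trans hr
    have hbound : ∀ θ, α < θ → HasCorrelationBound hβ (equilibrium t lam m) (θ / lam) :=
      fun θ hθ => hasCorrelationBound hβ hlam hq hmV hr hroots h.eigenfunctional h.normalized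
        hrep hθ
    obtain ⟨θ, hθ, hθlam⟩ := exists_between hαlam
    have hρ0 : 0 < θ / lam := div_pos (by linarith) h.pos
    have hρ1 : θ / lam < 1 := (div_lt_one h.pos).2 hθlam
    refine ⟨hlam, isIsolatedEigenvalue hβ hnorm h.eigenvalue,
      finrank_maxGenEigenspace hβ hnorm h.eigenvalue h.eigenfunctional hu,
      ⟨summable_normTerm hβ hlam, tsum_normTerm_pos hβ hlam⟩, summable_densityTerm hβ hlam,
      fun z hz hzr hne => ?_, m, hm, hatom, hrep, fun a => ?_,
      isProbabilityMeasure_equilibrium hβ hlam hmV, measurePreserving_sigma hβ hlam hq hmV,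
      α, hα, hr, hαlam, (hbound θ hθ).mono hρ0.le (by linarith), hbound,
      θ / lam, hρ0, hρ1, hbound θ hθ⟩
    · obtain ⟨f, hf0, hf⟩ := exists_eigenvector hz.1
      exact norm_lt_of_phi_eq_one hβ hlam hq (phi_eq_one_of_eigenvector hβ hzr hf0 hf) hne
    · rw [hmV]
      exact hasSum_realDigitSeries hβ hlam a.mem
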